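/- Fix $\varepsilon>0$. For $n\ge 1$ let $q=q(n)$ be $(1+\varepsilon)n$, rounded up or down to an integer, and colour each edge of the complete graph $K_n$ on $\{1,\dots,n\}$ independently and uniformly at random with one of $q$ colours. Given points $x_1,\dots,x_n\in[0,1]^2$, the length of the edge $\{i,j\}$ is the Euclidean distance $|x_i-x_j|$. A Hamilton cycle of $K_n$ is rainbow if its edges have pairwise distinct colours. Let $Z_{\mathrm{TSP}}$ be the minimum total length of a rainbow Hamilton cycle (defined when one exists) and $Z^*_{\mathrm{TSP}}$ the minimum total length of a Hamilton cycle regardless of colours. Then there are constants $C,c>0$ depending only on $\varepsilon$ such that, with probability tending to $1$ as $n\to\infty$, in each case a rainbow Hamilton cycle exists and the stated inequality holds: (a) if $x_1,\dots,x_n$ are independent uniformly random points of $[0,1]^2$, independent of the colouring, then $Z_{\mathrm{TSP}}\le C\sqrt n\,\log n$; and the same holds, with the same $C$, if for each $n$ the points $x_1,\dots,x_n\in[0,1]^2$ are fixed arbitrarily and only the colouring is random; (b) if $x_1,\dots,x_n$ are independent uniformly random points of $[0,1]^2$, independent of the colouring, then $Z_{\mathrm{TSP}}-Z^*_{\mathrm{TSP}}\ge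 c\sqrt n$. -/

import Mathlib

open MeasureTheory ProbabilityTheory Filter Topology

noncomputable section

namespace RainbowTour

/-- The Euclidean plane. -/
abbrev Plane : Type := EuclideanSpace ℝ (Fin 2)

/-- The unit square `[0,1]²`. -/
def unitSquare : Set Plane := {p | ∀ i, p i ∈ Set.Icc (0 : ℝ) 1}

/-- The uniform distribution on the unit square: Lebesgue measure restricted to it (the square
has area one, see `volume_unitSquare`). -/
def uniformSquare : Measure Plane := volume.restrict unitSquare

theorem volume_unitSquare : (volume : Measure Plane) unitSquare = 1 := by
  have h : unitSquare = (WithLp.ofLp : Plane → Fin 2 → ℝ) ⁻¹'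
      (Set.univ.pi fun _ => Set.Icc (0 : ℝ) 1) := by
    ext p
    simp only [unitSquare, Set.mem_ofPred_eq, Set.mem_preimage, Set.mem_univ_pi]
  rw [h, (PiLp.volume_preserving_ofLp (Fin 2)).measure_preimage
    (MeasurableSet.univ_pi fun _ => measurableSet_Icc).nullMeasurableSet]
  simp [volume_pi_pi, -Set.pi_univ_Icc]

/-- The complete graph on the vertex set `{0, …, n-1}`. -/
abbrev K (n : ℕ) : SimpleGraph (Fin n) := ⊤

/-- Colourings of the edges of the complete graph `K n` with `q` colours. -/
abbrev Colouring (n q : ℕ) : Type := (K n).edgeSet → Fin q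

/-- The law of a random colouring: the colours of the edges are independent and each is uniform
among the `q` colours. -/
def randomColouring (n q : ℕ) : Measure (Colouring n q) :=
  Measure.pi fun _ => uniformOn (Set.univ : Set (Fin q))

/-- The Euclidean model: `n` independent uniform points of the unit square together with an
independent uniformly random colouring of the edges by `q` colours. -/
def euclideanModel (n q : ℕ) : Measure ((Fin n → Plane) × Colouring n q) :=
  (Measure.pi fun _ => uniformSquare).prod (randomColouring n q)

variable {n q : ℕ}

/-- The length of an edge `{i, j}`: the distance between the points `x i` and `x j`. -/
def edgeLength (x : Fin n → Plane) : Sym2 (Fin n) → ℝ :=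
  Sym2.lift ⟨fun i j => dist (x i) (x j), fun i j => dist_comm (x i) (x j)⟩

/-- The total length of the edges of a walk. -/
def totalLength (x : Fin n → Plane) {a b : Fin n} (p : (K n).Walk a b) : ℝ :=
  (p.edges.map (edgeLength x)).sum

/-- The edges of a walk have pairwise distinct colours: distinct edges of it never share
a colour. -/
def IsRainbow (χ : Colouring n q) {a b : Fin n} (p : (K n).Walk a b) : Prop :=
  Set.InjOn χ {e | (e : Sym2 (Fin n)) ∈ p.edges}

/-- The lengths of all Hamilton cycles through the points. -/
def tourLengths (x : Fin n → Plane) : Set ℝ :=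
  {L | ∃ (a : Fin n) (p : (K n).Walk a a), p.IsHamiltonianCycle ∧ totalLength x p = L}

/-- The lengths of all rainbow Hamilton cycles through the points. -/
def rainbowTourLengths (x : Fin n → Plane) (χ : Colouring n q) : Set ℝ :=
  {L | ∃ (a : Fin n) (p : (K n).Walk a a),
    p.IsHamiltonianCycle ∧ IsRainbow χ p ∧ totalLength x p = L}

/-- There is a rainbow Hamilton cycle. -/
def HasRainbowTour (χ : Colouring n q) : Prop :=
  ∃ (a : Fin n) (p : (K n).Walk a a), p.IsHamiltonianCycle ∧ IsRainbow χ p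

/-- The minimum length of a Hamilton cycle through the points, without regard to colours. -/
def minTour (x : Fin n → Plane) : ℝ := sInf (tourLengths x)

/-- The minimum length of a rainbow Hamilton cycle through the points. It is meaningful only when
`HasRainbowTour χ` holds. -/
def minRainbowTour (x : Fin n → Plane) (χ : Colouring n q) : ℝ := sInf (rainbowTourLengths x χ)

end RainbowTour

end

/-! Upper bound. Colours are revealed only when they are needed. The construction accepts `n + O(log
n)` edges in all, while there are about `(1 + ε) n` colours, so at every moment a constant fraction
of the colours is unused. A fresh edge, or a fresh pair of edges, therefore receives new colours
with probability bounded below, and `m = Θ(log n)` disjoint trials all fail with probability at most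
`n⁻²`. This is `FailsAtMost.test`; a union bound over `O(n)` steps costs `3 / n`.

The vertices are split into two halves. In each half a path repeatedly moves to the nearest
unvisited vertex along an edge of a new colour, until `m` vertices are left (`greedy_path`). Each
step goes to one of the `m` nearest unvisited vertices, so a packing argument bounds the length of
the path by `O(√(m n))` (`IsGreedyPath.weight_le`). Both paths and the leftovers are then joined
into one cycle along the still unrevealed edges between the halves (`insert_items`). This takes
`O(m)` insertions, each costing `O(1)`. The estimate `rainbow_tour_fails_le` is uniform in the
points, which gives (a) for random and for fixed points alike.

Lower bound. A gadget is a very close pair `u`, `v`, with every other point at distance at least `R`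
from `v` and the circle of radius `R` about `v` densely surrounded by points. A tour that misses the
edge `uv` can be shortened by `R / 16` so that it contains `uv`, with at most six new edges
(`IsGadget.improve`). Iterating, a tour that misses `k` gadget edges exceeds the minimum by at least
`k R / 96` (`minTour_add_le_weight`). By a second moment computation, `n` random points contain
linearly many disjoint gadgets with `R` of order `1 / √n` (`exists_hasGadgets`). Since `q` is also
linear in `n`, the gadget edges have linearly many colour collisions (`prob_lt_card_image_le`). A
rainbow tour has to give up one edge per collision, hence loses order `n · 1 / √n = √n`
(`exists_gap`). -/

noncomputable section

namespace RainbowTour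

/-! ### Tours as lists of vertices, with multisets of edges. -/

section Lists

variable {V : Type*}

/-- The edges joining consecutive vertices of a list. -/
def pathEdges : List V → Multiset (Sym2 V)
  | [] => 0
  | [_] => 0
  | a :: b :: l => s(a, b) ::ₘ pathEdges (b :: l)

/-- The edges of the closed tour through the vertices of a list. -/
def cycleEdges : List V → Multiset (Sym2 V)
  | [] => 0
  | a :: l => pathEdges (a :: l ++ [a])

@[simp] theorem pathEdges_nil : pathEdges ([] : List V) = 0 := rfl

@[simp] theorem pathEdges_singleton (a : V) : pathEdges [a] = 0 := rfl

@[simp] theorem pathEdges_cons_cons (a b : V) (l : List V) :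
    pathEdges (a :: b :: l) = s(a, b) ::ₘ pathEdges (b :: l) := rfl

theorem pathEdges_append_cons (l₁ : List V) (a : V) (l₂ : List V) :
    pathEdges (l₁ ++ a :: l₂) = pathEdges (l₁ ++ [a]) + pathEdges (a :: l₂) := by
  induction l₁ with
  | nil => simp
  | cons b l ih =>
    cases l with
    | nil => simp
    | cons c l => simpa using ih

theorem pathEdges_cons {l : List V} (h : l ≠ []) (a : V) :
    pathEdges (a :: l) = s(a, l.head h) ::ₘ pathEdges l := by
  cases l with
  | nil => exact absurd rfl h
  | cons b l => rfl

theorem pathEdges_append {l₁ l₂ : List V} (h₁ : l₁ ≠ []) (h₂ : l₂ ≠ []) :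
    pathEdges (l₁ ++ l₂) =
      pathEdges l₁ + s(l₁.getLast h₁, l₂.head h₂) ::ₘ pathEdges l₂ := by
  induction l₁ with
  | nil => exact absurd rfl h₁
  | cons b l ih =>
    cases l with
    | nil => simp [pathEdges_cons h₂]
    | cons c l =>
      have := ih (by simp)
      simp only [List.cons_append, pathEdges_cons_cons] at this ⊢
      rw [this, List.getLast_cons (a := b) (List.cons_ne_nil c l), Multiset.cons_add]

theorem pathEdges_reverse (l : List V) : pathEdges l.reverse = pathEdges l := by
  induction l with
  | nil => rfl
  | cons a l ih =>
    by_cases h : l = []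
    · simp [h]
    · rw [List.reverse_cons, pathEdges_append (by simpa using h) (by simp), ih, pathEdges_cons h]
      simp [Sym2.eq_swap, add_comm, ← Multiset.singleton_add]

theorem cycleEdges_eq {l : List V} (h : l ≠ []) :
    cycleEdges l = s(l.getLast h, l.head h) ::ₘ pathEdges l := by
  cases l with
  | nil => exact absurd rfl h
  | cons a l =>
    rw [cycleEdges, pathEdges_append (by simp) (by simp)]
    simp [← Multiset.singleton_add, add_comm]

theorem cycleEdges_append_comm (l₁ l₂ : List V) :
    cycleEdges (l₁ ++ l₂) = cycleEdges (l₂ ++ l₁) := by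
  by_cases h₁ : l₁ = []
  · simp [h₁]
  by_cases h₂ : l₂ = []
  · simp [h₂]
  rw [cycleEdges_eq (by simp [h₁]), cycleEdges_eq (by simp [h₁]), pathEdges_append h₁ h₂,
    pathEdges_append h₂ h₁]
  simp only [List.head_append_of_ne_nil h₁, List.head_append_of_ne_nil h₂,
    List.getLast_append_of_ne_nil _ h₁, List.getLast_append_of_ne_nil _ h₂,
    ← Multiset.singleton_add]
  abel

theorem mem_of_mem_pathEdges {l : List V} {e : Sym2 V} (h : e ∈ pathEdges l) {v : V}
    (hv : v ∈ e) : v ∈ l := by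
  induction l with
  | nil => simp at h
  | cons a l ih =>
    cases l with
    | nil => simp at h
    | cons b l =>
      rw [pathEdges_cons_cons, Multiset.mem_cons] at h
      rcases h with rfl | h
      · rcases Sym2.mem_iff.1 hv with rfl | rfl <;> simp
      · exact List.mem_cons_of_mem _ (ih h)

end Lists

/-! ### Translation between Hamilton cycles and duplicate-free lists. -/

section Walks

theorem coe_edges_eq_pathEdges {V : Type*} {G : SimpleGraph V} {a b : V} (p : G.Walk a b) :
    (p.edges : Multiset (Sym2 V)) = pathEdges p.support := by
  induction p with
  | nil => simp
  | cons h p ih =>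
    rw [SimpleGraph.Walk.support_cons, pathEdges_cons (by simp), SimpleGraph.Walk.head_support,
      ← ih, SimpleGraph.Walk.edges_cons, Multiset.cons_coe]

theorem exists_walk_of_nodup {n : ℕ} (l : List (Fin n)) (b : Fin n) (hl : (b :: l).Nodup) :
    ∃ (c : Fin n) (p : (K n).Walk b c), p.support = b :: l := by
  induction l generalizing b with
  | nil => exact ⟨b, .nil, rfl⟩
  | cons d l ih =>
    obtain ⟨c, p, hp⟩ := ih d (List.nodup_cons.1 hl).2
    have hbd : (K n).Adj b d := by
      rintro rfl
      simp at hl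
    exact ⟨c, .cons hbd p, by simp [hp]⟩

/-- A duplicate-free enumeration of at least three vertices is traversed by a Hamilton cycle. -/
theorem exists_isHamiltonianCycle {n : ℕ} (hn : 3 ≤ n) (l : List (Fin n)) (hl : l.Nodup)
    (hm : ∀ v, v ∈ l) :
    ∃ (a : Fin n) (p : (K n).Walk a a), p.IsHamiltonianCycle ∧
      (p.edges : Multiset (Sym2 (Fin n))) = cycleEdges l := by
  have hlen : l.length = n := by
    have := Multiset.card_le_card (Multiset.le_iff_subset (s := (Finset.univ : Finset (Fin n)).1)
      (t := (l : Multiset (Fin n))) Finset.univ.2 |>.2 fun v _ => by simpa using hm v)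
    have h2 := hl.length_le_card
    simp at this h2
    omega
  match l, hlen with
  | [], h => simp at h; omega
  | [_], h => simp at h; omega
  | [_, _], h => simp at h; omega
  | a :: b :: c :: l, _ =>
    obtain ⟨e, p, hp⟩ := exists_walk_of_nodup (b :: c :: l) a hl
    have hpath : p.IsPath := by rw [SimpleGraph.Walk.isPath_def, hp]; exact hl
    have hlast : e = (b :: c :: l).getLast (by simp) := by
      have := p.getLast_support
      simp only [hp] at this
      rw [← this, List.getLast_cons (by simp)]
    have hea : e ≠ a := fun h => (List.nodup_cons.1 hl).1
      (h ▸ hlast.symm ▸ List.getLast_mem (l := b :: c :: l) (by simp))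
    have hadj : (K n).Adj e a := hea
    have hcyc : (SimpleGraph.Walk.cons hadj p).IsCycle := by
      rw [SimpleGraph.Walk.cons_isCycle_iff]
      refine ⟨hpath, fun hmem => ?_⟩
      have h' : s(e, a) ∈ pathEdges (a :: b :: c :: l) := by
        rw [← hp, ← coe_edges_eq_pathEdges]
        exact hmem
      rw [pathEdges_cons_cons, Multiset.mem_cons] at h'
      rcases h' with h' | h'
      · have heb : e = b := by
          rcases Sym2.eq_iff.1 h' with ⟨h1, _⟩ | ⟨h1, _⟩
          · exact absurd h1 hea
          · exact h1
        have : e ∈ c :: l := by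
          have h1 := List.getLast_mem (l := c :: l) (by simp)
          rwa [← List.getLast_cons (a := b), ← hlast] at h1
        exact (List.nodup_cons.1 (List.nodup_cons.1 hl).2).1 (heb ▸ this)
      · exact (List.nodup_cons.1 hl).1 (mem_of_mem_pathEdges h' (Sym2.mem_mk_right _ _))
    refine ⟨e, .cons hadj p, ?_, ?_⟩
    · rw [SimpleGraph.Walk.isHamiltonianCycle_iff_isCycle_and_support_count_tail_eq_one]
      refine ⟨hcyc, fun v => ?_⟩
      rw [SimpleGraph.Walk.support_cons, List.tail_cons, hp]
      exact List.count_eq_one_of_mem hl (hm v)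
    · rw [SimpleGraph.Walk.edges_cons, ← Multiset.cons_coe, coe_edges_eq_pathEdges, hp,
        cycleEdges_eq (by simp)]
      simp only [List.head_cons, hlast, List.getLast_cons (List.cons_ne_nil b (c :: l))]

theorem _root_.SimpleGraph.Walk.IsHamiltonianCycle.exists_list {n : ℕ} {a : Fin n}
    {p : (K n).Walk a a} (hp : p.IsHamiltonianCycle) :
    ∃ l : List (Fin n), l.Nodup ∧ (∀ v, v ∈ l) ∧
      (p.edges : Multiset (Sym2 (Fin n))) = cycleEdges l := by
  have hcount := (SimpleGraph.Walk.isHamiltonianCycle_iff_isCycle_and_support_count_tail_eq_one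
    (p := p)).1 hp
  cases p with
  | nil => exact absurd hcount.1 (by simp)
  | cons h q =>
    have hq := (SimpleGraph.Walk.cons_isCycle_iff _ _).1 hcount.1
    refine ⟨q.support, hq.1.support_nodup, fun v => ?_, ?_⟩
    · have := hcount.2 v
      rw [SimpleGraph.Walk.support_cons, List.tail_cons] at this
      exact List.count_pos_iff.1 (by omega)
    · rw [SimpleGraph.Walk.edges_cons, ← Multiset.cons_coe, coe_edges_eq_pathEdges,
        cycleEdges_eq (by simp), SimpleGraph.Walk.head_support, SimpleGraph.Walk.getLast_support]

variable {n q : ℕ}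

/-- The total length of a multiset of edges. -/
def weight (x : Fin n → Plane) (s : Multiset (Sym2 (Fin n))) : ℝ := (s.map (edgeLength x)).sum

@[simp] theorem weight_zero (x : Fin n → Plane) : weight x 0 = 0 := by simp [weight]

@[simp] theorem weight_add (x : Fin n → Plane) (s t : Multiset (Sym2 (Fin n))) :
    weight x (s + t) = weight x s + weight x t := by simp [weight]

@[simp] theorem weight_cons (x : Fin n → Plane) (a b : Fin n) (s : Multiset (Sym2 (Fin n))) :
    weight x (s(a, b) ::ₘ s) = dist (x a) (x b) + weight x s := by
  simp [weight, edgeLength]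

@[simp] theorem weight_singleton (x : Fin n → Plane) (a b : Fin n) :
    weight x {s(a, b)} = dist (x a) (x b) := by
  simp [weight, edgeLength]

theorem edgeLength_nonneg (x : Fin n → Plane) (e : Sym2 (Fin n)) : 0 ≤ edgeLength x e := by
  induction e with
  | _ a b => exact dist_nonneg (x := x a) (y := x b)

theorem weight_nonneg (x : Fin n → Plane) (s : Multiset (Sym2 (Fin n))) : 0 ≤ weight x s :=
  Multiset.sum_nonneg fun r hr => by
    obtain ⟨e, -, rfl⟩ := Multiset.mem_map.1 hr
    exact edgeLength_nonneg x e

theorem totalLength_eq_weight (x : Fin n → Plane) {a b : Fin n} (p : (K n).Walk a b) :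
    totalLength x p = weight x (p.edges : Multiset (Sym2 (Fin n))) := by
  simp [totalLength, weight]

theorem minTour_le (hn : 3 ≤ n) (x : Fin n → Plane) {l : List (Fin n)} (hl : l.Nodup)
    (hm : ∀ v, v ∈ l) : minTour x ≤ weight x (cycleEdges l) := by
  obtain ⟨a, p, hp, he⟩ := exists_isHamiltonianCycle hn l hl hm
  refine csInf_le ⟨0, ?_⟩ ⟨a, p, hp, by rw [totalLength_eq_weight, he]⟩
  rintro _ ⟨b, r, -, rfl⟩
  rw [totalLength_eq_weight]
  exact weight_nonneg _ _

theorem exists_rainbowTour_of_list (hn : 3 ≤ n) (x : Fin n → Plane) (χ : Sym2 (Fin n) → Fin q)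
    {l : List (Fin n)} (hl : l.Nodup) (hm : ∀ v, v ∈ l)
    (hχ : Set.InjOn χ {e | e ∈ cycleEdges l}) :
    HasRainbowTour (fun e : (K n).edgeSet => χ e) ∧
      minRainbowTour x (fun e : (K n).edgeSet => χ e) ≤ weight x (cycleEdges l) := by
  obtain ⟨a, p, hp, he⟩ := exists_isHamiltonianCycle hn l hl hm
  have hr : IsRainbow (fun e : (K n).edgeSet => χ e) p := by
    intro e h f h' hef
    refine Subtype.ext (hχ ?_ ?_ hef)
    · change _ ∈ cycleEdges l
      rw [← he]
      exact h
    · change _ ∈ cycleEdges l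
      rw [← he]
      exact h'
  refine ⟨⟨a, p, hp, hr⟩, csInf_le ⟨0, ?_⟩ ⟨a, p, hp, hr, by rw [totalLength_eq_weight, he]⟩⟩
  rintro _ ⟨b, r, -, -, rfl⟩
  rw [totalLength_eq_weight]
  exact weight_nonneg _ _

/-- A lower bound for all rainbow tours, seen as lists, bounds the shortest one. -/
theorem le_minRainbowTour (x : Fin n → Plane) (χ : Colouring n q) (h : HasRainbowTour χ) (b : ℝ)
    (hb : ∀ l : List (Fin n), l.Nodup → (∀ v, v ∈ l) →
      (∀ e f : (K n).edgeSet, (e : Sym2 (Fin n)) ∈ cycleEdges l →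
        (f : Sym2 (Fin n)) ∈ cycleEdges l → χ e = χ f → e = f) → b ≤ weight x (cycleEdges l)) :
    b ≤ minRainbowTour x χ := by
  obtain ⟨a, p, hp, hr⟩ := h
  refine le_csInf ⟨_, a, p, hp, hr, rfl⟩ ?_
  rintro _ ⟨c, r, hr, hrr, rfl⟩
  obtain ⟨l, hl, hm, he⟩ := hr.exists_list
  rw [totalLength_eq_weight, he]
  refine hb l hl hm fun e f h h' hef => hrr ?_ ?_ hef
  · change _ ∈ (r.edges : Multiset (Sym2 (Fin n)))
    rwa [he]
  · change _ ∈ (r.edges : Multiset (Sym2 (Fin n)))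
    rwa [he]

end Walks

/-! ### Probability on finite types by counting. -/

section Counting

variable {Ω Ω' : Type*} [Fintype Ω] [Fintype Ω']

open Classical in
/-- The proportion of the elements of a finite type that satisfy a predicate. -/
def prob (P : Ω → Prop) : ℝ := ((Finset.univ.filter P).card : ℝ) / Fintype.card Ω

theorem prob_nonneg (P : Ω → Prop) : 0 ≤ prob P := by unfold prob; positivity

theorem prob_mono {P Q : Ω → Prop} (h : ∀ ω, P ω → Q ω) : prob P ≤ prob Q := by
  classical
  unfold prob
  gcongr with ω
  exact h ω

theorem prob_le_one (P : Ω → Prop) : prob P ≤ 1 := by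
  classical
  unfold prob
  exact div_le_one_of_le₀ (by exact_mod_cast Finset.card_le_univ _) (by positivity)

theorem prob_def (P : Ω → Prop) [DecidablePred P] :
    prob P = ((Finset.univ.filter P).card : ℝ) / Fintype.card Ω := by
  unfold prob
  congr!

theorem prob_add_le_one {P Q : Ω → Prop} (h : ∀ ω, P ω → ¬ Q ω) : prob P + prob Q ≤ 1 := by
  classical
  rw [prob_def, prob_def, ← add_div, ← Nat.cast_add, ← Finset.card_union_of_disjoint]
  · exact div_le_one_of_le₀ (by exact_mod_cast Finset.card_le_univ _) (by positivity)
  · rw [Finset.disjoint_left]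
    intro ω h1 h2
    exact h ω (Finset.mem_filter.1 h1).2 (Finset.mem_filter.1 h2).2

theorem prob_eq_sum (P : Ω → Prop) [DecidablePred P] :
    prob P = (∑ ω, if P ω then (1 : ℝ) else 0) / Fintype.card Ω := by
  classical
  unfold prob
  simp only [Finset.sum_boole]
  congr!

theorem prob_prod_eq (P : Ω → Ω' → Prop) :
    prob (fun z : Ω × Ω' => P z.1 z.2) = (∑ ω, prob (P ω)) / Fintype.card Ω := by
  classical
  rw [prob_eq_sum, Fintype.sum_prod_type, Fintype.card_prod]
  simp only [prob_eq_sum, ← Finset.sum_div]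
  push_cast
  rw [div_div, mul_comm]

theorem prob_fst (P : Ω → Prop) [Nonempty Ω'] :
    prob (fun z : Ω × Ω' => P z.1) = prob P := by
  classical
  rw [prob_prod_eq (fun ω (_ : Ω') => P ω), prob_eq_sum P]
  congr 1
  refine Finset.sum_congr rfl fun ω _ => ?_
  by_cases h : P ω <;> simp [h, prob]

theorem prob_equiv (e : Ω ≃ Ω') (P : Ω' → Prop) : prob (fun ω => P (e ω)) = prob P := by
  classical
  rw [prob_eq_sum, prob_eq_sum, Fintype.card_congr e,
    Equiv.sum_comp e (fun ω => if P ω then (1 : ℝ) else 0)]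

theorem prob_and_prod (A : Ω → Prop) (B : Ω' → Prop) :
    prob (fun z : Ω × Ω' => A z.1 ∧ B z.2) = prob A * prob B := by
  classical
  rw [prob_prod_eq (fun ω ω' => A ω ∧ B ω'), prob_eq_sum A, div_mul_eq_mul_div, Finset.sum_mul]
  congr 1
  refine Finset.sum_congr rfl fun ω _ => ?_
  by_cases h : A ω
  · simp [h]
  · simp [h, prob]

/-- Averaging over the second coordinate outside a bad event for the first one. -/
theorem prob_prod_le {P : Ω → Ω' → Prop} {B : Ω → Prop} {δ : ℝ} (hδ : 0 ≤ δ)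
    (h : ∀ ω, ¬ B ω → prob (P ω) ≤ δ) :
    prob (fun z : Ω × Ω' => P z.1 z.2) ≤ prob B + δ := by
  classical
  rw [prob_prod_eq, prob_eq_sum B]
  rcases isEmpty_or_nonempty Ω with hΩ | hΩ
  · simpa using hδ
  have hc : (0 : ℝ) < Fintype.card Ω := by exact_mod_cast Fintype.card_pos
  rw [div_add' _ _ _ hc.ne', div_le_div_iff_of_pos_right hc]
  have : δ * Fintype.card Ω = ∑ _ω : Ω, δ := by simp [mul_comm]
  rw [this, ← Finset.sum_add_distrib]
  refine Finset.sum_le_sum fun ω _ => ?_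
  by_cases hB : B ω
  · simp only [hB, if_true]
    linarith [prob_le_one (P ω)]
  · simp only [hB, if_false]
    linarith [h ω hB]

end Counting

/-! ### Revealing a random colouring piece by piece. -/

section Exposure

variable {E : Type*} [Fintype E] [DecidableEq E] {q : ℕ}

/-- Exchange the values of two functions outside a set of coordinates. -/
def exchange (F : Finset E) : ((E → Fin q) × (E → Fin q)) ≃ ((E → Fin q) × (E → Fin q)) where
  toFun z := (F.piecewise z.1 z.2, F.piecewise z.2 z.1)
  invFun z := (F.piecewise z.1 z.2, F.piecewise z.2 z.1)
  left_inv z := by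
    ext e <;> by_cases h : e ∈ F <;> simp [h]
  right_inv z := by
    ext e <;> by_cases h : e ∈ F <;> simp [h]

/-- `exchange` is a bijection of the pairs of colourings, so the mixture of two independent uniform
colourings is again uniform. All independence arguments below rest on this. -/
theorem prob_resample (F : Finset E) (P : (E → Fin q) → Prop) :
    prob (fun z : (E → Fin q) × (E → Fin q) => P (F.piecewise z.1 z.2)) = prob P := by
  rcases isEmpty_or_nonempty (E → Fin q) with h | h
  · simp [prob]
  rw [← prob_fst (Ω' := E → Fin q) P, ← prob_equiv (exchange F) (fun z => P z.1)]
  rfl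

/-- Given the values of the colouring `χ` on the revealed set `F`, the conditional probability
that `T` fails is at most `δ`. -/
def FailsAtMost (F : Finset E) (χ : E → Fin q) (δ : ℝ) (T : (E → Fin q) → Prop) : Prop :=
  prob (fun ω => ¬ T (F.piecewise χ ω)) ≤ δ

/-- Reveal more coordinates, giving up on an unlikely event. -/
theorem FailsAtMost.step {F F' : Finset E} (hF : F ⊆ F') {χ : E → Fin q} {δ₁ δ₂ : ℝ}
    (hδ : 0 ≤ δ₂) {T B : (E → Fin q) → Prop} (hB : prob (fun ω => B (F.piecewise χ ω)) ≤ δ₁)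
    (h : ∀ χ' : E → Fin q, (∀ e ∈ F, χ' e = χ e) → ¬ B χ' → FailsAtMost F' χ' δ₂ T) :
    FailsAtMost F χ (δ₁ + δ₂) T := by
  unfold FailsAtMost
  -- The colouring is sampled in two rounds: `z.1` supplies the colours on `F'`, which decide `B`,
  -- and `z.2` supplies the rest.
  rw [← prob_resample F']
  have key : ∀ z : (E → Fin q) × (E → Fin q), F.piecewise χ (F'.piecewise z.1 z.2) =
      F'.piecewise (F.piecewise χ z.1) z.2 := by
    intro z
    ext e
    by_cases h1 : e ∈ F
    · simp [h1, hF h1]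
    · by_cases h2 : e ∈ F' <;> simp [h1, h2]
  simp only [key]
  refine (prob_prod_le (P := fun ω ω' => ¬ T (F'.piecewise (F.piecewise χ ω) ω'))
    (B := fun ω => B (F.piecewise χ ω)) hδ fun ω hω => ?_).trans (by linarith)
  exact h _ (fun e he => by simp [he]) hω

theorem FailsAtMost.mono {F : Finset E} {χ : E → Fin q} {δ δ' : ℝ}
    {T : (E → Fin q) → Prop} (h : FailsAtMost F χ δ T) (hδ : δ ≤ δ') : FailsAtMost F χ δ' T :=
  le_trans h hδ

theorem FailsAtMost.of_forall {F : Finset E} {χ : E → Fin q} {T : (E → Fin q) → Prop}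
    (h : ∀ χ' : E → Fin q, (∀ e ∈ F, χ' e = χ e) → T χ') : FailsAtMost F χ 0 T := by
  unfold FailsAtMost
  refine le_of_eq ?_
  have : ∀ ω, T (F.piecewise χ ω) := fun ω => h _ fun e he => by simp [he]
  simp [prob, this]

/-- Events depending on disjoint sets of coordinates are independent. -/
theorem prob_forall_le_pow {ι : Type*} [DecidableEq ι] (I : Finset ι) (S : ι → Finset E)
    (hS : ∀ i ∈ I, ∀ j ∈ I, i ≠ j → Disjoint (S i) (S j)) (G : ι → (E → Fin q) → Prop)
    (hG : ∀ i ∈ I, ∀ ω ω' : E → Fin q, (∀ e ∈ S i, ω e = ω' e) → G i ω → G i ω') {β : ℝ}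
    (hβ : ∀ i ∈ I, prob (G i) ≤ β) : prob (fun ω => ∀ i ∈ I, G i ω) ≤ β ^ I.card := by
  induction I using Finset.induction_on with
  | empty => simpa using prob_le_one _
  | insert a I ha ih =>
    have h0 : 0 ≤ β := (prob_nonneg _).trans (hβ a (by simp))
    -- With the coordinates in `S a` taken from one sample and all others from a second one, `G a`
    -- depends on the first sample only and the remaining events on the second only.
    rw [← prob_resample (S a), Finset.card_insert_of_notMem ha, pow_succ']
    have h1 : ∀ z : (E → Fin q) × (E → Fin q),
        (∀ i ∈ insert a I, G i ((S a).piecewise z.1 z.2)) → G a z.1 ∧ ∀ i ∈ I, G i z.2 := by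
      intro z hz
      refine ⟨hG a (by simp) _ _ (fun e he => by simp [he]) (hz a (by simp)), fun i hi => ?_⟩
      have hia : i ≠ a := fun h => ha (h ▸ hi)
      refine hG i (by simp [hi]) _ _ (fun e he => ?_) (hz i (by simp [hi]))
      have : e ∉ S a := fun h' =>
        Finset.disjoint_left.1 (hS i (by simp [hi]) a (by simp) hia) he h'
      simp [this]
    refine (prob_mono h1).trans ?_
    rw [prob_and_prod (G a) (fun ω => ∀ i ∈ I, G i ω)]
    exact mul_le_mul (hβ a (by simp))
      (ih (fun i hi j hj => hS i (by simp [hi]) j (by simp [hj])) (fun i hi => hG i (by simp [hi]))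
        fun i hi => hβ i (by simp [hi])) (prob_nonneg _) h0

theorem card_pi_filter (S : E → Finset (Fin q)) :
    prob (fun ω : E → Fin q => ∀ e, ω e ∈ S e) = ∏ e, ((S e).card : ℝ) / q := by
  classical
  rw [prob_def]
  have : (Finset.univ.filter fun ω : E → Fin q => ∀ e, ω e ∈ S e) = Fintype.piFinset S := by
    ext ω
    simp
  rw [this, Fintype.card_piFinset, Finset.prod_div_distrib]
  simp

/-- Two unrevealed edges receive new, distinct colours with probability at least `(s / q) ^ 2`. -/
theorem prob_not_injOn_le {s q : ℕ} (hq : 0 < q) (es : Finset E) (χ : E → Fin q)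
    (hs : 2 * s + es.card ≤ q) (hχ : Set.InjOn χ es) {e f : E} (he : e ∉ es) (hf : f ∉ es) :
    prob (fun ω : E → Fin q =>
      ¬ Set.InjOn (es.piecewise χ ω) (insert e (insert f es) : Finset E)) ≤
      1 - ((s : ℝ) / q) ^ 2 := by
  classical
  have hfree : 2 * s ≤ ((es.image χ)ᶜ).card := by
    rw [Finset.card_compl, Fintype.card_fin]
    have := Finset.card_image_le (s := es) (f := χ)
    omega
  obtain ⟨S₁, hS₁, hc₁⟩ := Finset.exists_subset_card_eq (show s ≤ ((es.image χ)ᶜ).card by omega)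
  obtain ⟨S₂, hS₂, hc₂⟩ := Finset.exists_subset_card_eq
    (show s ≤ ((es.image χ)ᶜ \ S₁).card by
      have := Finset.le_card_sdiff S₁ (es.image χ)ᶜ
      omega)
  have hq' : (0 : ℝ) < q := by exact_mod_cast hq
  have hsq : (s : ℝ) / q ≤ 1 := by
    rw [div_le_one hq']
    exact_mod_cast (by omega : s ≤ q)
  -- It suffices that `e` and `f` take colours from two disjoint sets of `s` unused colours. If `e =
  -- f`, only the first requirement remains, and `s / q` is at least `(s / q) ^ 2`.
  let S : E → Finset (Fin q) := fun g => if g = e then S₁ else if g = f then S₂ else Finset.univ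
  have hgood : ∀ ω : E → Fin q, (∀ g, ω g ∈ S g) →
      Set.InjOn (es.piecewise χ ω) (insert e (insert f es) : Finset E) := by
    intro ω hω
    have h1 : ω e ∈ S₁ := by simpa [S] using hω e
    have h1' : ω e ∉ es.image χ := by simpa using hS₁ h1
    have h2 : e = f ∨ ω f ∈ S₂ := by
      by_cases hef : f = e
      · exact Or.inl hef.symm
      · right; simpa [S, hef] using hω f
    have h2' : e = f ∨ (ω f ∉ es.image χ ∧ ω e ≠ ω f) := by
      refine h2.imp id fun h => ?_
      have := Finset.mem_sdiff.1 (hS₂ h)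
      exact ⟨by simpa using this.1, fun h' => this.2 (h' ▸ h1)⟩
    have hes : Set.InjOn (es.piecewise χ ω) es := by
      intro a ha b hb hab
      rw [Finset.mem_coe] at ha hb
      rw [Finset.piecewise_eq_of_mem _ _ _ ha, Finset.piecewise_eq_of_mem _ _ _ hb] at hab
      exact hχ ha hb hab
    have himg : (es.piecewise χ ω) '' (es : Set E) = (es.image χ : Finset _) := by
      rw [Finset.coe_image]
      exact Set.image_congr fun a ha => Finset.piecewise_eq_of_mem _ _ _ ha
    have hve : es.piecewise χ ω e = ω e := Finset.piecewise_eq_of_notMem _ _ _ he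
    have hvf : es.piecewise χ ω f = ω f := Finset.piecewise_eq_of_notMem _ _ _ hf
    rcases h2' with rfl | ⟨h3, h4⟩
    · rw [Finset.insert_idem, Finset.coe_insert, Set.injOn_insert (by simpa using he)]
      exact ⟨hes, by rw [himg, hve]; exact_mod_cast h1'⟩
    · have hef : e ≠ f := fun h => h4 (by rw [h])
      rw [Finset.coe_insert, Set.injOn_insert (by simpa [hef] using he), Finset.coe_insert,
        Set.injOn_insert (by simpa using hf), Set.image_insert_eq, himg, hve, hvf]
      refine ⟨⟨hes, by exact_mod_cast h3⟩, ?_⟩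
      rw [Set.mem_insert_iff, not_or]
      exact ⟨h4, by exact_mod_cast h1'⟩
  have hprob : ((s : ℝ) / q) ^ 2 ≤ prob (fun ω : E → Fin q => ∀ g, ω g ∈ S g) := by
    rw [card_pi_filter]
    have hle : ∀ g, (if g = e then (s : ℝ) / q else 1) * (if g = f then (s : ℝ) / q else 1) ≤
        ((S g).card : ℝ) / q := by
      intro g
      have h0 : (0 : ℝ) ≤ s / q := by positivity
      by_cases hge : g = e
      · simp only [S, hge, if_true, hc₁]
        split_ifs <;> nlinarith
      · by_cases hgf : g = f
        · simp only [S, hgf]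
          split_ifs with h
          · exact absurd (hgf.trans h) hge
          · rw [hc₂, one_mul]
        · simp [S, hge, hgf, hq'.ne']
    calc ((s : ℝ) / q) ^ 2 = ∏ g, ((if g = e then (s : ℝ) / q else 1) *
          (if g = f then (s : ℝ) / q else 1)) := by
          rw [Finset.prod_mul_distrib]
          simp [sq]
      _ ≤ _ := by
          refine Finset.prod_le_prod (fun g _ => ?_) fun g _ => hle g
          split_ifs <;> positivity
  have hsum : prob (fun ω : E → Fin q => ∀ g, ω g ∈ S g) + prob (fun ω : E → Fin q =>
      ¬ Set.InjOn (es.piecewise χ ω) (insert e (insert f es) : Finset E)) ≤ 1 :=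
    prob_add_le_one fun ω h1 h2 => h2 (hgood ω h1)
  linarith

/-- Test disjoint pairs of unrevealed edges until one of them can be added rainbow. -/
theorem FailsAtMost.test {s q : ℕ} (hq : 0 < q) {F F' es : Finset E} {χ : E → Fin q}
    (hes : es ⊆ F) (hF : F ⊆ F') (hχ : Set.InjOn χ es) (hs : 2 * s + es.card ≤ q) {ι : Type*}
    (I : Finset ι) (e f : ι → E) (he : ∀ i ∈ I, e i ∉ F) (hf : ∀ i ∈ I, f i ∉ F)
    (hef : ∀ i ∈ I, ∀ j ∈ I, i ≠ j → e i ≠ e j ∧ e i ≠ f j ∧ f i ≠ f j) {δ : ℝ} (hδ : 0 ≤ δ)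
    {T : (E → Fin q) → Prop}
    (h : ∀ χ' : E → Fin q, (∀ g ∈ F, χ' g = χ g) →
      (∃ i ∈ I, Set.InjOn χ' (insert (e i) (insert (f i) es) : Finset E)) →
        FailsAtMost F' χ' δ T) :
    FailsAtMost F χ ((1 - ((s : ℝ) / q) ^ 2) ^ I.card + δ) T := by
  classical
  refine FailsAtMost.step hF hδ
    (B := fun χ' => ∀ i ∈ I, ¬ Set.InjOn χ' (insert (e i) (insert (f i) es) : Finset E)) ?_ ?_
  · have hcongr : ∀ i ∈ I, ∀ ω ω' : E → Fin q, (∀ g ∈ ({e i, f i} : Finset E), ω g = ω' g) →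
        Set.EqOn (es.piecewise χ ω) (es.piecewise χ ω') (insert (e i) (insert (f i) es) :
          Finset E) := by
      intro i hi ω ω' hω g hg
      by_cases hges : g ∈ es
      · simp [hges]
      · rw [Finset.piecewise_eq_of_notMem _ _ _ hges, Finset.piecewise_eq_of_notMem _ _ _ hges]
        refine hω g ?_
        simp only [Finset.coe_insert, Set.mem_insert_iff, Finset.mem_coe, hges, or_false] at hg
        simpa using hg
    refine (prob_mono fun ω hω i hi => ?_).trans (prob_forall_le_pow I (fun i => {e i, f i})
      ?_ (fun i ω => ¬ Set.InjOn (es.piecewise χ ω) (insert (e i) (insert (f i) es) : Finset E))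
      ?_ fun i hi => prob_not_injOn_le hq es χ hs hχ (fun h => he i hi (hes h))
        fun h => hf i hi (hes h))
    · intro hinj
      refine hω i hi (hinj.congr fun g hg => ?_)
      by_cases hges : g ∈ es
      · simp [hges, hes hges]
      · simp only [Finset.coe_insert, Set.mem_insert_iff, Finset.mem_coe, hges, or_false] at hg
        have hgF : g ∉ F := by
          rcases hg with rfl | rfl
          · exact he i hi
          · exact hf i hi
        simp [hges, hgF]
    · intro i hi j hj hij
      have h1 := hef i hi j hj hij
      have h2 := hef j hj i hi (Ne.symm hij)
      simp only [Finset.disjoint_insert_left, Finset.disjoint_singleton_left,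
        Finset.mem_insert, Finset.mem_singleton, not_or]
      exact ⟨⟨h1.1, h1.2.1⟩, h2.2.1.symm, h1.2.2⟩
    · intro i hi ω ω' hω h1 h2
      exact h1 (h2.congr (hcongr i hi ω ω' hω).symm)
  · intro χ' h1 h2
    push Not at h2
    exact h χ' h1 h2

end Exposure

/-! ### The rainbow nearest neighbour path. -/

section Greedy

variable {n q : ℕ}

theorem exists_subset_nearest {α : Type*} [DecidableEq α] (f : α → ℝ) (W : Finset α) (m : ℕ)
    (hm : m ≤ W.card) : ∃ M ⊆ W, M.card = m ∧ ∀ z ∈ W, z ∉ M → ∀ y ∈ M, f y ≤ f z := by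
  induction m with
  | zero => exact ⟨∅, by simp, rfl, by simp⟩
  | succ m ih =>
    obtain ⟨M, hM, hc, h⟩ := ih (by omega)
    obtain ⟨a, ha, hmin⟩ := Finset.exists_min_image (W \ M) f
      (Finset.card_pos.1 (by rw [Finset.card_sdiff_of_subset hM]; omega))
    rw [Finset.mem_sdiff] at ha
    refine ⟨insert a M, Finset.insert_subset ha.1 hM, by simp [ha.2, hc], ?_⟩
    intro z hz hzM y hy
    rw [Finset.mem_insert, not_or] at hzM
    rcases Finset.mem_insert.1 hy with rfl | hy
    · exact hmin z (Finset.mem_sdiff.2 ⟨hz, hzM.2⟩)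
    · exact h z hz hzM.2 y hy

/-- In the list `P` (latest vertex first) with unvisited vertices `W`, each vertex is followed by
one such that fewer than `m` of the vertices visited later are strictly nearer. -/
def IsGreedyPath (x : Fin n → Plane) (m : ℕ) (W : Finset (Fin n)) (P : List (Fin n)) : Prop :=
  ∀ A v w B, P = A ++ v :: w :: B →
    ((W ∪ A.toFinset).filter fun z => dist (x w) (x z) < dist (x w) (x v)).card < m

theorem isGreedyPath_singleton (x : Fin n → Plane) (m : ℕ) (W : Finset (Fin n)) (w : Fin n) :
    IsGreedyPath x m W [w] := by
  intro A v u B h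
  have := congrArg List.length h
  simp at this
  omega

/-- Moving `v` from `W` to the path does not change the set of vertices visited after an older
vertex, so only the newest step has to be checked. -/
theorem IsGreedyPath.cons {x : Fin n → Plane} {m : ℕ} {W : Finset (Fin n)} {w v : Fin n}
    {P : List (Fin n)} (h : IsGreedyPath x m W (w :: P)) (hv : v ∈ W)
    (hc : ((W.erase v).filter fun z => dist (x w) (x z) < dist (x w) (x v)).card < m) :
    IsGreedyPath x m (W.erase v) (v :: w :: P) := by
  intro A a b B hAB
  cases A with
  | nil =>
    simp only [List.nil_append, List.cons.injEq] at hAB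
    obtain ⟨rfl, rfl, rfl⟩ := hAB
    simpa using hc
  | cons c A =>
    simp only [List.cons_append, List.cons.injEq] at hAB
    obtain ⟨rfl, hP⟩ := hAB
    have := h A a b B hP
    rwa [List.toFinset_cons, Finset.union_insert, ← Finset.insert_union, Finset.insert_erase hv]

/-- The state of the exploration: the edges `es` have been revealed and have distinct colours. -/
structure Explored (F es : Finset (Sym2 (Fin n))) (χ : Sym2 (Fin n) → Fin q) : Prop where
  subset : es ⊆ F
  injOn : Set.InjOn χ es

theorem Explored.insert_pair {F F' es : Finset (Sym2 (Fin n))} {χ : Sym2 (Fin n) → Fin q}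
    (h : Explored F es χ) (hF : F ⊆ F') {e f : Sym2 (Fin n)} {χ' : Sym2 (Fin n) → Fin q}
    (he : e ∈ F') (hf : f ∈ F')
    (hi : Set.InjOn χ' (insert e (insert f es) : Finset (Sym2 (Fin n)))) :
    Explored F' (insert e (insert f es)) χ' :=
  ⟨Finset.insert_subset he (Finset.insert_subset hf (h.subset.trans hF)), hi⟩

/-- Moving always to the nearest unvisited vertex along an edge of a new colour, until `m`
vertices are left. -/
theorem greedy_path (x : Fin n → Plane) {m s N : ℕ} (hm : 0 < m) (hq : 0 < q)
    (hs : 2 * s + N ≤ q) {T : (Sym2 (Fin n) → Fin q) → Prop} {δ : ℝ} (hδ : 0 ≤ δ) (k : ℕ) :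
    ∀ (W : Finset (Fin n)) (w : Fin n) (P : List (Fin n)) (F es : Finset (Sym2 (Fin n)))
      (χ : Sym2 (Fin n) → Fin q), W.card = m + k → (w :: P).Nodup → (∀ z ∈ w :: P, z ∉ W) →
      IsGreedyPath x m W (w :: P) → (∀ e ∈ pathEdges (w :: P), e ∈ es) → Explored F es χ →
      es.card + k ≤ N → (∀ a ∈ insert w W, ∀ b ∈ insert w W, s(a, b) ∉ F) →
      (∀ (W' : Finset (Fin n)) (P' : List (Fin n)) (F' es' : Finset (Sym2 (Fin n)))
        (χ' : Sym2 (Fin n) → Fin q), W'.card = m → P' ≠ [] → P'.Nodup → (∀ z ∈ P', z ∉ W') →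
        P'.toFinset ∪ W' = (w :: P).toFinset ∪ W → IsGreedyPath x m W' P' →
        (∀ e ∈ pathEdges P', e ∈ es') → Explored F' es' χ' → es ⊆ es' →
        es'.card ≤ es.card + k →
        (∀ e ∈ F', e ∈ F ∨ ∃ a ∈ insert w W, ∃ b ∈ insert w W, e = s(a, b)) →
        FailsAtMost F' χ' δ T) →
      FailsAtMost F χ (k * (1 - ((s : ℝ) / q) ^ 2) ^ m + δ) T := by
  have hβ : 0 ≤ 1 - ((s : ℝ) / q) ^ 2 := by
    have hq' : (0 : ℝ) < q := by exact_mod_cast hq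
    have : (s : ℝ) / q ≤ 1 := by
      rw [div_le_one hq']
      exact_mod_cast (by omega : s ≤ q)
    have h0 : (0 : ℝ) ≤ s / q := by positivity
    nlinarith
  induction k with
  | zero =>
    intro W w P F es χ hW hnd hdis hg hes hex hN hfresh hcont
    have := hcont W (w :: P) F es χ (by simpa using hW) (by simp) hnd hdis rfl hg hes hex
      (Finset.Subset.refl _) (by omega) (fun e he => Or.inl he)
    simpa using this
  | succ k ih =>
    intro W w P F es χ hW hnd hdis hg hes hex hN hfresh hcont
    obtain ⟨M, hMW, hMc, hM⟩ := exists_subset_nearest (fun z => dist (x w) (x z)) W m (by omega)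
    have hwW : w ∉ W := hdis w (by simp)
    have key : FailsAtMost F χ ((1 - ((s : ℝ) / q) ^ 2) ^ M.card +
        (k * (1 - ((s : ℝ) / q) ^ 2) ^ m + δ)) T := by
      -- The tested pair is degenerate, both of its edges being `s(w, i)`. The trials run over the
      -- `m` nearest vertices, but every edge from `w` to `W` counts as revealed; edges inside the
      -- remaining set stay fresh.
      refine FailsAtMost.test (F' := F ∪ W.image fun z => s(w, z)) hq hex.subset
        Finset.subset_union_left hex.injOn (s := s) (by omega) M (fun i => s(w, i))
        (fun i => s(w, i)) (fun i hi => hfresh _ (by simp) _ (by simp [hMW hi]))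
        (fun i hi => hfresh _ (by simp) _ (by simp [hMW hi]))
        (fun i hi j hj hij => by
          have : s(w, i) ≠ s(w, j) := fun h => hij (Sym2.congr_right.1 h)
          exact ⟨this, this, this⟩) (by positivity) ?_
      rintro χ' hχ' ⟨y, hyM, hy⟩
      -- `v` is the nearest vertex of all of `W`, not just of `M`, that is reached by a new colour.
      -- A strictly nearer unvisited vertex lies in `M` and differs from `y`, so there are fewer
      -- than `m` of them.
      obtain ⟨v, hv, hmin⟩ := Finset.exists_min_image
        (W.filter fun z => Set.InjOn χ' (insert s(w, z) (insert s(w, z) es) :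
          Finset (Sym2 (Fin n)))) (fun z => dist (x w) (x z))
        ⟨y, Finset.mem_filter.2 ⟨hMW hyM, hy⟩⟩
      rw [Finset.mem_filter] at hv
      have hvW := hv.1
      have hvw : v ≠ w := fun h => hwW (h ▸ hvW)
      have hinj : Set.InjOn χ' (insert s(w, v) es : Finset (Sym2 (Fin n))) := by
        simpa using hv.2
      have hcard : ((W.erase v).filter fun z => dist (x w) (x z) < dist (x w) (x v)).card < m := by
        rw [← hMc]
        refine Finset.card_lt_card ?_
        rw [Finset.ssubset_iff_of_subset]
        · refine ⟨y, hyM, fun h => ?_⟩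
          rw [Finset.mem_filter] at h
          exact absurd h.2 (not_lt.2 (hmin y (Finset.mem_filter.2 ⟨hMW hyM, hy⟩)))
        · intro z hz
          rw [Finset.mem_filter] at hz
          by_contra hzM
          have h1 := hM z (Finset.mem_of_mem_erase hz.1) hzM y hyM
          have h2 := hmin y (Finset.mem_filter.2 ⟨hMW hyM, hy⟩)
          linarith [hz.2]
      have hins : insert v (W.erase v) = W := Finset.insert_erase hvW
      have hcin : (insert s(w, v) es).card ≤ es.card + 1 := Finset.card_insert_le _ _
      refine ih (W.erase v) v (w :: P) (F ∪ W.image fun z => s(w, z)) (insert s(w, v) es) χ'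
        (by rw [Finset.card_erase_of_mem hvW]; omega) ?_ ?_ (hg.cons hvW hcard) ?_
        ⟨Finset.insert_subset (Finset.mem_union_right _ (Finset.mem_image_of_mem _ hvW)) (hex.subset.trans Finset.subset_union_left), hinj⟩
        (by omega) ?_ ?_
      · rw [List.nodup_cons]
        exact ⟨fun h => hdis v h hvW, hnd⟩
      · intro z hz hz'
        rcases List.mem_cons.1 hz with rfl | hz
        · simp at hz'
        · exact hdis z hz (Finset.mem_of_mem_erase hz')
      · intro e he
        rw [pathEdges_cons_cons, Multiset.mem_cons] at he
        rcases he with rfl | he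
        · rw [Sym2.eq_swap]; simp
        · exact Finset.mem_insert_of_mem (hes e he)
      · intro a ha b hb
        rw [hins] at ha hb
        rw [Finset.mem_union, not_or]
        refine ⟨hfresh a (by simp [ha]) b (by simp [hb]), fun h => ?_⟩
        obtain ⟨z, -, hz⟩ := Finset.mem_image.1 h
        rcases Sym2.eq_iff.1 hz with ⟨rfl, _⟩ | ⟨rfl, _⟩
        · exact hwW ha
        · exact hwW hb
      · intro W' P' F' es' χ'' h1 h2 h3 h4 h5 h6 h7 h8 h9 h10 h11
        refine hcont W' P' F' es' χ'' h1 h2 h3 h4 ?_ h6 h7 h8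
          ((Finset.subset_insert _ _).trans h9) (by omega) ?_
        · rw [h5, List.toFinset_cons, Finset.insert_union, ← Finset.union_insert, hins]
        · intro e he
          rcases h11 e he with h | ⟨a, ha, b, hb, rfl⟩
          · rcases Finset.mem_union.1 h with h | h
            · exact Or.inl h
            · obtain ⟨z, hz, rfl⟩ := Finset.mem_image.1 h
              exact Or.inr ⟨w, by simp, z, by simp [hz], rfl⟩
          · rw [hins] at ha hb
            exact Or.inr ⟨a, by simp [ha], b, by simp [hb], rfl⟩
    refine key.mono (le_of_eq ?_)
    rw [hMc]
    push_cast
    ring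

end Greedy

/-! ### Splicing paths into a given path. -/

section Insertion

variable {n q : ℕ}

/-- The replaced edge `ab` stands on the left, so that the surgery is an identity of sums, without
multiset subtraction. -/
theorem pathEdges_insert {V : Type*} (L : List V) (a : V) {I : List V} (hI : I ≠ []) (b : V)
    (R : List V) :
    pathEdges (L ++ a :: (I ++ b :: R)) + {s(a, b)} =
      pathEdges (L ++ a :: b :: R) + {s(a, I.head hI)} + {s(I.getLast hI, b)} + pathEdges I := by
  rw [pathEdges_append_cons L a (I ++ b :: R), pathEdges_append_cons L a (b :: R),
    pathEdges_cons (by simp [hI]), pathEdges_append hI (by simp), pathEdges_cons_cons]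
  simp only [List.head_append_of_ne_nil hI, List.head_cons, ← Multiset.singleton_add]
  abel

theorem weight_pathEdges_insert_le (x : Fin n → Plane) {I : List (Fin n)} (hI : I ≠ [])
    (L R : List (Fin n)) (a b : Fin n) {D : ℝ} (hD : ∀ i j, dist (x i) (x j) ≤ D) :
    weight x (pathEdges (L ++ a :: (I ++ b :: R))) ≤
      weight x (pathEdges (L ++ a :: b :: R)) + weight x (pathEdges I) + 2 * D := by
  have h := congrArg (weight x) (pathEdges_insert L a hI b R)
  simp only [weight_add, weight_singleton] at h
  have h1 := hD a (I.head hI)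
  have h2 := hD (I.getLast hI) b
  have h3 := dist_nonneg (x := x a) (y := x b)
  linarith

theorem mem_pathEdges_insert {V : Type*} {L : List V} {a b : V} {I : List V} (hI : I ≠ [])
    {R : List V} {e : Sym2 V} (h : e ∈ pathEdges (L ++ a :: (I ++ b :: R))) :
    e ∈ pathEdges (L ++ a :: b :: R) ∨ e = s(a, I.head hI) ∨ e = s(I.getLast hI, b) ∨
      e ∈ pathEdges I := by
  have h' : e ∈ pathEdges (L ++ a :: (I ++ b :: R)) + {s(a, b)} := Multiset.mem_add.2 (Or.inl h)
  rw [pathEdges_insert L a hI b R] at h'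
  simpa [or_assoc] using h'

/-- Insertion of vertex-disjoint paths (`items`) between consecutive vertices of a given path,
along edges of new colours. -/
theorem insert_items (x : Fin n → Plane) {D : ℝ} (hD : ∀ i j, dist (x i) (x j) ≤ D)
    {m s N : ℕ} (hq : 0 < q)
    (hs : 2 * s + N ≤ q) {T : (Sym2 (Fin n) → Fin q) → Prop} {δ : ℝ} (hδ : 0 ≤ δ)
    (S : List (Fin n)) (items : List (List (Fin n))) :
    ∀ (Q P : List (Fin n)) (F es : Finset (Sym2 (Fin n))) (χ : Sym2 (Fin n) → Fin q),
      2 * m * items.length ≤ P.length → P.Nodup → (∀ I ∈ items, I ≠ []) →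
      items.Pairwise List.Disjoint → (∀ I ∈ items, ∀ z ∈ I, z ∉ P) →
      (∀ I ∈ items, ∀ z, (z ∈ I.head? ∨ z ∈ I.getLast?) → ∀ p ∈ P, s(z, p) ∉ F) →
      (∀ e ∈ pathEdges (Q ++ P ++ S), e ∈ es) → (∀ I ∈ items, ∀ e ∈ pathEdges I, e ∈ es) →
      Explored F es χ → es.card + 2 * items.length ≤ N →
      (∀ (P' : List (Fin n)) (F' es' : Finset (Sym2 (Fin n))) (χ' : Sym2 (Fin n) → Fin q),
        P'.Perm (P ++ items.flatten) → (∀ e ∈ pathEdges (Q ++ P' ++ S), e ∈ es') →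
        Explored F' es' χ' → es ⊆ es' → es'.card ≤ es.card + 2 * items.length →
        weight x (pathEdges (Q ++ P' ++ S)) ≤ weight x (pathEdges (Q ++ P ++ S)) +
          (items.map fun I => weight x (pathEdges I)).sum + 2 * D * items.length →
        (∀ e ∈ F', e ∈ F ∨ ∃ I ∈ items, ∃ z ∈ I, ∃ p ∈ P, e = s(z, p)) →
        FailsAtMost F' χ' δ T) →
      FailsAtMost F χ (items.length * (1 - ((s : ℝ) / q) ^ 2) ^ m + δ) T := by
  have hβ : 0 ≤ 1 - ((s : ℝ) / q) ^ 2 := by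
    have hq' : (0 : ℝ) < q := by exact_mod_cast hq
    have : (s : ℝ) / q ≤ 1 := by
      rw [div_le_one hq']
      exact_mod_cast (by omega : s ≤ q)
    have h0 : (0 : ℝ) ≤ s / q := by positivity
    nlinarith
  induction items with
  | nil =>
    intro Q P F es χ _ _ _ _ _ _ hes _ hex _ hcont
    simpa using hcont P F es χ (by simp) hes hex (Finset.Subset.refl _) (by simp) (by simp)
      fun e he => Or.inl he
  | cons I items ih =>
    intro Q P F es χ hlen hnd hne hpw hdis hfresh hes hies hex hN hcont
    rw [List.length_cons] at hlen hN
    have hlen' : 2 * m * items.length + 2 * m ≤ P.length := by linarith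
    have hI : I ≠ [] := hne I (by simp)
    have hhd : I.head hI ∈ I := List.head_mem hI
    have hlt : I.getLast hI ∈ I := List.getLast_mem hI
    have hlt1 : ∀ i : Fin m, 2 * (i : ℕ) < P.length := fun i => by have := i.2; omega
    have hlt2 : ∀ i : Fin m, 2 * (i : ℕ) + 1 < P.length := fun i => by have := i.2; omega
    have hIP : ∀ z ∈ I, z ∉ P := hdis I (by simp)
    have hcr : ∀ z ∈ I, ∀ z' ∈ I, ∀ p ∈ P, ∀ p' ∈ P, s(p, z) = s(p', z') → p = p' := by
      intro z hz z' hz' p hp p' hp' h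
      rcases Sym2.eq_iff.1 h with ⟨h, _⟩ | ⟨h, _⟩
      · exact h
      · exact absurd (h ▸ hp) (hIP z' hz')
    have hidx : ∀ {i j : ℕ} (hi : i < P.length) (hj : j < P.length), P[i] = P[j] → i = j :=
      fun hi hj h => (hnd.getElem_inj_iff).1 h
    have key : FailsAtMost F χ ((1 - ((s : ℝ) / q) ^ 2) ^ (Finset.univ : Finset (Fin m)).card +
        (items.length * (1 - ((s : ℝ) / q) ^ 2) ^ m + δ)) T := by
      -- The candidate places are the edges from `P[2 * i]` to `P[2 * i + 1]`. They share no
      -- vertices, so the pairs of connecting edges tested at different places are disjoint.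
      refine FailsAtMost.test
        (F' := F ∪ (I.toFinset ×ˢ P.toFinset).image fun z => s(z.1, z.2)) hq hex.subset
        Finset.subset_union_left hex.injOn (s := s) (by omega)
        (Finset.univ : Finset (Fin m)) (fun i : Fin m => s(P[2 * (i : ℕ)]'(hlt1 i), I.head hI))
        (fun i : Fin m => s(P[2 * (i : ℕ) + 1]'(hlt2 i), I.getLast hI))
        (fun i _ => by rw [Sym2.eq_swap]; exact hfresh I (by simp) _ (Or.inl (by
          simp [List.head?_eq_some_head hI])) _ (List.getElem_mem _))
        (fun i _ => by rw [Sym2.eq_swap]; exact hfresh I (by simp) _ (Or.inr (by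
          simp [List.getLast?_eq_some_getLast hI])) _ (List.getElem_mem _))
        ?_ (by positivity) ?_
      · intro i _ j _ hij
        have hij' : (i : ℕ) ≠ j := fun h => hij (Fin.ext h)
        refine ⟨fun h => ?_, fun h => ?_, fun h => ?_⟩
        · have := hidx _ _ (hcr _ hhd _ hhd _ (List.getElem_mem _) _ (List.getElem_mem _) h)
          omega
        · have := hidx _ _ (hcr _ hhd _ hlt _ (List.getElem_mem _) _ (List.getElem_mem _) h)
          omega
        · have := hidx _ _ (hcr _ hlt _ hlt _ (List.getElem_mem _) _ (List.getElem_mem _) h)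
          omega
      · rintro χ' hχ' ⟨i, -, hi⟩
        have hi2 := hlt2 i
        have him := i.2
        obtain ⟨A, hA⟩ : ∃ A, A = P.take (2 * (i : ℕ)) := ⟨_, rfl⟩
        obtain ⟨B, hB⟩ : ∃ B, B = P.drop (2 * (i : ℕ) + 2) := ⟨_, rfl⟩
        obtain ⟨a, ha⟩ : ∃ a, a = P[2 * (i : ℕ)]'(hlt1 i) := ⟨_, rfl⟩
        obtain ⟨b, hb⟩ : ∃ b, b = P[2 * (i : ℕ) + 1]'(hlt2 i) := ⟨_, rfl⟩
        have hP : P = A ++ a :: b :: B := by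
          rw [hA, hB, ha, hb, ← List.drop_eq_getElem_cons, ← List.drop_eq_getElem_cons,
            List.take_append_drop]
        have hBlen : 2 * m * items.length ≤ B.length := by
          rw [hB, List.length_drop]
          omega
        have hBP : ∀ z ∈ B, z ∈ P := fun z hz => by rw [hP]; simp [hz]
        have haP : a ∈ P := by rw [hP]; simp
        have hbP : b ∈ P := by rw [hP]; simp
        rw [← ha, ← hb] at hi
        have hI' : ∀ z ∈ I, ∀ p ∈ P, s(p, z) ∈ F ∪ (I.toFinset ×ˢ P.toFinset).image
            fun z => s(z.1, z.2) := by
          intro z hz p hp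
          refine Finset.mem_union_right _ (Finset.mem_image.2 ⟨(z, p), ?_, Sym2.eq_swap⟩)
          simp [hz, hp]
        have hcard : (insert s(a, I.head hI) (insert s(b, I.getLast hI) es)).card ≤
            es.card + 2 := by
          have h1 := Finset.card_insert_le s(a, I.head hI) (insert s(b, I.getLast hI) es)
          have h2 := Finset.card_insert_le s(b, I.getLast hI) es
          omega
        have hss : es ⊆ insert s(a, I.head hI) (insert s(b, I.getLast hI) es) :=
          (Finset.subset_insert _ _).trans (Finset.subset_insert _ _)
        have hassoc : ∀ B' : List (Fin n), Q ++ A ++ a :: I ++ [b] ++ B' ++ S =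
            (Q ++ A) ++ a :: (I ++ b :: (B' ++ S)) := by intro B'; simp
        have hold : Q ++ P ++ S = (Q ++ A) ++ a :: b :: (B ++ S) := by rw [hP]; simp
        -- Everything up to the place used joins the fixed prefix. At most `2 * m` vertices are
        -- given up in this way, which is the share of one item, and the edges just revealed all
        -- meet `I`, which is disjoint from the later items.
        refine ih (Q ++ A ++ a :: I ++ [b]) B _ _ χ' hBlen ?_ (fun J hJ => hne J (by simp [hJ]))
          (List.pairwise_cons.1 hpw).2 (fun J hJ z hz h => hdis J (by simp [hJ]) z hz (hBP z h))
          ?_ ?_ ?_ (hex.insert_pair Finset.subset_union_left (hI' _ hhd a haP) (hI' _ hlt b hbP)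
            hi) (by omega) ?_
        · rw [hB]
          exact hnd.sublist (List.drop_sublist _ _)
        · intro J hJ z hends p hp h
          have hz : z ∈ J := hends.elim List.mem_of_mem_head? List.mem_of_mem_getLast?
          rcases Finset.mem_union.1 h with h | h
          · exact hfresh J (by simp [hJ]) z hends p (hBP p hp) h
          · obtain ⟨⟨y, r⟩, hyr, h⟩ := Finset.mem_image.1 h
            simp only [Finset.mem_product, List.mem_toFinset] at hyr
            rcases Sym2.eq_iff.1 h with ⟨h, _⟩ | ⟨_, h⟩
            · simp only at h
              exact (List.pairwise_cons.1 hpw).1 J hJ hyr.1 (h ▸ hz)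
            · simp only at h
              exact hdis J (by simp [hJ]) z hz (h ▸ hyr.2)
        · intro e he
          rw [hassoc] at he
          rcases mem_pathEdges_insert hI he with h | h | h | h
          · exact hss (hes e (by rw [hold]; exact h))
          · simp [h]
          · rw [Sym2.eq_swap] at h
            simp [h]
          · exact hss (hies I (by simp) e h)
        · intro J hJ e he
          exact hss (hies J (by simp [hJ]) e he)
        · intro B' F' es' χ'' hperm hes' hex' hsub hc hw hF'
          refine hcont (A ++ a :: I ++ b :: B') F' es' χ'' ?_ ?_ hex' (hss.trans hsub) ?_ ?_ ?_
          · rw [hP, List.flatten_cons]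
            have h1 : (A ++ a :: I ++ b :: B').Perm (A ++ a :: I ++ b :: (B ++ items.flatten)) :=
              (List.Perm.cons _ hperm).append_left _
            refine h1.trans ?_
            rw [← Multiset.coe_eq_coe]
            simp only [← Multiset.coe_add, ← Multiset.cons_coe, ← Multiset.singleton_add]
            abel
          · intro e he
            refine hes' e ?_
            simpa using he
          · rw [List.length_cons]
            omega
          · have h1 := weight_pathEdges_insert_le x hI (Q ++ A) (B ++ S) a b hD
            rw [← hold, ← hassoc] at h1
            have h2 : Q ++ (A ++ a :: I ++ b :: B') ++ S = Q ++ A ++ a :: I ++ [b] ++ B' ++ S := by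
              simp
            rw [h2, List.map_cons, List.sum_cons, List.length_cons]
            push_cast
            linarith
          · intro e he
            rcases hF' e he with h | ⟨J, hJ, z, hz, p, hp, rfl⟩
            · rcases Finset.mem_union.1 h with h | h
              · exact Or.inl h
              · obtain ⟨⟨y, r⟩, hyr, rfl⟩ := Finset.mem_image.1 h
                simp only [Finset.mem_product, List.mem_toFinset] at hyr
                exact Or.inr ⟨I, by simp, y, hyr.1, r, hyr.2, rfl⟩
            · exact Or.inr ⟨J, by simp [hJ], z, hz, p, hBP p hp, rfl⟩
    refine key.mono (le_of_eq ?_)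
    rw [Finset.card_univ, Fintype.card_fin, List.length_cons]
    push_cast
    ring

end Insertion

/-! ### The length of a greedy path. -/

section GreedyCost

variable {n : ℕ}

/-- The hypothesis at `r = min f` bounds the smallest of `k` values by `√(D / k)`. Removing the
minimum repeatedly leads to `∑ √(D / k)`, which is at most `2 √(D |I|)`. -/
theorem sum_le_two_mul_sqrt {ι : Type*} [DecidableEq ι] (I : Finset ι) (f : ι → ℝ)
    (hf : ∀ i ∈ I, 0 ≤ f i) {D : ℝ}
    (h : ∀ r : ℝ, 0 < r → ((I.filter fun i => r ≤ f i).card : ℝ) * r ^ 2 ≤ D) :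
    ∑ i ∈ I, f i ≤ 2 * Real.sqrt (D * I.card) := by
  induction hk : I.card generalizing I with
  | zero => simp [Finset.card_eq_zero.1 hk]
  | succ k ih =>
    obtain ⟨a, ha, hmin⟩ := Finset.exists_min_image I f (Finset.card_pos.1 (by omega))
    have hcard : (I.erase a).card = k := by rw [Finset.card_erase_of_mem ha]; omega
    have h1 := ih (I.erase a) (fun i hi => hf i (Finset.mem_of_mem_erase hi)) (fun r hr =>
      (mul_le_mul_of_nonneg_right (by
        exact_mod_cast Finset.card_le_card
          (Finset.filter_subset_filter _ (Finset.erase_subset a I))) (by positivity)).trans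
        (h r hr)) hcard
    rw [← Finset.add_sum_erase I f ha]
    have hD : 0 ≤ D := le_trans (by positivity) (h 1 one_pos)
    have h2 : ((k : ℝ) + 1) * f a ^ 2 ≤ D := by
      rcases (hf a ha).eq_or_lt with h0 | h0
      · rw [← h0]; simpa using hD
      · have := h (f a) h0
        rw [Finset.filter_true_of_mem (fun i hi => hmin i hi), hk] at this
        exact_mod_cast this
    set u := Real.sqrt (D * k) with hu
    set w := Real.sqrt (D * ((k + 1 : ℕ) : ℝ)) with hw
    have hu0 : 0 ≤ u := Real.sqrt_nonneg _
    have hw0 : 0 ≤ w := Real.sqrt_nonneg _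
    have hu2 : u ^ 2 = D * k := Real.sq_sqrt (by positivity)
    have hw2 : w ^ 2 = D * (k + 1) := by
      rw [hw, Real.sq_sqrt (by positivity)]; push_cast; ring
    have hfa := hf a ha
    have hk0 : (0 : ℝ) ≤ k := by positivity
    -- `(k + 1) f(a) ≤ w`, and `w (w - u) ≥ D / 2`
    have h3 : ((k : ℝ) + 1) * f a ≤ w := by
      refine abs_le_of_sq_le_sq' ?_ hw0 |>.2
      rw [hw2, mul_pow, sq ((k : ℝ) + 1), mul_assoc]
      nlinarith
    have h4 : u ≤ w := by
      refine abs_le_of_sq_le_sq' ?_ hw0 |>.2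
      rw [hu2, hw2]; nlinarith
    have h5 : (w - u) * (w + u) = D := by nlinarith
    by_contra hcon
    push Not at hcon
    have h6 : 2 * (w - u) < f a := by linarith
    have h7 : 0 ≤ w - u := by linarith
    have h8 : (k + 1) * (2 * (w - u)) < w := lt_of_lt_of_le (by nlinarith) h3
    have h9 : 0 < w := lt_of_le_of_lt (by positivity) h8
    nlinarith

theorem dist_plane_sq (a b : Plane) : dist a b ^ 2 = (a 0 - b 0) ^ 2 + (a 1 - b 1) ^ 2 := by
  rw [EuclideanSpace.dist_eq, Real.sq_sqrt (Finset.sum_nonneg fun i _ => by positivity),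
    Fin.sum_univ_two, Real.dist_eq, Real.dist_eq, sq_abs, sq_abs]

theorem dist_plane_le {a b : Plane} {r : ℝ} (hr : 0 ≤ r) (h0 : |a 0 - b 0| ≤ r)
    (h1 : |a 1 - b 1| ≤ r) : dist a b ≤ 3 / 2 * r := by
  refine abs_le_of_sq_le_sq' ?_ (by positivity) |>.2
  rw [dist_plane_sq]
  have := sq_le_sq' (by linarith [(abs_le.1 h0).1]) (abs_le.1 h0).2
  have := sq_le_sq' (by linarith [(abs_le.1 h1).1]) (abs_le.1 h1).2
  nlinarith

theorem dist_le_two {a b : Plane} (ha : a ∈ unitSquare) (hb : b ∈ unitSquare) : dist a b ≤ 2 := by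
  have h : ∀ i, |a i - b i| ≤ 1 := fun i => by
    rw [abs_le]
    constructor <;> linarith [(ha i).1, (ha i).2, (hb i).1, (hb i).2]
  linarith [dist_plane_le zero_le_one (h 0) (h 1)]

theorem weight_pathEdges_eq_sum (x : Fin n → Plane) (P : List (Fin n)) :
    weight x (pathEdges P) = ∑ i ∈ (Finset.range (P.length - 1)).attach,
      dist (x (P[(i : ℕ)]'(by have := Finset.mem_range.1 i.2; omega)))
        (x (P[(i : ℕ) + 1]'(by have := Finset.mem_range.1 i.2; omega))) := by
  induction P with
  | nil => simp
  | cons a P ih =>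
    cases P with
    | nil => simp
    | cons b P =>
      rw [pathEdges_cons_cons, weight_cons, ih]
      have h := Finset.sum_range_succ'
        (fun i => if h : i + 1 < (a :: b :: P).length then
          dist (x ((a :: b :: P)[i])) (x ((a :: b :: P)[i + 1])) else 0) P.length
      have h1 := Finset.sum_attach (Finset.range ((a :: b :: P).length - 1))
        (fun i => if h : i + 1 < (a :: b :: P).length then
          dist (x ((a :: b :: P)[i])) (x ((a :: b :: P)[i + 1])) else 0)
      have h2 := Finset.sum_attach (Finset.range ((b :: P).length - 1))
        (fun i => if h : i + 1 < (b :: P).length then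
          dist (x ((b :: P)[i])) (x ((b :: P)[i + 1])) else 0)
      rw [Finset.sum_congr rfl (g := fun i : {i // i ∈ Finset.range ((a :: b :: P).length - 1)} =>
        dist (x ((a :: b :: P)[(i : ℕ)]'(by have := Finset.mem_range.1 i.2; omega)))
          (x ((a :: b :: P)[(i : ℕ) + 1]'(by have := Finset.mem_range.1 i.2; omega))))
        (fun i _ => dif_pos (by have := Finset.mem_range.1 i.2; omega))] at h1
      rw [Finset.sum_congr rfl (g := fun i : {i // i ∈ Finset.range ((b :: P).length - 1)} =>
        dist (x ((b :: P)[(i : ℕ)]'(by have := Finset.mem_range.1 i.2; omega)))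
          (x ((b :: P)[(i : ℕ) + 1]'(by have := Finset.mem_range.1 i.2; omega))))
        (fun i _ => dif_pos (by have := Finset.mem_range.1 i.2; omega))] at h2
      rw [h1, h2]
      simp only [List.length_cons, Nat.add_sub_cancel] at h ⊢
      rw [h, add_comm]
      congr 1
      refine Finset.sum_congr rfl fun i hi => ?_
      simp

/-- The length of a path that goes to one of the `m` nearest unvisited vertices each time. -/
theorem IsGreedyPath.weight_le {x : Fin n → Plane} (hx : ∀ i, x i ∈ unitSquare) {m : ℕ}
    {W : Finset (Fin n)} {P : List (Fin n)} (hP : IsGreedyPath x m W P) (hnd : P.Nodup) :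
    weight x (pathEdges P) ≤ 12 * Real.sqrt (m * P.length) := by
  classical
  rw [weight_pathEdges_eq_sum]
  have hlt : ∀ i : {i // i ∈ Finset.range (P.length - 1)}, (i : ℕ) + 1 < P.length := fun i => by
    have := Finset.mem_range.1 i.2; omega
  set f : {i // i ∈ Finset.range (P.length - 1)} → ℝ := fun i =>
    dist (x (P[(i : ℕ)]'(by have := hlt i; omega))) (x (P[(i : ℕ) + 1]'(hlt i))) with hf
  have hcount : ∀ r : ℝ, 0 < r →
      (((Finset.range (P.length - 1)).attach.filter fun i => r ≤ f i).card : ℝ) * r ^ 2 ≤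
        36 * m := by
    intro r hr
    set S := (Finset.range (P.length - 1)).attach.filter fun i => r ≤ f i with hS
    rcases S.eq_empty_or_nonempty with h0 | ⟨i₀, hi₀⟩
    · rw [h0]; simp
    have hr2 : r ≤ 2 := (Finset.mem_filter.1 hi₀).2.trans (dist_le_two (hx _) (hx _))
    -- The mesh is `1 / k ≤ r / 2`, so two points of one cell are at distance at most `3 r / 4 < r`;
    -- there are `(k + 1) ^ 2 ≤ 36 / r ^ 2` cells.
    set k := ⌈2 / r⌉₊ with hk
    have hk1 : 2 / r ≤ k := Nat.le_ceil _
    have hk2 : (k : ℝ) < 2 / r + 1 := Nat.ceil_lt_add_one (by positivity)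
    have hkpos : (0 : ℝ) < k := lt_of_lt_of_le (by positivity) hk1
    have hkr : 2 ≤ k * r := by rwa [div_le_iff₀ hr] at hk1
    let cell : {i // i ∈ Finset.range (P.length - 1)} → ℕ × ℕ := fun i =>
      (⌊k * x (P[(i : ℕ) + 1]'(hlt i)) 0⌋₊, ⌊k * x (P[(i : ℕ) + 1]'(hlt i)) 1⌋₊)
    have hcell : ∀ i ∈ S, cell i ∈ Finset.range (k + 1) ×ˢ Finset.range (k + 1) := by
      intro i _
      have h : ∀ j, ⌊k * x (P[(i : ℕ) + 1]'(hlt i)) j⌋₊ ∈ Finset.range (k + 1) := fun j => by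
        rw [Finset.mem_range, Nat.lt_succ_iff]
        refine Nat.floor_le_of_le ?_
        nlinarith [(hx (P[(i : ℕ) + 1]'(hlt i)) j).2]
      exact Finset.mem_product.2 ⟨h 0, h 1⟩
    have hnear : ∀ i j, cell i = cell j →
        dist (x (P[(i : ℕ) + 1]'(hlt i))) (x (P[(j : ℕ) + 1]'(hlt j))) < r := by
      intro i j hij
      have h : ∀ c : Fin 2, ⌊k * x (P[(i : ℕ) + 1]'(hlt i)) c⌋₊ =
          ⌊k * x (P[(j : ℕ) + 1]'(hlt j)) c⌋₊ →
          |x (P[(i : ℕ) + 1]'(hlt i)) c - x (P[(j : ℕ) + 1]'(hlt j)) c| ≤ r / 2 := by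
        intro c hc
        have e1 := Nat.floor_le (mul_nonneg hkpos.le (hx (P[(i : ℕ) + 1]'(hlt i)) c).1)
        have e2 := Nat.lt_floor_add_one (k * x (P[(i : ℕ) + 1]'(hlt i)) c)
        have e3 := Nat.floor_le (mul_nonneg hkpos.le (hx (P[(j : ℕ) + 1]'(hlt j)) c).1)
        have e4 := Nat.lt_floor_add_one (k * x (P[(j : ℕ) + 1]'(hlt j)) c)
        rw [hc] at e1 e2
        rw [abs_le]
        constructor <;> nlinarith
      have := dist_plane_le (by positivity) (h 0 (Prod.ext_iff.1 hij).1) (h 1 (Prod.ext_iff.1 hij).2)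
      linarith
    -- Consider the steps of length at least `r` that start in one cell. The earliest of them has
    -- the largest index, as the list runs backwards in time. The starts of all the others are
    -- visited later and are nearer to its start than the vertex it moves to, so there are fewer
    -- than `m` others.
    have hfib : ∀ c ∈ Finset.range (k + 1) ×ˢ Finset.range (k + 1),
        (S.filter fun i => cell i = c).card ≤ m := by
      intro c _
      rcases (S.filter fun i => cell i = c).eq_empty_or_nonempty with h0 | hne
      · rw [h0]; simp
      obtain ⟨i, hi, hmax⟩ := Finset.exists_max_image _
        (fun i : {i // i ∈ Finset.range (P.length - 1)} => (i : ℕ)) hne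
      have himem := hi
      rw [Finset.mem_filter, Finset.mem_filter] at hi
      have hlti := hlt i
      have hgr := hP (P.take (i : ℕ)) (P[(i : ℕ)]) (P[(i : ℕ) + 1]) (P.drop ((i : ℕ) + 2)) (by
        rw [← List.drop_eq_getElem_cons, ← List.drop_eq_getElem_cons, List.take_append_drop])
      have hinj : ((S.filter fun i => cell i = c).erase i).card ≤
          ((W ∪ (P.take (i : ℕ)).toFinset).filter fun z =>
            dist (x P[(i : ℕ) + 1]) (x z) < dist (x P[(i : ℕ) + 1]) (x P[(i : ℕ)])).card := by
        refine Finset.card_le_card_of_injOn (fun j => P[(j : ℕ) + 1]'(hlt j)) ?_ ?_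
        · intro j hj
          rw [Finset.mem_coe, Finset.mem_erase] at hj
          have hji := hmax j hj.2
          rw [Finset.mem_filter] at hj
          have hd : dist (x P[(i : ℕ) + 1]) (x (P[(j : ℕ) + 1]'(hlt j))) <
              dist (x P[(i : ℕ) + 1]) (x P[(i : ℕ)]) := by
            refine (hnear i j (hi.2.trans hj.2.2.symm)).trans_le ?_
            rw [dist_comm]
            exact hi.1.2
          have hne' : (j : ℕ) ≠ i := fun h => hj.1 (Subtype.ext h)
          -- The vertex moved to in step `i` is not itself such a start, since it is not strictly
          -- nearer than itself.
          have hne2 : (j : ℕ) + 1 ≠ i := by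
            intro h
            simp only [h] at hd
            exact lt_irrefl _ hd
          rw [Finset.mem_coe, Finset.mem_filter]
          refine ⟨Finset.mem_union_right _ ?_, hd⟩
          rw [List.mem_toFinset, List.mem_take_iff_getElem]
          exact ⟨(j : ℕ) + 1, by have := hlt j; omega, rfl⟩
        · intro j _ j' _ h
          have := (hnd.getElem_inj_iff (hi := hlt j) (hj := hlt j')).1 h
          exact Subtype.ext (by omega)
      rw [Finset.card_erase_of_mem himem] at hinj
      omega
    have hc := Finset.card_le_mul_card_image_of_maps_to (s := S)
      (t := Finset.range (k + 1) ×ˢ Finset.range (k + 1)) hcell m hfib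
    rw [Finset.card_product, Finset.card_range] at hc
    have hc' : (S.card : ℝ) ≤ m * ((k + 1) * (k + 1)) := by exact_mod_cast hc
    have h6 : ((k : ℝ) + 1) * r ≤ 6 := by
      have : (k : ℝ) * r < 2 + r := by
        calc (k : ℝ) * r < (2 / r + 1) * r := by gcongr
          _ = 2 + r := by field_simp
      linarith
    have h60 : 0 ≤ ((k : ℝ) + 1) * r := by positivity
    calc (S.card : ℝ) * r ^ 2 ≤ m * ((k + 1) * (k + 1)) * r ^ 2 := by gcongr
      _ = m * (((k + 1) * r) ^ 2) := by ring
      _ ≤ m * 6 ^ 2 := by gcongr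
      _ = 36 * m := by ring
  refine (sum_le_two_mul_sqrt _ f (fun i _ => dist_nonneg) hcount).trans ?_
  have : Real.sqrt (36 * m * ((Finset.range (P.length - 1)).attach.card : ℝ)) ≤
      6 * Real.sqrt (m * P.length) := by
    rw [show (6 : ℝ) = Real.sqrt 36 by rw [show (36 : ℝ) = 6 ^ 2 by norm_num]; simp,
      ← Real.sqrt_mul (by norm_num), mul_assoc]
    refine Real.sqrt_le_sqrt ?_
    have : ((P.length - 1 : ℕ) : ℝ) ≤ P.length := by exact_mod_cast Nat.sub_le _ _
    rw [Finset.card_attach, Finset.card_range]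
    gcongr
  linarith

end GreedyCost

/-! ### Assembling the rainbow tour. -/

section ShortTour

variable {n q : ℕ}

theorem nodup_of_length_eq {l : List (Fin n)} (hm : ∀ v, v ∈ l) (hl : l.length = n) :
    l.Nodup := by
  have h : l.toFinset = Finset.univ := by ext v; simp [hm v]
  have h2 : l.toFinset.card = l.length := by rw [h, Finset.card_univ, Fintype.card_fin, hl]
  exact Multiset.coe_nodup.1 (Multiset.toFinset_card_eq_card_iff_nodup.1 h2)

/-- A greedy path through a nonempty set of vertices inside which no edge has been revealed. -/
theorem greedy_path_of_set (x : Fin n → Plane) (hx : ∀ i, x i ∈ unitSquare) {m s N : ℕ}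
    (hm : 0 < m) (hq : 0 < q)
    (hs : 2 * s + N ≤ q) {T : (Sym2 (Fin n) → Fin q) → Prop} {δ : ℝ} (hδ : 0 ≤ δ)
    {A : Finset (Fin n)} (hA : m + 1 ≤ A.card) {F es : Finset (Sym2 (Fin n))}
    {χ : Sym2 (Fin n) → Fin q} (hex : Explored F es χ) (hN : es.card + A.card ≤ N)
    (hfresh : ∀ a ∈ A, ∀ b ∈ A, s(a, b) ∉ F)
    (hcont : ∀ (W : Finset (Fin n)) (P : List (Fin n)) (F' es' : Finset (Sym2 (Fin n)))
        (χ' : Sym2 (Fin n) → Fin q), W.card = m → P.Nodup → (∀ z ∈ P, z ∉ W) →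
        P.toFinset ∪ W = A → weight x (pathEdges P) ≤ 12 * Real.sqrt (m * n) →
        (∀ e ∈ pathEdges P, e ∈ es') → Explored F' es' χ' → es ⊆ es' →
        es'.card ≤ es.card + A.card → (∀ e ∈ F', e ∈ F ∨ ∃ a ∈ A, ∃ b ∈ A, e = s(a, b)) →
        FailsAtMost F' χ' δ T) :
    FailsAtMost F χ ((A.card - m - 1 : ℕ) * (1 - ((s : ℝ) / q) ^ 2) ^ m + δ) T := by
  obtain ⟨w, hw⟩ := Finset.card_pos.1 (show 0 < A.card by omega)
  have hins : insert w (A.erase w) = A := Finset.insert_erase hw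
  refine greedy_path x hm hq hs hδ (A.card - m - 1) (A.erase w) w [] F es χ
    (by rw [Finset.card_erase_of_mem hw]; omega) (by simp) (by simp)
    (isGreedyPath_singleton x m _ w) (by simp) hex (by omega) (by rwa [hins]) ?_
  intro W P F' es' χ' h1 h2 h3 h4 h5 h6 h7 h8 h9 h10 h11
  rw [hins] at h11
  refine hcont W P F' es' χ' h1 h3 h4 ?_ ((h6.weight_le hx h3).trans ?_) h7 h8 h9 (by omega) h11
  · rw [h5, ← hins]
    ext z
    simp
  · have : (P.length : ℝ) ≤ n := by
      have := h3.length_le_card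
      rw [Fintype.card_fin] at this
      exact_mod_cast this
    gcongr

theorem length_add_card_of_partition {A W : Finset (Fin n)} {P : List (Fin n)} (hP : P.Nodup)
    (hd : ∀ z ∈ P, z ∉ W) (h : P.toFinset ∪ W = A) : P.length + W.card = A.card := by
  rw [← h, Finset.card_union_of_disjoint, List.toFinset_card_of_nodup hP]
  rw [Finset.disjoint_left]
  exact fun z hz => hd z (List.mem_toFinset.1 hz)

theorem exists_eq_append_of_two_le {α : Type*} (l : List α) (h : 2 ≤ l.length) :
    ∃ a m b, l = [a] ++ m ++ [b] := by
  cases l with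
  | nil => simp at h
  | cons a l =>
    have hl : l ≠ [] := by
      rintro rfl
      simp at h
    exact ⟨a, l.dropLast, l.getLast hl, by
      rw [List.append_assoc, List.dropLast_append_getLast hl]; rfl⟩

theorem pathEdges_closed {V : Type*} (l a : V) (M : List V) (b : V) :
    pathEdges ([l, a] ++ M ++ [b, l]) =
      s(l, a) ::ₘ pathEdges ([a] ++ M ++ [b]) + {s(b, l)} := by
  have h := pathEdges_append_cons (l :: a :: M) b [l]
  simp only [List.cons_append, List.nil_append, pathEdges_cons_cons, pathEdges_singleton] at h ⊢
  rw [h]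
  rfl

theorem flatten_map_singleton {α : Type*} (l : List α) : (l.map fun a => [a]).flatten = l := by
  induction l with
  | nil => rfl
  | cons a l ih => simpa using ih

set_option maxHeartbeats 1000000 in
/-- A rainbow tour of length `O (√(m n))` exists, except with probability `3 n β ^ m`. -/
theorem rainbow_tour_fails_le (x : Fin n → Plane) (hx : ∀ i, x i ∈ unitSquare) {m s : ℕ}
    (hm : 0 < m) (hmn : 2 * m * m + m + 3 ≤ n / 2) (hs : 2 * s + (n + 4 * m + 2) ≤ q) :
    prob (fun χ : Sym2 (Fin n) → Fin q => ¬ ∃ l : List (Fin n), l.Nodup ∧ (∀ v, v ∈ l) ∧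
      Set.InjOn χ {e | e ∈ cycleEdges l} ∧
      weight x (cycleEdges l) ≤ 24 * Real.sqrt (m * n) + 8 * m + 4) ≤
      3 * n * (1 - ((s : ℝ) / q) ^ 2) ^ m := by
  classical
  have hq : 0 < q := by omega
  have hβ : 0 ≤ 1 - ((s : ℝ) / q) ^ 2 := by
    have hq' : (0 : ℝ) < q := by exact_mod_cast hq
    have : (s : ℝ) / q ≤ 1 := by
      rw [div_le_one hq']
      exact_mod_cast (by omega : s ≤ q)
    have h0 : (0 : ℝ) ≤ s / q := by positivity
    nlinarith
  have hβm : 0 ≤ (1 - ((s : ℝ) / q) ^ 2) ^ m := by positivity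
  have hD : ∀ i j, dist (x i) (x j) ≤ 2 := fun i j => dist_le_two (hx i) (hx j)
  set T : (Sym2 (Fin n) → Fin q) → Prop := fun χ => ∃ l : List (Fin n), l.Nodup ∧
    (∀ v, v ∈ l) ∧ Set.InjOn χ {e | e ∈ cycleEdges l} ∧
      weight x (cycleEdges l) ≤ 24 * Real.sqrt (m * n) + 8 * m + 4 with hT
  -- The halves are arbitrary and ignore the positions of the points. Their purpose is that the
  -- greedy phases reveal nothing between `A` and its complement, so all cross edges remain fresh
  -- for joining.
  set A : Finset (Fin n) := Finset.univ.filter fun i => (i : ℕ) < n / 2 with hA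
  have hAc : A.card = n / 2 := by
    rw [hA, Fin.card_filter_val_lt]
    omega
  have hBc : Aᶜ.card = n - n / 2 := by rw [Finset.card_compl, hAc, Fintype.card_fin]
  obtain ⟨χ₀⟩ : Nonempty (Sym2 (Fin n) → Fin q) := ⟨fun _ => ⟨0, hq⟩⟩
  -- The five terms belong to the five phases: two greedy paths, closing the second one, inserting
  -- the leftovers of the complement into the first path, and inserting everything else into the
  -- cycle.
  have hfinal : FailsAtMost ∅ χ₀ ((A.card - m - 1 : ℕ) * (1 - ((s : ℝ) / q) ^ 2) ^ m +
      ((Aᶜ.card - m - 1 : ℕ) * (1 - ((s : ℝ) / q) ^ 2) ^ m +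
        ((1 - ((s : ℝ) / q) ^ 2) ^ m + (m * (1 - ((s : ℝ) / q) ^ 2) ^ m +
          (m * (1 - ((s : ℝ) / q) ^ 2) ^ m + 0))))) T := by
    -- a greedy path through `A`
    refine greedy_path_of_set x hx (es := ∅) hm hq hs (by positivity) (by omega)
      ⟨by simp, by simp⟩ (by simp; omega) (by simp) ?_
    intro LA PA F₁ es₁ χ₁ hLA hPA hdA hPLA hwA heA hex₁ hsub₁ hc₁ hF₁
    have hF₁' : ∀ e ∈ F₁, ∀ v ∈ e, v ∈ A := by
      intro e he v hv
      rcases hF₁ e he with h | ⟨a, ha, b, hb, rfl⟩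
      · simp at h
      · rcases Sym2.mem_iff.1 hv with rfl | rfl <;> assumption
    -- a greedy path through the complement of `A`
    refine greedy_path_of_set x hx hm hq hs (by positivity) (A := Aᶜ) (by omega) hex₁
      (by simp at hc₁; omega)
      (fun a ha b _ h => Finset.mem_compl.1 ha (hF₁' _ h a (Sym2.mem_mk_left _ _))) ?_
    intro LB PB F₂ es₂ χ₂ hLB hPB hdB hPLB hwB heB hex₂ hsub₂ hc₂ hF₂
    have hcard₂ : es₂.card ≤ n := by simp at hc₁; omega
    have hlenA := length_add_card_of_partition hPA hdA hPLA
    have hlenB := length_add_card_of_partition hPB hdB hPLB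
    have hPA_A : ∀ z ∈ PA, z ∈ A := fun z hz => by
      rw [← hPLA]; exact Finset.mem_union_left _ (List.mem_toFinset.2 hz)
    have hLA_A : ∀ z ∈ LA, z ∈ A := fun z hz => by
      rw [← hPLA]; exact Finset.mem_union_right _ hz
    have hPB_B : ∀ z ∈ PB, z ∉ A := fun z hz => by
      rw [← Finset.mem_compl, ← hPLB]; exact Finset.mem_union_left _ (List.mem_toFinset.2 hz)
    have hLB_B : ∀ z ∈ LB, z ∉ A := fun z hz => by
      rw [← Finset.mem_compl, ← hPLB]; exact Finset.mem_union_right _ hz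
    have hcross : ∀ a ∈ A, ∀ b ∉ A, s(a, b) ∉ F₂ := by
      intro a ha b hb h
      rcases hF₂ _ h with h | ⟨c, hc, d, hd, h⟩
      · exact hb (hF₁' _ h b (Sym2.mem_mk_right _ _))
      · rw [Finset.mem_compl] at hc hd
        rcases Sym2.eq_iff.1 h with ⟨rfl, _⟩ | ⟨rfl, _⟩
        · exact hc ha
        · exact hd ha
    -- close the second path through a vertex of `A`
    obtain ⟨b₁, midB, b₂, hPBeq⟩ := exists_eq_append_of_two_le PB (by omega)
    have hb₁B : b₁ ∈ PB := by rw [hPBeq]; simp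
    have hb₂B : b₂ ∈ PB := by rw [hPBeq]; simp
    have hmidBPB : ∀ z ∈ midB, z ∈ PB := fun z hz => by rw [hPBeq]; simp [hz]
    have hmidBlen : midB.length + 2 = PB.length := by rw [hPBeq]; simp
    have hmidBnd : midB.Nodup ∧ b₁ ∉ midB ∧ b₂ ∉ midB := by
      rw [hPBeq] at hPB
      simp only [List.nodup_append, List.mem_append, List.mem_singleton] at hPB
      refine ⟨hPB.1.2.1, fun h => ?_, fun h => ?_⟩
      · exact hPB.1.2.2 b₁ rfl b₁ h rfl
      · exact hPB.2.2 b₂ (Or.inr h) b₂ rfl rfl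
    have hclose : FailsAtMost F₂ χ₂ ((1 - ((s : ℝ) / q) ^ 2) ^ LA.card +
        (m * (1 - ((s : ℝ) / q) ^ 2) ^ m + (m * (1 - ((s : ℝ) / q) ^ 2) ^ m + 0))) T := by
      have hcr : ∀ a ∈ A, ∀ a' ∈ A, ∀ b ∈ PB, ∀ b' ∈ PB, a ≠ a' → s(a, b) ≠ s(a', b') := by
        intro a ha a' ha' b hb b' hb' hne h
        rcases Sym2.eq_iff.1 h with ⟨h, _⟩ | ⟨h, _⟩
        · exact hne h
        · exact hPB_B _ hb' (h ▸ ha)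
      -- The `m` leftover vertices of `A` compete to close the second path. This reveals edges from
      -- `LA` to `b₁` and `b₂`, which is why these two ends are excluded from later insertions.
      refine FailsAtMost.test (F' := F₂ ∪ (LA ×ˢ {b₁, b₂}).image fun z => s(z.1, z.2)) hq
        hex₂.subset Finset.subset_union_left hex₂.injOn (s := s) (by omega) LA
        (fun l => s(l, b₁)) (fun l => s(l, b₂))
        (fun l hl => hcross l (hLA_A l hl) b₁ (hPB_B _ hb₁B))
        (fun l hl => hcross l (hLA_A l hl) b₂ (hPB_B _ hb₂B))
        (fun l hl l' hl' hne =>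
          ⟨hcr _ (hLA_A l hl) _ (hLA_A l' hl') _ hb₁B _ hb₁B hne,
            hcr _ (hLA_A l hl) _ (hLA_A l' hl') _ hb₁B _ hb₂B hne,
            hcr _ (hLA_A l hl) _ (hLA_A l' hl') _ hb₂B _ hb₂B hne⟩) (by positivity) ?_
      rintro χ₃ - ⟨l₀, hl₀, hi⟩
      have hex₃ := hex₂.insert_pair
        (F' := F₂ ∪ (LA ×ˢ {b₁, b₂}).image fun z => s(z.1, z.2)) Finset.subset_union_left
        (e := s(l₀, b₁)) (f := s(l₀, b₂))
        (Finset.mem_union_right _ (Finset.mem_image.2 ⟨(l₀, b₁), by simp [hl₀], rfl⟩))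
        (Finset.mem_union_right _ (Finset.mem_image.2 ⟨(l₀, b₂), by simp [hl₀], rfl⟩)) hi
      set es₃ := insert s(l₀, b₁) (insert s(l₀, b₂) es₂) with hes₃
      set F₃ := F₂ ∪ (LA ×ˢ {b₁, b₂}).image fun z => s(z.1, z.2) with hF₃
      have hc₃ : es₃.card ≤ n + 2 := by
        rw [hes₃]
        have h1 := Finset.card_insert_le s(l₀, b₁) (insert s(l₀, b₂) es₂)
        have h2 := Finset.card_insert_le s(l₀, b₂) es₂
        omega
      have hsub₃ : es₂ ⊆ es₃ :=
        (Finset.subset_insert _ _).trans (Finset.subset_insert _ _)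
      have hcross₃ : ∀ a ∈ A, ∀ b ∉ A, a ∉ LA ∨ (b ≠ b₁ ∧ b ≠ b₂) → s(a, b) ∉ F₃ := by
        intro a ha b hb hor h
        rcases Finset.mem_union.1 h with h | h
        · exact hcross a ha b hb h
        · obtain ⟨⟨c, d⟩, hcd, h⟩ := Finset.mem_image.1 h
          simp only [Finset.mem_product, Finset.mem_insert, Finset.mem_singleton] at hcd
          rcases Sym2.eq_iff.1 h with ⟨h1, h2⟩ | ⟨h1, h2⟩
          · simp only at h1 h2
            rcases hor with h3 | h3
            · exact h3 (h1 ▸ hcd.1)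
            · rw [h2] at hcd
              exact hcd.2.elim h3.1 h3.2
          · simp only at h1
            exact hb (h1 ▸ hLA_A c hcd.1)
      -- insert the rest of the complement of `A` into the first path
      obtain ⟨a₁, mid, a₂, hPAeq⟩ := exists_eq_append_of_two_le PA (by omega)
      have hmidlen : mid.length + 2 = PA.length := by rw [hPAeq]; simp
      have hmidPA : ∀ z ∈ mid, z ∈ PA := fun z hz => by rw [hPAeq]; simp [hz]
      have hmidnd : mid.Nodup := by
        rw [hPAeq] at hPA
        exact ((List.nodup_append.1 (List.nodup_append.1 hPA).1).2.1)
      have hlB : (LB.toList.map fun z => [z]).length = m := by simp [hLB]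
      -- The ends `a₁` and `a₂` stay outside the list that is modified, because the result is known
      -- only up to permutation and the last phase needs the ends of this path to lie in `A`.
      have hstep := insert_items x hD (m := m) hq hs (T := T)
        (δ := m * (1 - ((s : ℝ) / q) ^ 2) ^ m + 0) (by positivity) [a₂]
        (LB.toList.map fun z => [z]) [a₁] mid F₃ es₃ χ₃
      rw [hlB] at hstep
      refine hstep ?_ hmidnd ?_ ?_ ?_ ?_ ?_ ?_ hex₃ (by omega) ?_
      · rw [hAc] at hlenA
        omega
      · simp
      · rw [List.pairwise_map]
        exact (Finset.nodup_toList LB).imp fun h => by simpa using Ne.symm h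
      · intro I hI z hz h
        obtain ⟨b, hb, rfl⟩ := List.mem_map.1 hI
        rw [List.mem_singleton.1 hz] at h
        exact hLB_B b (Finset.mem_toList.1 hb) (hPA_A _ (hmidPA _ h))
      · intro I hI z hz p hp
        obtain ⟨b, hb, rfl⟩ := List.mem_map.1 hI
        have hzb : z = b := by simpa [eq_comm] using hz
        rw [hzb, Sym2.eq_swap]
        rw [Finset.mem_toList] at hb
        exact hcross₃ p (hPA_A _ (hmidPA _ hp)) b (hLB_B b hb)
          (Or.inl (hdA p (hmidPA _ hp)))
      · rw [← hPAeq]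
        exact fun e he => hsub₃ (hsub₂ (heA e he))
      · intro I hI e he
        obtain ⟨b, -, rfl⟩ := List.mem_map.1 hI
        simp at he
      intro mid' F₄ es₄ χ₄ hperm₄ hes₄ hex₄ hsub₄ hc₄ hw₄ hF₄
      rw [flatten_map_singleton] at hperm₄
      rw [← hPAeq, List.map_map, show ((fun I => weight x (pathEdges I)) ∘ fun z => [z]) =
        fun _ => (0 : ℝ) by ext; simp] at hw₄
      simp only [List.map_const', List.sum_replicate, smul_zero, add_zero] at hw₄
      -- insert everything else into the cycle
      have hlA : (([a₁] ++ mid' ++ [a₂]) :: (LA.erase l₀).toList.map fun z => [z]).length = m := by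
        simp [Finset.card_erase_of_mem hl₀, hLA]
        omega
      have hmem₄ : ∀ z ∈ [a₁] ++ mid' ++ [a₂], z ∈ PA ∨ z ∈ LB := by
        intro z hz
        simp only [List.mem_append, List.mem_singleton] at hz
        rcases hz with (rfl | h) | rfl
        · left; rw [hPAeq]; simp
        · have := hperm₄.mem_iff.1 h
          rw [List.mem_append, Finset.mem_toList] at this
          exact this.imp_left (hmidPA z)
        · left; rw [hPAeq]; simp
      -- The cycle is cut at `l₀` and read as the path from `l₀` back to `l₀`. The items are the
      -- whole path through `A` and the other `m - 1` leftovers, again `m` items in total.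
      have hstep' := insert_items x hD (m := m) hq hs (T := T) (δ := 0) le_rfl [b₂, l₀]
        (([a₁] ++ mid' ++ [a₂]) :: (LA.erase l₀).toList.map fun z => [z]) [l₀, b₁] midB F₄ es₄ χ₄
      rw [hlA] at hstep'
      have hPAdisj : ∀ z, z ∈ PA ∨ z ∈ LB → z ∉ LA ∧ z ∉ PB := by
        rintro z (h | h)
        · exact ⟨hdA z h, fun h' => hPB_B z h' (hPA_A z h)⟩
        · exact ⟨fun h' => hLB_B z h (hLA_A z h'), fun h' => hdB z h' h⟩
      refine hstep' ?_ hmidBnd.1 ?_ ?_ ?_ ?_ ?_ ?_ hex₄ (by omega) ?_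
      · rw [hBc] at hlenB
        omega
      · intro I hI
        rcases List.mem_cons.1 hI with rfl | hI
        · simp
        · obtain ⟨b, hb, rfl⟩ := List.mem_map.1 hI
          simp
      · rw [List.pairwise_cons]
        constructor
        · intro I hI z hz hz'
          obtain ⟨b, hb, rfl⟩ := List.mem_map.1 hI
          rw [List.mem_singleton.1 hz'] at hz
          exact (hPAdisj b (hmem₄ b hz)).1
            (Finset.mem_of_mem_erase (Finset.mem_toList.1 hb))
        · rw [List.pairwise_map]
          exact (Finset.nodup_toList _).imp fun h => by simpa using Ne.symm h
      · intro I hI z hz h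
        rcases List.mem_cons.1 hI with rfl | hI
        · exact (hPAdisj z (hmem₄ z hz)).2 (hmidBPB z h)
        · obtain ⟨b, hb, rfl⟩ := List.mem_map.1 hI
          rw [List.mem_singleton.1 hz] at h
          exact hPB_B b (hmidBPB b h) (hLA_A b (Finset.mem_of_mem_erase (Finset.mem_toList.1 hb)))
      · intro I hI z hz p hp h
        have hpB := hPB_B p (hmidBPB p hp)
        have hz' : z ∈ A ∧ z ∉ LB ∧ (z ∉ LA ∨ (p ≠ b₁ ∧ p ≠ b₂)) := by
          rcases List.mem_cons.1 hI with rfl | hI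
          · rw [List.getLast?_concat] at hz
            have : z = a₁ ∨ z = a₂ := by simpa [eq_comm] using hz
            have hzPA : z ∈ PA := by rw [hPAeq]; rcases this with rfl | rfl <;> simp
            exact ⟨hPA_A z hzPA, fun h => hLB_B z h (hPA_A z hzPA), Or.inl (hdA z hzPA)⟩
          · obtain ⟨b, hb, rfl⟩ := List.mem_map.1 hI
            have hzb : z = b := by simpa [eq_comm] using hz
            have hbLA := Finset.mem_of_mem_erase (Finset.mem_toList.1 hb)
            rw [hzb]
            exact ⟨hLA_A b hbLA, fun h => hLB_B b h (hLA_A b hbLA),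
              Or.inr ⟨fun h => hmidBnd.2.1 (h ▸ hp), fun h => hmidBnd.2.2 (h ▸ hp)⟩⟩
        rcases hF₄ _ h with h | ⟨J, hJ, y, hy, r, hr, h⟩
        · exact hcross₃ z hz'.1 p hpB hz'.2.2 h
        · obtain ⟨b, hb, rfl⟩ := List.mem_map.1 hJ
          rw [List.mem_singleton.1 hy] at h
          rcases Sym2.eq_iff.1 h with ⟨h, _⟩ | ⟨_, h⟩
          · exact hz'.2.1 (h ▸ Finset.mem_toList.1 hb)
          · exact hdB p (hmidBPB p hp) (h ▸ Finset.mem_toList.1 hb)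
      · intro e he
        refine hsub₄ ?_
        rw [pathEdges_closed, ← hPBeq, Multiset.mem_add, Multiset.mem_cons,
          Multiset.mem_singleton] at he
        rcases he with (rfl | h) | rfl
        · simp [hes₃]
        · exact hsub₃ (heB e h)
        · rw [Sym2.eq_swap]; simp [hes₃]
      · intro I hI e he
        rcases List.mem_cons.1 hI with rfl | hI
        · exact hes₄ e he
        · obtain ⟨b, -, rfl⟩ := List.mem_map.1 hI
          simp at he
      · intro P' F' es' χ' hperm' hes' hex' hsub' hc' hw' hF'
        rw [List.flatten_cons, flatten_map_singleton] at hperm'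
        have hcyc : cycleEdges ([l₀, b₁] ++ P' ++ [b₂]) =
            pathEdges ([l₀, b₁] ++ P' ++ [b₂, l₀]) := by
          simp [cycleEdges]
        have hmem : ∀ v, v ∈ [l₀, b₁] ++ P' ++ [b₂] := by
          intro v
          have hP' : v ∈ midB ∨ v ∈ [a₁] ++ mid' ++ [a₂] ∨ (v ≠ l₀ ∧ v ∈ LA) → v ∈ P' := by
            intro h
            rw [hperm'.mem_iff, List.mem_append, List.mem_append, Finset.mem_toList,
              Finset.mem_erase]
            exact h
          have hmid' : v ∈ mid ∨ v ∈ LB → v ∈ mid' := by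
            intro h
            rw [hperm₄.mem_iff, List.mem_append, Finset.mem_toList]
            exact h
          have hcases : v ∈ PA ∨ v ∈ LA ∨ v ∈ PB ∨ v ∈ LB := by
            by_cases hv : v ∈ A
            · rw [← hPLA, Finset.mem_union, List.mem_toFinset] at hv
              exact hv.elim Or.inl fun h => Or.inr (Or.inl h)
            · rw [← Finset.mem_compl, ← hPLB, Finset.mem_union, List.mem_toFinset] at hv
              exact Or.inr (Or.inr hv)
          rw [hPAeq, hPBeq] at hcases
          simp only [List.mem_append, List.mem_cons, List.not_mem_nil, or_false]
            at hcases hP' ⊢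
          clear * - hcases hP' hmid'
          rcases hcases with ((h | h) | h) | h | ((h | h) | h) | h
          · exact Or.inl (Or.inr (hP' (Or.inr (Or.inl (Or.inl (Or.inl h))))))
          · exact Or.inl (Or.inr (hP' (Or.inr (Or.inl (Or.inl (Or.inr (hmid' (Or.inl h))))))))
          · exact Or.inl (Or.inr (hP' (Or.inr (Or.inl (Or.inr h)))))
          · by_cases hv : v = l₀
            · exact Or.inl (Or.inl (Or.inl hv))
            · exact Or.inl (Or.inr (hP' (Or.inr (Or.inr ⟨hv, h⟩))))
          · exact Or.inl (Or.inl (Or.inr h))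
          · exact Or.inl (Or.inr (hP' (Or.inl h)))
          · exact Or.inr h
          · exact Or.inl (Or.inr (hP' (Or.inr (Or.inl (Or.inl (Or.inr (hmid' (Or.inr h))))))))
        have hlen : ([l₀, b₁] ++ P' ++ [b₂]).length = n := by
          have h1 := hperm'.length_eq
          have h2 := hperm₄.length_eq
          have h3 := Finset.card_erase_of_mem hl₀
          have h4 := Nat.div_le_self n 2
          simp only [List.length_append, List.length_cons, List.length_nil,
            Finset.length_toList] at h1 h2 ⊢
          rw [hAc] at hlenA
          rw [hBc] at hlenB
          omega
        refine FailsAtMost.of_forall fun χ'' hχ'' => ?_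
        refine ⟨[l₀, b₁] ++ P' ++ [b₂], nodup_of_length_eq hmem hlen, hmem, ?_, ?_⟩
        · rw [hcyc]
          intro e he f hf hef
          rw [hχ'' e (hex'.subset (hes' e he)), hχ'' f (hex'.subset (hes' f hf))] at hef
          exact hex'.injOn (hes' e he) (hes' f hf) hef
        · rw [hcyc]
          refine hw'.trans ?_
          rw [pathEdges_closed, ← hPBeq, List.map_cons, List.sum_cons, List.map_map,
            show ((fun I => weight x (pathEdges I)) ∘ fun z => [z]) = fun _ => (0 : ℝ) by
              ext; simp]
          simp only [List.map_const', List.sum_replicate, smul_zero, add_zero, weight_add,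
            weight_cons, weight_singleton]
          have h1 := hD l₀ b₁
          have h2 := hD b₂ l₀
          linarith
    rwa [hLA] at hclose
  rw [FailsAtMost] at hfinal
  simp only [Finset.piecewise_empty] at hfinal
  refine hfinal.trans ?_
  have hsum : ((A.card - m - 1 : ℕ) : ℝ) + (Aᶜ.card - m - 1 : ℕ) + 1 + m + m ≤ 3 * n := by
    have : A.card - m - 1 + (Aᶜ.card - m - 1) + 1 + m + m ≤ 3 * n := by omega
    exact_mod_cast this
  nlinarith

end ShortTour

/-! ### From counting to the product measures. -/

section RandomColouring

variable {n q : ℕ}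

instance [NeZero q] : IsProbabilityMeasure (randomColouring n q) := by
  unfold randomColouring
  infer_instance

theorem randomColouring_eq_uniformOn (hq : 0 < q) :
    randomColouring n q = uniformOn (Set.univ : Set (Colouring n q)) := by
  classical
  have : NeZero q := ⟨hq.ne'⟩
  refine Measure.ext_of_singleton fun χ => ?_
  rw [randomColouring, Measure.pi_singleton, uniformOn_univ]
  simp only [uniformOn_univ, Measure.count_singleton, Fintype.card_fin, Finset.prod_const,
    Finset.card_univ, Fintype.card_pi, one_div, ENNReal.inv_pow, Nat.cast_pow]

/-- Colouring the diagonal pairs as well adds independent coordinates on which the event does not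
depend, so the exposure arguments may run over all of `Sym2 (Fin n)`. -/
theorem randomColouring_apply (hq : 0 < q) (S : Set (Colouring n q)) :
    randomColouring n q S =
      ENNReal.ofReal (prob fun χ : Sym2 (Fin n) → Fin q =>
        (fun e : (K n).edgeSet => χ e) ∈ S) := by
  classical
  have : NeZero q := ⟨hq.ne'⟩
  have h1 : (prob fun χ : Sym2 (Fin n) → Fin q => (fun e : (K n).edgeSet => χ e) ∈ S) =
      prob fun χ : Colouring n q => χ ∈ S := by
    rw [← prob_fst (Ω' := {e : Sym2 (Fin n) // ¬ e ∈ (K n).edgeSet} → Fin q)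
      (fun χ : Colouring n q => χ ∈ S),
      ← prob_equiv (Equiv.piEquivPiSubtypeProd (fun e => e ∈ (K n).edgeSet) fun _ => Fin q)]
    rfl
  rw [h1, randomColouring_eq_uniformOn hq, uniformOn_univ, prob_def,
    Measure.count_apply_finite _ S.toFinite, ENNReal.ofReal_div_of_pos (by
      exact_mod_cast Fintype.card_pos), ENNReal.ofReal_natCast, ENNReal.ofReal_natCast]
  congr 3
  ext χ
  simp

theorem le_randomColouring (hq : 0 < q) {P : (Sym2 (Fin n) → Fin q) → Prop}
    {S : Set (Colouring n q)} (h : ∀ χ : Sym2 (Fin n) → Fin q, P χ →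
      (fun e : (K n).edgeSet => χ e) ∈ S) :
    ENNReal.ofReal (1 - prob fun χ => ¬ P χ) ≤ randomColouring n q S := by
  classical
  rw [randomColouring_apply hq]
  refine ENNReal.ofReal_le_ofReal ((sub_le_iff_le_add).2 ?_)
  have : Nonempty (Sym2 (Fin n) → Fin q) := ⟨fun _ => ⟨0, hq⟩⟩
  rw [prob_def, prob_def, ← add_div, le_div_iff₀ (by exact_mod_cast Fintype.card_pos), one_mul,
    ← Nat.cast_add]
  norm_cast
  rw [← Finset.card_univ, ← Finset.card_filter_add_card_filter_not (s := Finset.univ) P]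
  refine Nat.add_le_add_right (Finset.card_le_card fun χ hχ => ?_) _
  simp only [Finset.mem_filter, Finset.mem_univ, true_and] at hχ ⊢
  exact h χ hχ

/-- A lower bound for the measure of a possibly nonmeasurable event of a product space. -/
theorem mul_le_prod_apply {α β : Type*} [MeasurableSpace α] [MeasurableSpace β] (μ : Measure α)
    (ν : Measure β) [SFinite ν] (S : Set (α × β)) (A : Set α) (δ : ENNReal)
    (h : ∀ a ∈ A, δ ≤ ν {b | (a, b) ∈ S}) : δ * μ A ≤ (μ.prod ν) S := by
  -- Passing to the measurable hull of `S` keeps its measure and only enlarges the sections, so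
  -- neither `S` nor `A` has to be measurable.
  rw [← measure_toMeasurable S, Measure.prod_apply (measurableSet_toMeasurable _ _)]
  refine le_trans ?_ (mul_meas_ge_le_lintegral (measurable_measure_prodMk_left
    (measurableSet_toMeasurable (μ.prod ν) S)) δ)
  gcongr
  intro a ha
  exact (h a ha).trans (measure_mono fun b hb => subset_toMeasurable _ _ hb)

instance : IsProbabilityMeasure uniformSquare :=
  ⟨by rw [uniformSquare, Measure.restrict_apply_univ, volume_unitSquare]⟩

theorem pi_unitSquare (n : ℕ) : (Measure.pi fun _ : Fin n => uniformSquare)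
    {x | ∀ i, x i ∈ unitSquare} = 1 := by
  have h : {x : Fin n → Plane | ∀ i, x i ∈ unitSquare} = Set.univ.pi fun _ => unitSquare := by
    ext x
    simp
  rw [h, Measure.pi_pi]
  simp [uniformSquare, volume_unitSquare]

/-- Probabilities bounded below by a sequence tending to one. -/
theorem tendsto_measure_one {Ω : ℕ → Type*} [∀ n, MeasurableSpace (Ω n)]
    {μ : ∀ n, Measure (Ω n)} {S : ∀ n, Set (Ω n)} {f : ℕ → ENNReal}
    (hμ : ∀ᶠ n in atTop, μ n (S n) ≤ 1) (hf : Tendsto f atTop (𝓝 1))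
    (h : ∀ᶠ n in atTop, f n ≤ μ n (S n)) : Tendsto (fun n => μ n (S n)) atTop (𝓝 1) :=
  tendsto_of_tendsto_of_tendsto_of_le_of_le' hf tendsto_const_nhds h hμ

end RandomColouring

/-! ### Choice of the parameters for the upper bound. -/

section ShortTourAsymptotics

theorem eventually_log_sq_le {η : ℝ} (hη : 0 < η) :
    ∀ᶠ n : ℕ in atTop, Real.log n ^ 2 ≤ η * n := by
  have h := (Real.isLittleO_pow_log_id_atTop (n := 2)).comp_tendsto tendsto_natCast_atTop_atTop
  filter_upwards [h.bound hη] with n hn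
  simpa [abs_of_nonneg (sq_nonneg (Real.log n))] using hn

set_option maxHeartbeats 1000000 in
/-- Uniformly over all configurations of points there is, with high probability, a rainbow tour
of length `O (√n log n)`. -/
theorem exists_short_rainbowTour (ε : ℝ) (hε : 0 < ε) :
    ∃ C : ℝ, 0 < C ∧ ∀ q : ℕ → ℕ, (∀ n : ℕ, |(q n : ℝ) - (1 + ε) * (n : ℝ)| < 1) →
      ∀ᶠ n : ℕ in atTop, 0 < q n ∧ ∀ x : Fin n → Plane, (∀ i, x i ∈ unitSquare) →
        ENNReal.ofReal (1 - 3 / n) ≤ randomColouring n (q n)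
          {χ | HasRainbowTour χ ∧ minRainbowTour x χ ≤ C * (Real.sqrt n * Real.log n)} := by
  -- With `s = ⌊ε n / 4⌋` below, `ρ` is a lower bound for `s / q` that does not depend on `n`.
  set ρ : ℝ := ε / (8 * (1 + ε)) with hρ
  have hρ0 : 0 < ρ := by positivity
  have hρ1 : ρ < 1 / 8 := by
    rw [hρ, div_lt_div_iff₀ (by positivity) (by norm_num)]
    linarith
  have hρε : ρ * (1 + ε) = ε / 8 := by
    rw [hρ]
    field_simp
  set b : ℝ := 1 - ρ ^ 2 with hb
  have hb0 : 0 < b := by nlinarith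
  have hb1 : b < 1 := by nlinarith
  have hlogb : Real.log b < 0 := Real.log_neg hb0 hb1
  -- Chosen so that `b ^ (c log n) = n⁻²`, which beats the factor `3 n` of the union bound.
  set c : ℝ := 2 / (-Real.log b) with hc
  have hc0 : 0 < c := div_pos two_pos (by linarith)
  refine ⟨36 * (c + 1), by positivity, fun q hq => ?_⟩
  -- The first entry gives `24 m ^ 2 ≤ n`, enough room for the insertions; the second gives `7 m ^ 2
  -- ≤ ε n / 2`, enough spare colours for the extra `4 m + 2` edges and the rounding of `q`.
  have hη : 0 < min (1 / (24 * (c + 1) ^ 2)) (ε / (14 * (c + 1) ^ 2)) := by positivity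
  filter_upwards [eventually_log_sq_le hη, eventually_ge_atTop 12,
    eventually_ge_atTop ⌈(8 * (1 + ρ)) / ε⌉₊] with n hlog hn12 hnε
  have hn0 : (0 : ℝ) < n := by exact_mod_cast (by omega : 0 < n)
  have hn3 : (3 : ℝ) ≤ n := by exact_mod_cast (by omega : 3 ≤ n)
  have hlog1 : 1 ≤ Real.log n := by
    rw [Real.le_log_iff_exp_le hn0]
    linarith [Real.exp_one_lt_d9]
  have hqn := abs_lt.1 (hq n)
  have hq0 : 0 < q n := by
    have : (0 : ℝ) < q n := by nlinarith
    exact_mod_cast this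
  refine ⟨hq0, fun x hx => ?_⟩
  set m := ⌈c * Real.log n⌉₊ with hm
  have hm1 : c * Real.log n ≤ m := Nat.le_ceil _
  have hm2 : (m : ℝ) ≤ (c + 1) * Real.log n := by
    have := Nat.ceil_lt_add_one (show 0 ≤ c * Real.log n by positivity)
    rw [← hm] at this
    linarith
  have hmpos : 0 < m := Nat.ceil_pos.2 (by positivity)
  have hm1' : (1 : ℝ) ≤ m := by exact_mod_cast hmpos
  have hmsq : (m : ℝ) ^ 2 ≤ (c + 1) ^ 2 * Real.log n ^ 2 := by
    rw [← mul_pow]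
    gcongr
  have hms1 : (m : ℝ) ^ 2 ≤ n / 24 := by
    refine hmsq.trans ?_
    calc (c + 1) ^ 2 * Real.log n ^ 2 ≤ (c + 1) ^ 2 * (1 / (24 * (c + 1) ^ 2) * n) := by
          gcongr
          exact hlog.trans (by gcongr; exact min_le_left _ _)
      _ = (n : ℝ) / 24 := by field_simp
  have hms2 : (m : ℝ) ^ 2 ≤ ε * n / 14 := by
    refine hmsq.trans ?_
    calc (c + 1) ^ 2 * Real.log n ^ 2 ≤ (c + 1) ^ 2 * (ε / (14 * (c + 1) ^ 2) * n) := by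
          gcongr
          exact hlog.trans (by gcongr; exact min_le_right _ _)
      _ = ε * n / 14 := by field_simp
  have hcond1 : 2 * m * m + m + 3 ≤ n / 2 := by
    have h : 4 * (2 * m * m + m + 3) ≤ n := by
      have : (4 : ℝ) * (2 * m * m + m + 3) ≤ n := by nlinarith
      exact_mod_cast this
    omega
  set s := ⌊ε * n / 4⌋₊ with hs
  have hs1 : (s : ℝ) ≤ ε * n / 4 := Nat.floor_le (by positivity)
  have hs2 : ε * n / 4 < s + 1 := Nat.lt_floor_add_one _
  have hcond2 : 2 * s + (n + 4 * m + 2) ≤ q n := by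
    have : (2 : ℝ) * s + (n + 4 * m + 2) ≤ q n := by nlinarith
    exact_mod_cast this
  have hq0' : (0 : ℝ) < q n := by exact_mod_cast hq0
  have hsq : ρ ≤ s / q n := by
    rw [le_div_iff₀ hq0']
    have h1 : 8 * (1 + ρ) / ε ≤ n := (Nat.le_ceil _).trans (by exact_mod_cast hnε)
    rw [div_le_iff₀ hε] at h1
    have h2 : ρ * q n ≤ ρ * ((1 + ε) * n + 1) := by
      gcongr
      linarith
    have h3 : ρ * ((1 + ε) * n + 1) = ε / 8 * n + ρ := by rw [← hρε]; ring
    linarith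
  have hfail := rainbow_tour_fails_le x hx hmpos hcond1 hcond2
  have hpow : (1 - ((s : ℝ) / q n) ^ 2) ^ m ≤ 1 / (n : ℝ) ^ 2 := by
    have h1 : 0 ≤ 1 - ((s : ℝ) / q n) ^ 2 := by
      have : (s : ℝ) / q n ≤ 1 := by
        rw [div_le_one hq0']
        exact_mod_cast (by omega : s ≤ q n)
      nlinarith
    calc (1 - ((s : ℝ) / q n) ^ 2) ^ m ≤ b ^ m := by
          gcongr
          rw [hb]
          gcongr
      _ = Real.exp (Real.log b * m) := by
          rw [mul_comm, Real.exp_nat_mul, Real.exp_log hb0]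
      _ ≤ Real.exp (Real.log b * (c * Real.log n)) := by
          rw [Real.exp_le_exp]
          exact mul_le_mul_of_nonpos_left hm1 hlogb.le
      _ = Real.exp (-(2 * Real.log n)) := by
          congr 1
          have := hlogb.ne
          rw [hc]
          field_simp
      _ = 1 / (n : ℝ) ^ 2 := by
          rw [Real.exp_neg, two_mul, Real.exp_add, Real.exp_log hn0, one_div, sq]
  have hδ : 3 * n * (1 - ((s : ℝ) / q n) ^ 2) ^ m ≤ 3 / n := by
    calc 3 * n * (1 - ((s : ℝ) / q n) ^ 2) ^ m ≤ 3 * n * (1 / (n : ℝ) ^ 2) := by gcongr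
      _ = 3 / (n : ℝ) := by field_simp
  have hle : 24 * Real.sqrt (m * n) + 8 * m + 4 ≤ 36 * (c + 1) * (Real.sqrt n * Real.log n) := by
    have hsn : 1 ≤ Real.sqrt n := by
      rw [Real.one_le_sqrt]; linarith
    have hsm : Real.sqrt m ≤ m := by
      rw [Real.sqrt_le_left (by linarith)]
      exact le_self_pow₀ hm1' two_ne_zero
    have h1 : Real.sqrt (m * n) ≤ (c + 1) * Real.log n * Real.sqrt n := by
      rw [Real.sqrt_mul (by positivity)]
      gcongr
      linarith
    have h2 : 8 * (m : ℝ) + 4 ≤ 12 * ((c + 1) * Real.log n * Real.sqrt n) := by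
      have : (c + 1) * Real.log n * 1 ≤ (c + 1) * Real.log n * Real.sqrt n := by gcongr
      linarith
    linarith
  refine le_trans (ENNReal.ofReal_le_ofReal ?_) (le_randomColouring hq0
    (P := fun χ : Sym2 (Fin n) → Fin (q n) => ∃ l : List (Fin n), l.Nodup ∧ (∀ v, v ∈ l) ∧
      Set.InjOn χ {e | e ∈ cycleEdges l} ∧
      weight x (cycleEdges l) ≤ 24 * Real.sqrt (m * n) + 8 * m + 4) ?_)
  · linarith
  · rintro χ ⟨l, hl, hml, hinj, hwl⟩
    have := exists_rainbowTour_of_list (by omega) x χ hl hml hinj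
    exact ⟨this.1, this.2.trans (hwl.trans hle)⟩

end ShortTourAsymptotics

/-! ### Savings in the triangle inequality at angles of at most `120` degrees. -/

section Triangle

variable {E : Type*} [NormedAddCommGroup E] [InnerProductSpace ℝ E]

/-- The angle condition gives `‖X - Y‖² ≤ (‖X‖ + ‖Y‖)² - ‖X‖ ‖Y‖`, and `‖X‖ ‖Y‖ ≥ R (‖X‖ + ‖Y‖) / 2`
because both norms are at least `R`. -/
theorem norm_sub_le_of_inner {X Y : E} {R : ℝ} (hR : 0 < R) (hX : R ≤ ‖X‖) (hY : R ≤ ‖Y‖)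
    (h : -(‖X‖ * ‖Y‖) ≤ 2 * inner ℝ X Y) : ‖X - Y‖ + R / 4 ≤ ‖X‖ + ‖Y‖ := by
  have h1 := norm_sub_sq_real X Y
  have h2 : 0 ≤ ‖X‖ + ‖Y‖ - R / 4 := by linarith
  have h3 : ‖X - Y‖ ≤ ‖X‖ + ‖Y‖ - R / 4 := by
    refine abs_le_of_sq_le_sq' ?_ h2 |>.2
    rw [h1]
    nlinarith
  linarith

/-- Among three vectors two enclose an angle of at most `120` degrees. -/
theorem exists_inner_ge (X Y Z : E) (hX : X ≠ 0) (hY : Y ≠ 0) (hZ : Z ≠ 0) :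
    -(‖X‖ * ‖Y‖) ≤ 2 * inner ℝ X Y ∨ -(‖X‖ * ‖Z‖) ≤ 2 * inner ℝ X Z ∨
      -(‖Y‖ * ‖Z‖) ≤ 2 * inner ℝ Y Z := by
  have hX' := norm_pos_iff.2 hX
  have hY' := norm_pos_iff.2 hY
  have hZ' := norm_pos_iff.2 hZ
  by_contra hcon
  push Not at hcon
  obtain ⟨h1, h2, h3⟩ := hcon
  have key : ∀ {A B : E}, 0 < ‖A‖ → 0 < ‖B‖ → 2 * inner ℝ A B < -(‖A‖ * ‖B‖) →
      2 * inner ℝ (‖A‖⁻¹ • A) (‖B‖⁻¹ • B) < -1 := by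
    intro A B hA hB h
    rw [real_inner_smul_left, real_inner_smul_right]
    have : 2 * (‖A‖⁻¹ * (‖B‖⁻¹ * inner ℝ A B)) = 2 * inner ℝ A B / (‖A‖ * ‖B‖) := by
      field_simp
    rw [this, div_lt_iff₀ (by positivity)]
    linarith
  have k1 := key hX' hY' h1
  have k2 := key hX' hZ' h2
  have k3 := key hY' hZ' h3
  have hu : ∀ {A : E}, 0 < ‖A‖ → inner ℝ (‖A‖⁻¹ • A) (‖A‖⁻¹ • A) = (1 : ℝ) := by
    intro A hA
    rw [real_inner_self_eq_norm_sq, norm_smul, norm_inv, norm_norm, inv_mul_cancel₀ hA.ne', one_pow]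
  -- If all three angles exceeded `120` degrees, the sum of the unit vectors would have squared norm
  -- below `3 - 3 = 0`.
  have hpos := real_inner_self_nonneg (x := ‖X‖⁻¹ • X + ‖Y‖⁻¹ • Y + ‖Z‖⁻¹ • Z)
  simp only [inner_add_left, inner_add_right, hu hX', hu hY', hu hZ'] at hpos
  rw [real_inner_comm (‖X‖⁻¹ • X) (‖Y‖⁻¹ • Y), real_inner_comm (‖X‖⁻¹ • X) (‖Z‖⁻¹ • Z),
    real_inner_comm (‖Y‖⁻¹ • Y) (‖Z‖⁻¹ • Z)] at hpos
  linarith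

end Triangle

/-! ### Cutting and splicing cycles. -/

section Surgery

variable {V : Type*}

/-- Insertion of a path into a cycle after a given vertex. -/
theorem exists_insert {L S : List V} {p : V} (hp : p ∈ L) (hS : S ≠ []) :
    ∃ l y, l.Perm (S ++ L) ∧ s(p, S.head hS) ∈ cycleEdges l ∧
      cycleEdges l + {s(p, y)} =
        cycleEdges L + {s(p, S.head hS)} + {s(S.getLast hS, y)} + pathEdges S := by
  obtain ⟨A, B, rfl⟩ := List.append_of_mem hp
  -- `y` is the successor of `p` on the cycle; appending `p` covers the case in which `p` is the
  -- only vertex.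
  obtain ⟨y, R, hR⟩ : ∃ y R, B ++ A ++ [p] = y :: R :=
    List.exists_cons_of_ne_nil (by simp)
  refine ⟨p :: (S ++ (B ++ A)), y, ?_, ?_, ?_⟩
  · rw [← Multiset.coe_eq_coe]
    simp only [← Multiset.coe_add, ← Multiset.cons_coe, ← Multiset.singleton_add]
    abel
  · rw [cycleEdges, List.cons_append, pathEdges_cons (by simp [hS])]
    simp [List.head_append_of_ne_nil hS]
  · have h1 : cycleEdges (p :: (S ++ (B ++ A))) = pathEdges ([] ++ p :: (S ++ y :: R)) := by
      rw [← hR]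
      simp [cycleEdges]
    have h2 : cycleEdges (A ++ p :: B) = pathEdges ([] ++ p :: y :: R) := by
      rw [cycleEdges_append_comm, ← hR]
      simp [cycleEdges]
    rw [h1, h2, pathEdges_insert]

theorem cycleEdges_reverse (l : List V) : cycleEdges l.reverse = cycleEdges l := by
  by_cases h : l = []
  · simp [h]
  · rw [cycleEdges_eq h, cycleEdges_eq (by simpa using h), pathEdges_reverse, Sym2.eq_swap]
    simp

theorem cycleEdges_two_paths {S₁ S₂ : List V} (h₁ : S₁ ≠ []) (h₂ : S₂ ≠ []) (u v : V) :
    cycleEdges (v :: S₁ ++ u :: S₂) = {s(v, S₁.head h₁)} + pathEdges S₁ + {s(S₁.getLast h₁, u)} +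
      {s(u, S₂.head h₂)} + pathEdges S₂ + {s(S₂.getLast h₂, v)} := by
  rw [cycleEdges_eq (by simp), pathEdges_append (by simp) (by simp), pathEdges_cons h₁,
    pathEdges_cons h₂]
  simp only [List.cons_append, List.head_cons, List.getLast_cons h₁, ← Multiset.singleton_add]
  rw [List.getLast_cons (by simp), List.getLast_append_of_ne_nil _ (by simp),
    List.getLast_cons h₂]
  abel

end Surgery

/-! ### Gadgets, and the cost of missing their edges. -/

section Gadget

variable {n : ℕ}

/-- Two very close points `u`, `v`, isolated from all the others, and points `Z` surrounding them
on a circle. -/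
structure IsGadget (x : Fin n → Plane) (R : ℝ) (u v : Fin n) (Z : Finset (Fin n)) : Prop where
  ne : u ≠ v
  near : dist (x u) (x v) ≤ R / 32
  far : ∀ w, w ≠ u → w ≠ v → R ≤ dist (x v) (x w)
  cover : ∀ z : Plane, dist z (x v) = R → ∃ p ∈ Z, p ≠ u ∧ p ≠ v ∧ dist z (x p) < R / 32

variable {x : Fin n → Plane} {R : ℝ} {u v : Fin n} {Z : Finset (Fin n)}

theorem gain_of_inner (hR : 0 < R) {o a b : Plane} (ha : R ≤ dist o a) (hb : R ≤ dist o b)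
    (h : -(‖a - o‖ * ‖b - o‖) ≤ 2 * inner ℝ (a - o) (b - o)) :
    dist a b + R / 4 ≤ dist o a + dist o b := by
  rw [dist_comm o a, dist_comm o b] at *
  rw [dist_eq_norm] at ha hb
  rw [dist_eq_norm, dist_eq_norm a o, dist_eq_norm b o, ← sub_sub_sub_cancel_right a b o]
  exact norm_sub_le_of_inner hR ha hb h

set_option maxHeartbeats 1600000 in
-- Of the neighbours `a`, `b` of `v` and the neighbour `c` of `u`, two are seen from `v` at an angle
-- of at most `120` degrees, and joining them directly saves `R / 4` compared with going through
-- `v`. For `a`, `b` the vertex `v` is moved next to `u`; for `a`, `c` the path `S₂` is reversed.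
-- For `b`, `c` the path `S₁` must be attached to the cycle through `v`, `u`, `S₂` again, and the
-- points of `Z` provided by `hring` make this cheap. Detours through `uv` and the circle cost
-- multiples of `R / 32`. The tightest case merges two cycles at points at distance `R / 16` and
-- keeps `R / 4 - R / 8 - R / 16 = R / 16`.
theorem IsGadget.improve_aux (hR : 0 < R) (hg : IsGadget x R u v Z) {S₁ S₂ : List (Fin n)}
    (h₁ : S₁ ≠ []) (h₂ : S₂ ≠ []) (hu₁ : u ∉ S₁) (hv₁ : v ∉ S₁) (hu₂ : u ∉ S₂) (hv₂ : v ∉ S₂)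
    (hring : (∃ p ∈ S₁, ∃ r ∈ S₂, p ∈ Z ∧ r ∈ Z ∧ dist (x p) (x r) ≤ R / 16) ∨
      ∀ z : Plane, dist z (x v) = R → ∃ p ∈ S₂, p ∈ Z ∧ dist z (x p) < R / 32) :
    ∃ T : List (Fin n), T.Perm (v :: S₁ ++ u :: S₂) ∧ s(u, v) ∈ cycleEdges T ∧
      weight x (cycleEdges T) + R / 16 ≤ weight x (cycleEdges (v :: S₁ ++ u :: S₂)) ∧
      (∀ e, e ∈ pathEdges S₁ ∨ e ∈ pathEdges S₂ → (∀ p ∈ Z, p ∉ e) → e ∈ cycleEdges T) ∧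
      ∃ N : Finset (Sym2 (Fin n)), N.card ≤ 6 ∧
        ∀ e ∈ cycleEdges T, e ∈ pathEdges S₁ ∨ e ∈ pathEdges S₂ ∨ e ∈ N := by
  classical
  set a := S₂.getLast h₂ with ha
  set b := S₁.head h₁ with hb
  set c := S₁.getLast h₁ with hc
  set d := S₂.head h₂ with hd
  have haS : a ∈ S₂ := List.getLast_mem _
  have hbS : b ∈ S₁ := List.head_mem _
  have hcS : c ∈ S₁ := List.getLast_mem _
  have hfar₁ : ∀ w ∈ S₁, R ≤ dist (x v) (x w) := fun w hw =>
    hg.far w (fun h => hu₁ (h ▸ hw)) (fun h => hv₁ (h ▸ hw))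
  have hfar₂ : ∀ w ∈ S₂, R ≤ dist (x v) (x w) := fun w hw =>
    hg.far w (fun h => hu₂ (h ▸ hw)) (fun h => hv₂ (h ▸ hw))
  have hW : weight x (cycleEdges (v :: S₁ ++ u :: S₂)) = dist (x v) (x b) +
      weight x (pathEdges S₁) + dist (x c) (x u) + dist (x u) (x d) + weight x (pathEdges S₂) +
      dist (x a) (x v) := by
    rw [cycleEdges_two_paths h₁ h₂]
    simp only [weight_add, weight_singleton]
    rfl
  have huv := hg.near
  have hne : ∀ w, R ≤ dist (x v) (x w) → x w - x v ≠ 0 := by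
    intro w hw h
    rw [sub_eq_zero] at h
    rw [h, dist_self] at hw
    linarith
  have hcu : dist (x v) (x c) ≤ dist (x c) (x u) + R / 32 := by
    have := dist_triangle (x v) (x u) (x c)
    rw [dist_comm (x v) (x u), dist_comm (x u) (x c)] at this
    linarith
  rcases exists_inner_ge (x a - x v) (x b - x v) (x c - x v) (hne a (hfar₂ a haS))
    (hne b (hfar₁ b hbS)) (hne c (hfar₁ c hcS)) with hab | hac | hbc
  · -- move `v` next to `u`
    have hgain := gain_of_inner hR (hfar₂ a haS) (hfar₁ b hbS) hab
    obtain ⟨T, y, hperm, hmem, hT⟩ := exists_insert (L := S₁ ++ u :: S₂) (S := [v]) (p := u)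
      (by simp) (by simp)
    have hL : cycleEdges (S₁ ++ u :: S₂) = {s(a, b)} + pathEdges S₁ + {s(c, u)} + {s(u, d)} +
        pathEdges S₂ := by
      rw [cycleEdges_eq (by simp), pathEdges_append h₁ (by simp), pathEdges_cons h₂]
      simp only [List.head_append_of_ne_nil h₁, ← Multiset.singleton_add]
      rw [List.getLast_append_of_ne_nil _ (by simp), List.getLast_cons h₂]
      simp only [List.head_cons]
      abel
    refine ⟨T, by simpa using hperm, by simpa using hmem, ?_, ?_,
      {s(a, b), s(c, u), s(u, d), s(u, v), s(v, y)},
      Finset.card_le_five.trans (by norm_num), fun e he => ?_⟩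
    · have := congrArg (weight x) hT
      rw [hL] at this
      simp only [weight_add, weight_singleton, List.head_cons, List.getLast_singleton,
        pathEdges_singleton, weight_zero] at this
      rw [hW]
      have h3 := dist_triangle (x v) (x u) (x y)
      rw [dist_comm (x v) (x u)] at h3
      rw [dist_comm (x v) (x a)] at hgain
      linarith
    · intro e he _
      have hue : u ∉ e := fun h => by
        rcases he with he | he
        · exact hu₁ (mem_of_mem_pathEdges he h)
        · exact hu₂ (mem_of_mem_pathEdges he h)
      have heL : e ∈ cycleEdges T + {s(u, y)} := by
        rw [hT, hL]
        simp only [Multiset.mem_add]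
        tauto
      rcases Multiset.mem_add.1 heL with h | h
      · exact h
      · rw [Multiset.mem_singleton.1 h] at hue
        simp at hue
    · have h := Multiset.mem_add.2 (Or.inl he : e ∈ cycleEdges T ∨ e ∈ {s(u, y)})
      rw [hT, hL] at h
      simp only [Multiset.mem_add, Multiset.mem_singleton, List.head_cons,
        List.getLast_singleton, pathEdges_singleton, Multiset.notMem_zero, or_false] at h
      simp only [Finset.mem_insert, Finset.mem_singleton]
      tauto
  · -- reverse the second path
    have hgain := gain_of_inner hR (hfar₂ a haS) (hfar₁ c hcS) hac
    have hT : cycleEdges (v :: S₁ ++ (S₂.reverse ++ [u])) = {s(v, b)} + pathEdges S₁ + {s(c, a)} +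
        pathEdges S₂ + {s(d, u)} + {s(u, v)} := by
      rw [cycleEdges_eq (by simp), pathEdges_append (by simp) (by simp),
        pathEdges_append (l₁ := S₂.reverse) (by simpa using h₂) (by simp), pathEdges_cons h₁,
        pathEdges_reverse]
      simp only [List.cons_append, List.head_cons, List.getLast_cons h₁, List.getLast_reverse,
        ← Multiset.singleton_add, List.head_append_of_ne_nil (List.reverse_ne_nil_iff.2 h₂),
        List.head_reverse, pathEdges_singleton]
      rw [List.getLast_cons (by simp), List.getLast_append_of_ne_nil _ (by simp),
        List.getLast_append_of_ne_nil _ (by simp), List.getLast_singleton]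
      abel
    refine ⟨v :: S₁ ++ (S₂.reverse ++ [u]), ?_, ?_, ?_, ?_, {s(v, b), s(c, a), s(d, u), s(u, v)},
      Finset.card_le_four.trans (by norm_num), fun e he => ?_⟩
    · rw [← Multiset.coe_eq_coe]
      simp only [← Multiset.coe_add, ← Multiset.cons_coe, ← Multiset.singleton_add,
        Multiset.coe_reverse, Multiset.coe_nil]
      abel
    · rw [hT]; simp
    · rw [hT, hW]
      simp only [weight_add, weight_singleton]
      rw [dist_comm (x c) (x a), dist_comm (x d) (x u)]
      rw [dist_comm (x v) (x a)] at hgain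
      linarith
    · intro e he _
      rw [hT]
      simp only [Multiset.mem_add]
      tauto
    · rw [hT] at he
      simp only [Multiset.mem_add, Multiset.mem_singleton] at he
      simp only [Finset.mem_insert, Finset.mem_singleton]
      tauto
  · -- close the first path and merge it with the second one
    have hL : cycleEdges (v :: u :: S₂) = {s(a, v)} + {s(v, u)} + {s(u, d)} + pathEdges S₂ := by
      rw [cycleEdges_eq (by simp), pathEdges_cons_cons, pathEdges_cons h₂]
      simp only [List.head_cons, ← Multiset.singleton_add]
      rw [List.getLast_cons (by simp), List.getLast_cons h₂]
      abel
    have hedge : ∀ {S : List (Fin n)} (hS : S ≠ []) {r y : Fin n} {T : List (Fin n)},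
        r ∈ S₂ → cycleEdges T + {s(r, y)} = cycleEdges (v :: u :: S₂) + {s(r, S.head hS)} +
          {s(S.getLast hS, y)} + pathEdges S →
        s(u, v) ∈ cycleEdges T ∧ (∀ e, e ∈ pathEdges S ∨ e ∈ pathEdges S₂ → r ∉ e →
          e ∈ cycleEdges T) ∧ ∀ e ∈ cycleEdges T, e ∈ pathEdges S ∨ e ∈ pathEdges S₂ ∨
          e ∈ ({s(a, v), s(v, u), s(u, d), s(r, S.head hS), s(S.getLast hS, y)} :
            Finset (Sym2 (Fin n))) := by
      intro S hS r y T hr hT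
      have key : ∀ e, e ∈ cycleEdges (v :: u :: S₂) ∨ e ∈ pathEdges S → r ∉ e →
          e ∈ cycleEdges T := by
        intro e he hre
        have : e ∈ cycleEdges T + {s(r, y)} := by
          rw [hT]
          simp only [Multiset.mem_add]
          tauto
        rcases Multiset.mem_add.1 this with h | h
        · exact h
        · rw [Multiset.mem_singleton.1 h] at hre
          simp at hre
      refine ⟨key _ (Or.inl ?_) ?_, fun e he hre => key e ?_ hre, fun e he => ?_⟩
      · rw [hL, Sym2.eq_swap]; simp
      · intro h
        rcases Sym2.mem_iff.1 h with rfl | rfl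
        · exact hu₂ hr
        · exact hv₂ hr
      · rcases he with h | h
        · exact Or.inr h
        · left
          rw [hL]
          simp [h]
      · have h := Multiset.mem_add.2 (Or.inl he : e ∈ cycleEdges T ∨ e ∈ {s(r, y)})
        rw [hT, hL] at h
        simp only [Multiset.mem_add, Multiset.mem_singleton] at h
        simp only [Finset.mem_insert, Finset.mem_singleton]
        tauto
    have hgain := gain_of_inner hR (hfar₁ b hbS) (hfar₁ c hcS) hbc
    rcases hring with ⟨p, hp, r, hr, hpZ, hrZ, hpr⟩ | hring
    · obtain ⟨X₁, X₂, hX⟩ := List.append_of_mem hp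
      obtain ⟨T, y, hperm, -, hT⟩ := exists_insert (L := v :: u :: S₂) (S := p :: X₂ ++ X₁)
        (p := r) (by simp [hr]) (by simp)
      have hclosed : pathEdges (p :: X₂ ++ X₁) + {s((p :: X₂ ++ X₁).getLast (by simp), p)} =
          pathEdges S₁ + {s(c, b)} := by
        have e1 := cycleEdges_eq (l := p :: X₂ ++ X₁) (by simp)
        have e2 := cycleEdges_eq h₁
        have e3 : cycleEdges (p :: X₂ ++ X₁) = cycleEdges S₁ := by
          rw [hX, cycleEdges_append_comm X₁]
        rw [e3, e2] at e1
        simp only [← Multiset.singleton_add, List.cons_append, List.head_cons] at e1 ⊢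
        rw [add_comm, ← e1, add_comm]
      obtain ⟨hmem, hkeep, hnew⟩ := hedge _ hr hT
      refine ⟨T, ?_, hmem, ?_, ?_, insert s(c, b) {s(a, v), s(v, u), s(u, d), s(r, p),
        s((p :: X₂ ++ X₁).getLast (by simp), y)}, (Finset.card_insert_le _ _).trans
          (Nat.succ_le_succ Finset.card_le_five), fun e he => ?_⟩
      · refine hperm.trans ?_
        rw [hX, ← Multiset.coe_eq_coe]
        simp only [← Multiset.coe_add, ← Multiset.cons_coe, ← Multiset.singleton_add]
        abel
      · have w1 := congrArg (weight x) hT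
        have w2 := congrArg (weight x) hclosed
        rw [hL] at w1
        simp only [weight_add, weight_singleton, List.cons_append, List.head_cons] at w1 w2
        rw [hW]
        set g := (p :: (X₂ ++ X₁)).getLast (by simp) with hgl
        have t1 := dist_triangle (x g) (x p) (x y)
        have t2 := dist_triangle (x p) (x r) (x y)
        rw [dist_comm (x c) (x b)] at w2
        rw [dist_comm (x v) (x u)] at w1
        rw [dist_comm (x r) (x p)] at w1
        linarith
      · intro e he hZ
        refine hkeep e ?_ (hZ r hrZ)
        rcases he with h | h
        · left
          have : e ∈ pathEdges (p :: X₂ ++ X₁) +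
              {s((p :: X₂ ++ X₁).getLast (by simp), p)} := by
            rw [hclosed]
            exact Multiset.mem_add.2 (Or.inl h)
          rcases Multiset.mem_add.1 this with h' | h'
          · exact h'
          · have := hZ p hpZ
            rw [Multiset.mem_singleton.1 h'] at this
            simp at this
        · exact Or.inr h
      · rcases hnew e he with h | h | h
        · have := Multiset.mem_add.2 (Or.inl h : e ∈ pathEdges (p :: X₂ ++ X₁) ∨
            e ∈ {s((p :: X₂ ++ X₁).getLast (by simp), p)})
          rw [hclosed, Multiset.mem_add, Multiset.mem_singleton] at this
          rcases this with h | h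
          · exact Or.inl h
          · exact Or.inr (Or.inr (h ▸ Finset.mem_insert_self _ _))
        · exact Or.inr (Or.inl h)
        · exact Or.inr (Or.inr (Finset.mem_insert_of_mem h))
    · -- the circle point in the direction of `b`
      have hbn : 0 < ‖x b - x v‖ := norm_pos_iff.2 (hne b (hfar₁ b hbS))
      have hbd : dist (x v) (x b) = ‖x b - x v‖ := by rw [dist_comm, dist_eq_norm]
      have hRb : R ≤ ‖x b - x v‖ := by rw [← hbd]; exact hfar₁ b hbS
      set t := R / ‖x b - x v‖ with ht
      have ht0 : 0 < t := by positivity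
      have ht1 : t ≤ 1 := by rw [ht, div_le_one hbn]; exact hRb
      have htR : t * ‖x b - x v‖ = R := by rw [ht]; field_simp
      set z : Plane := x v + t • (x b - x v) with hz
      have hzv : z - x v = t • (x b - x v) := by rw [hz]; abel
      have hzd : dist z (x v) = R := by
        rw [dist_eq_norm, hzv, norm_smul, Real.norm_of_nonneg ht0.le, htR]
      have hzb : dist z (x b) = dist (x v) (x b) - R := by
        have : z - x b = (t - 1) • (x b - x v) := by rw [hz]; module
        rw [dist_eq_norm, this, norm_smul, Real.norm_of_nonpos (by linarith), hbd]
        linarith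
      -- As `z` lies on the segment from `v` to `b`, it sees the same angle at `v`. Entering `S₁` at
      -- `b` through the point `r` near `z` follows the old edge `vb` closely, and the shortcut is
      -- taken from `z` to `c`.
      have hgz := gain_of_inner hR (o := x v) (a := z) (b := x c) (by rw [dist_comm, hzd])
        (hfar₁ c hcS) (by
          rw [hzv, real_inner_smul_left, norm_smul, Real.norm_of_nonneg ht0.le]
          nlinarith)
      obtain ⟨r, hr, hrZ, hzr⟩ := hring z hzd
      obtain ⟨T, y, hperm, -, hT⟩ := exists_insert (L := v :: u :: S₂) (S := S₁)
        (p := r) (by simp [hr]) h₁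
      obtain ⟨hmem, hkeep, hnew⟩ := hedge _ hr hT
      refine ⟨T, ?_, hmem, ?_, fun e he hZ => hkeep e he (hZ r hrZ), _,
        Finset.card_le_five.trans (by norm_num), hnew⟩
      · refine hperm.trans ?_
        rw [← Multiset.coe_eq_coe]
        simp only [← Multiset.coe_add, ← Multiset.cons_coe, ← Multiset.singleton_add]
        abel
      · have w1 := congrArg (weight x) hT
        rw [hL] at w1
        simp only [weight_add, weight_singleton] at w1
        rw [hW]
        have t1 := dist_triangle (x c) (x r) (x y)
        have t2 := dist_triangle (x r) z (x b)
        have t3 := dist_triangle (x c) z (x r)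
        rw [dist_comm (x r) z] at t2
        rw [dist_comm (x c) z] at t3
        rw [dist_comm (x v) (x u)] at w1
        rw [dist_comm (x v) z] at hgz
        change _ = _ + dist (x r) (x b) + dist (x c) (x y) + _ at w1
        linarith

/-- A tour that misses the edge of a gadget can be improved. -/
theorem IsGadget.improve (hR : 0 < R) (hg : IsGadget x R u v Z) {T : List (Fin n)}
    (hT : T.Nodup) (hm : ∀ w, w ∈ T) (huv : s(u, v) ∉ cycleEdges T) :
    ∃ T' : List (Fin n), T'.Nodup ∧ (∀ w, w ∈ T') ∧ s(u, v) ∈ cycleEdges T' ∧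
      weight x (cycleEdges T') + R / 16 ≤ weight x (cycleEdges T) ∧
      (∀ e ∈ cycleEdges T, u ∉ e → v ∉ e → (∀ p ∈ Z, p ∉ e) → e ∈ cycleEdges T') ∧
      ∃ N : Finset (Sym2 (Fin n)), N.card ≤ 6 ∧
        ∀ e ∈ cycleEdges T', e ∈ cycleEdges T ∨ e ∈ N := by
  have main : ∀ S₁ S₂ : List (Fin n), (v :: S₁ ++ u :: S₂).Perm T →
      cycleEdges (v :: S₁ ++ u :: S₂) = cycleEdges T →
      ((∃ p ∈ S₁, ∃ r ∈ S₂, p ∈ Z ∧ r ∈ Z ∧ dist (x p) (x r) ≤ R / 16) ∨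
        ∀ z : Plane, dist z (x v) = R → ∃ p ∈ S₂, p ∈ Z ∧ dist z (x p) < R / 32) →
      ∃ T' : List (Fin n), T'.Nodup ∧ (∀ w, w ∈ T') ∧ s(u, v) ∈ cycleEdges T' ∧
        weight x (cycleEdges T') + R / 16 ≤ weight x (cycleEdges T) ∧
        (∀ e ∈ cycleEdges T, u ∉ e → v ∉ e → (∀ p ∈ Z, p ∉ e) → e ∈ cycleEdges T') ∧
        ∃ N : Finset (Sym2 (Fin n)), N.card ≤ 6 ∧
          ∀ e ∈ cycleEdges T', e ∈ cycleEdges T ∨ e ∈ N := by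
    intro S₁ S₂ hperm hcyc hring
    have hnd := hperm.nodup_iff.2 hT
    rw [List.cons_append, List.nodup_cons, List.nodup_append, List.nodup_cons] at hnd
    have h₁ : S₁ ≠ [] := by
      rintro rfl
      apply huv
      rw [← hcyc, Sym2.eq_swap]
      simp [cycleEdges]
    have h₂ : S₂ ≠ [] := by
      rintro rfl
      apply huv
      rw [← hcyc, cycleEdges_eq (by simp)]
      simp
    have hnd1 := hnd.1
    rw [List.mem_append, List.mem_cons, not_or, not_or] at hnd1
    obtain ⟨T', hp', hm', hw', hk', N, hN, hnew⟩ := hg.improve_aux hR h₁ h₂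
      (fun h => hnd.2.2.2 u h u (by simp) rfl) hnd1.1 hnd.2.2.1.1 hnd1.2.2 hring
    refine ⟨T', (hp'.trans hperm).nodup_iff.2 hT, fun w => (hp'.trans hperm).mem_iff.2 (hm w), hm',
      by rwa [← hcyc], fun e he hue hve hZ => hk' e ?_ hZ, N, hN, fun e he => ?_⟩
    swap
    · rw [← hcyc, cycleEdges_two_paths h₁ h₂]
      simp only [Multiset.mem_add]
      have := hnew e he
      tauto
    rw [← hcyc, cycleEdges_two_paths h₁ h₂] at he
    simp only [Multiset.mem_add, Multiset.mem_singleton] at he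
    rcases he with ((((rfl | h) | rfl) | rfl) | h) | rfl
    · simp at hve
    · exact Or.inl h
    · simp at hue
    · simp at hue
    · exact Or.inr h
    · simp at hve
  -- rotate the tour to start at `v`
  obtain ⟨A, B, hAB⟩ := List.append_of_mem (hm v)
  have huBA : u ∈ B ++ A := by
    have := hm u
    rw [hAB] at this
    simp only [List.mem_append, List.mem_cons] at this ⊢
    rcases this with h | h | h
    · exact Or.inr h
    · exact absurd h hg.ne
    · exact Or.inl h
  obtain ⟨S₁, S₂, hS⟩ := List.append_of_mem huBA
  have hperm : (v :: S₁ ++ u :: S₂).Perm T := by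
    rw [List.cons_append, ← hS, hAB, ← List.cons_append]
    exact List.perm_append_comm
  have hcyc : cycleEdges (v :: S₁ ++ u :: S₂) = cycleEdges T := by
    rw [List.cons_append, ← hS, hAB, cycleEdges_append_comm, List.cons_append]
  have hcov : ∀ z : Plane, dist z (x v) = R →
      (∃ p ∈ S₁, p ∈ Z ∧ dist z (x p) < R / 32) ∨ ∃ p ∈ S₂, p ∈ Z ∧ dist z (x p) < R / 32 := by
    intro z hz
    obtain ⟨p, hpZ, hpu, hpv, hd⟩ := hg.cover z hz
    have := hperm.mem_iff.2 (hm p)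
    simp only [List.cons_append, List.mem_cons, List.mem_append, hpu, hpv, false_or] at this
    exact this.imp (fun h => ⟨p, h, hpZ, hd⟩) fun h => ⟨p, h, hpZ, hd⟩
  have hopen : ∀ S : List (Fin n),
      IsOpen {z : Plane | ∃ p ∈ S, p ∈ Z ∧ dist z (x p) < R / 32} := by
    intro S
    have : {z : Plane | ∃ p ∈ S, p ∈ Z ∧ dist z (x p) < R / 32} =
        ⋃ p ∈ {p | p ∈ S ∧ p ∈ Z}, Metric.ball (x p) (R / 32) := by
      ext z
      simp [and_assoc]
    rw [this]
    exact isOpen_biUnion fun p _ => Metric.isOpen_ball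
  have hconn : IsPreconnected (Metric.sphere (x v) R) :=
    isPreconnected_sphere (by
      rw [← Module.finrank_eq_rank, finrank_euclideanSpace, Fintype.card_fin]
      norm_num) _ _
  -- The discs about the points of `Z` on either path cover the circle. Either one path covers it
  -- alone, or, the circle being connected, discs of both paths meet and yield points at distance at
  -- most `R / 16`.
  by_cases hall₂ : ∀ z : Plane, dist z (x v) = R → ∃ p ∈ S₂, p ∈ Z ∧ dist z (x p) < R / 32
  · exact main S₁ S₂ hperm hcyc (Or.inr hall₂)
  by_cases hall₁ : ∀ z : Plane, dist z (x v) = R → ∃ p ∈ S₁, p ∈ Z ∧ dist z (x p) < R / 32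
  -- Traversing the tour backwards exchanges the roles of the two paths.
  · have hrev : cycleEdges (v :: S₂.reverse ++ u :: S₁.reverse) =
        cycleEdges (v :: S₁ ++ u :: S₂) := by
      rw [← cycleEdges_reverse (v :: S₁ ++ u :: S₂)]
      simp only [List.cons_append, List.reverse_cons, List.reverse_append]
      rw [cycleEdges_append_comm _ [v]]
      simp
    refine main S₂.reverse S₁.reverse (List.Perm.trans ?_ hperm) (hrev.trans hcyc) (Or.inr ?_)
    · rw [← Multiset.coe_eq_coe]
      simp only [← Multiset.coe_add, ← Multiset.cons_coe, ← Multiset.singleton_add,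
        Multiset.coe_reverse]
      abel
    · simpa using hall₁
  push Not at hall₁ hall₂
  obtain ⟨z₁, hz₁, hz₁'⟩ := hall₁
  obtain ⟨z₂, hz₂, hz₂'⟩ := hall₂
  have hne₁ : ∃ p ∈ S₂, p ∈ Z ∧ dist z₁ (x p) < R / 32 := (hcov z₁ hz₁).resolve_left (by
    push Not; exact hz₁')
  have hne₂ : ∃ p ∈ S₁, p ∈ Z ∧ dist z₂ (x p) < R / 32 := (hcov z₂ hz₂).resolve_right (by
    push Not; exact hz₂')
  obtain ⟨z, -, ⟨p, hp, hpZ, hpd⟩, r, hr, hrZ, hrd⟩ := hconn _ _ (hopen S₁) (hopen S₂)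
    (fun z hz => hcov z hz) ⟨z₂, hz₂, hne₂⟩ ⟨z₁, hz₁, hne₁⟩
  refine main S₁ S₂ hperm hcyc (Or.inl ⟨p, hp, r, hr, hpZ, hrZ, ?_⟩)
  have := dist_triangle_left (x p) (x r) z
  linarith

/-- Each gadget whose edge a tour misses makes it longer. -/
theorem minTour_add_le_weight (hn : 3 ≤ n) (hR : 0 < R) {ι : Type*} (J : Finset ι)
    (u v : ι → Fin n) (Z : ι → Finset (Fin n)) (hg : ∀ j ∈ J, IsGadget x R (u j) (v j) (Z j))
    (hdis : ∀ i ∈ J, ∀ j ∈ J, i ≠ j → ∀ w, (w = u i ∨ w = v i) →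
      w ≠ u j ∧ w ≠ v j ∧ w ∉ Z j) (k : ℕ) :
    ∀ T : List (Fin n), T.Nodup → (∀ w, w ∈ T) →
      (J.filter fun j => s(u j, v j) ∉ cycleEdges T).card = k →
      minTour x + k * (R / 96) ≤ weight x (cycleEdges T) := by
  classical
  induction k using Nat.strong_induction_on with
  | _ k ih =>
    intro T hT hm hk
    rcases (J.filter fun j => s(u j, v j) ∉ cycleEdges T).eq_empty_or_nonempty with h0 | ⟨j, hj⟩
    · rw [h0] at hk
      simp only [Finset.card_empty] at hk
      rw [← hk]
      simpa using minTour_le hn x hT hm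
    · have hj' := Finset.mem_filter.1 hj
      obtain ⟨T', hT', hm', hmem, hw, hkeep, N, hN, hnew⟩ := (hg j hj'.1).improve hR hT hm hj'.2
      -- The edges of other gadgets avoid `u j`, `v j` and `Z j`, so the improvement destroys none
      -- of them and the number of missed edges drops strictly.
      have hsub : (J.filter fun i => s(u i, v i) ∉ cycleEdges T') ⊆
          (J.filter fun i => s(u i, v i) ∉ cycleEdges T).erase j := by
        intro i hi
        rw [Finset.mem_filter] at hi
        have hij : i ≠ j := by
          rintro rfl
          exact hi.2 hmem
        rw [Finset.mem_erase, Finset.mem_filter]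
        refine ⟨hij, hi.1, fun h => hi.2 (hkeep _ h ?_ ?_ ?_)⟩
        · intro h'
          exact (hdis i hi.1 j hj'.1 hij _ (Sym2.mem_iff.1 h')).1 rfl
        · intro h'
          exact (hdis i hi.1 j hj'.1 hij _ (Sym2.mem_iff.1 h')).2.1 rfl
        · intro p hp h'
          exact (hdis i hi.1 j hj'.1 hij _ (Sym2.mem_iff.1 h')).2.2 hp
      have hcard := Finset.card_le_card hsub
      rw [Finset.card_erase_of_mem hj, hk] at hcard
      have hkpos : 0 < k := by rw [← hk]; exact Finset.card_pos.2 ⟨j, hj⟩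
      have hinj : Set.InjOn (fun i => s(u i, v i)) (J : Set ι) := by
        intro i hi i' hi' h
        by_contra hne
        have h1 := hdis i hi i' hi' hne (u i) (Or.inl rfl)
        rcases Sym2.eq_iff.1 h with ⟨h, _⟩ | ⟨h, _⟩
        · exact h1.1 h
        · exact h1.2.1 h
      -- The number of missed edges also drops by at most six, so each of them accounts for a gain
      -- of at least `(R / 16) / 6 = R / 96`.
      have hnewc : (J.filter fun i => s(u i, v i) ∈ N).card ≤ 6 := by
        refine le_trans ?_ hN
        refine Finset.card_le_card_of_injOn (fun i => s(u i, v i)) ?_ ?_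
        · intro i hi
          exact (Finset.mem_filter.1 hi).2
        · exact hinj.mono fun i hi => (Finset.mem_filter.1 hi).1
      have hle : k ≤ (J.filter fun i => s(u i, v i) ∉ cycleEdges T').card + 6 := by
        rw [← hk]
        refine le_trans (Finset.card_le_card ?_) ((Finset.card_union_le _ _).trans
          (Nat.add_le_add_left hnewc _))
        intro i hi
        rw [Finset.mem_filter] at hi
        rw [Finset.mem_union, Finset.mem_filter, Finset.mem_filter]
        by_cases h : s(u i, v i) ∈ cycleEdges T'
        · exact Or.inr ⟨hi.1, (hnew _ h).resolve_left hi.2⟩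
        · exact Or.inl ⟨hi.1, h⟩
      have h1 := ih _ (by omega) T' hT' hm' rfl
      have h2 : (k : ℝ) ≤ ((J.filter fun i => s(u i, v i) ∉ cycleEdges T').card : ℝ) + 6 := by
        exact_mod_cast hle
      nlinarith

end Gadget

/-! ### Concentration of a count of events. -/

section SecondMoment

variable {Ω : Type*} [MeasurableSpace Ω] (μ : Measure Ω) [IsProbabilityMeasure μ]

open Classical in
/-- Chebyshev's inequality for the number of events that occur, for events that are almost
pairwise uncorrelated. -/
theorem measureReal_card_lt_le {ι : Type*} [Fintype ι] [Nonempty ι] {G : ι → Set Ω}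
    (hG : ∀ i, MeasurableSet (G i)) {P θ : ℝ} (hP0 : 0 < P) (hP : ∀ i, μ.real (G i) = P)
    (hθ : 0 ≤ θ) (hpair : ∀ i j, i ≠ j → μ.real (G i ∩ G j) ≤ P ^ 2 * (1 + θ)) :
    μ.real {ω | ((Finset.univ.filter fun i => ω ∈ G i).card : ℝ) < Fintype.card ι * P / 2} ≤
      4 * (1 / (Fintype.card ι * P) + θ) := by
  set N : ℝ := (Fintype.card ι : ℝ) with hN
  have hN0 : 0 < N := by rw [hN]; exact_mod_cast Fintype.card_pos
  set X : Ω → ℝ := fun ω => ∑ i, (G i).indicator 1 ω with hX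
  have hXc : ∀ ω, ((Finset.univ.filter fun i => ω ∈ G i).card : ℝ) = X ω := by
    intro ω
    rw [hX, Finset.card_filter]
    push_cast
    exact Finset.sum_congr rfl fun i _ => by simp [Set.indicator_apply]
  have hint : ∀ A : Set Ω, MeasurableSet A → Integrable (A.indicator (1 : Ω → ℝ)) μ := fun A hA =>
    (integrable_const (1 : ℝ)).indicator hA
  have hsq : ∀ ω, (X ω - N * P) ^ 2 = ∑ i, ∑ j, (G i ∩ G j).indicator (1 : Ω → ℝ) ω -
      2 * (N * P) * ∑ i, (G i).indicator 1 ω + (N * P) ^ 2 := by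
    intro ω
    have : ∑ i, ∑ j, (G i ∩ G j).indicator (1 : Ω → ℝ) ω = X ω * X ω := by
      rw [hX, Finset.sum_mul_sum]
      refine Finset.sum_congr rfl fun i _ => Finset.sum_congr rfl fun j _ => ?_
      rw [Set.inter_indicator_one, Pi.mul_apply]
    rw [this]
    ring
  have hi1 : Integrable (fun ω => ∑ i, ∑ j, (G i ∩ G j).indicator (1 : Ω → ℝ) ω) μ :=
    integrable_finsetSum _ fun i _ => integrable_finsetSum _ fun j _ =>
      hint _ ((hG i).inter (hG j))
  have hi2 : Integrable (fun ω => ∑ i, (G i).indicator (1 : Ω → ℝ) ω) μ :=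
    integrable_finsetSum _ fun i _ => hint _ (hG i)
  have hi3 : Integrable (fun ω => (X ω - N * P) ^ 2) μ := by
    simp only [hsq]
    exact (hi1.sub (hi2.const_mul _)).add (integrable_const _)
  have hval : ∫ ω, (X ω - N * P) ^ 2 ∂μ =
      ∑ i, ∑ j, μ.real (G i ∩ G j) - 2 * (N * P) * ∑ i, μ.real (G i) + (N * P) ^ 2 := by
    simp only [hsq]
    have h12 : Integrable (fun ω => ∑ i, ∑ j, (G i ∩ G j).indicator (1 : Ω → ℝ) ω -
        2 * (N * P) * ∑ i, (G i).indicator 1 ω) μ := hi1.sub (hi2.const_mul _)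
    rw [integral_add h12 (integrable_const _),
      integral_sub hi1 (hi2.const_mul _), integral_const_mul, integral_const,
      integral_finsetSum _ fun i _ => hint _ (hG i),
      integral_finsetSum _ fun i _ => integrable_finsetSum _ fun j _ =>
        hint _ ((hG i).inter (hG j))]
    simp only [probReal_univ, smul_eq_mul, one_mul]
    congr 2
    · refine Finset.sum_congr rfl fun i _ => ?_
      rw [integral_finsetSum _ fun j _ => hint _ ((hG i).inter (hG j))]
      exact Finset.sum_congr rfl fun j _ => integral_indicator_one ((hG i).inter (hG j))
    · congr 1
      exact Finset.sum_congr rfl fun i _ => integral_indicator_one (hG i)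
  -- The diagonal terms contribute `N P`, the slack in the pair correlations `(N P)² θ`.
  have hbound : ∫ ω, (X ω - N * P) ^ 2 ∂μ ≤ N * P + (N * P) ^ 2 * θ := by
    have h1 : ∑ i, ∑ j, μ.real (G i ∩ G j) ≤ ∑ i : ι, (P + N * (P ^ 2 * (1 + θ))) := by
      refine Finset.sum_le_sum fun i _ => ?_
      have : ∀ j, μ.real (G i ∩ G j) ≤ (if i = j then P else 0) + P ^ 2 * (1 + θ) := by
        intro j
        by_cases h : i = j
        · subst h
          rw [Set.inter_self, hP, if_pos rfl]
          nlinarith [mul_nonneg (sq_nonneg P) hθ, sq_nonneg P]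
        · rw [if_neg h, zero_add]
          exact hpair i j h
      refine (Finset.sum_le_sum fun j _ => this j).trans (le_of_eq ?_)
      rw [Finset.sum_add_distrib, Finset.sum_ite_eq, if_pos (Finset.mem_univ _), Finset.sum_const,
        nsmul_eq_mul, Finset.card_univ]
    rw [Finset.sum_const, nsmul_eq_mul, Finset.card_univ] at h1
    rw [hval]
    simp only [hP, Finset.sum_const, nsmul_eq_mul, Finset.card_univ]
    rw [← hN] at h1 ⊢
    nlinarith
  have hm := mul_meas_ge_le_integral_of_nonneg (μ := μ) (f := fun ω => (X ω - N * P) ^ 2)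
    (ae_of_all _ fun ω => sq_nonneg _) hi3 ((N * P / 2) ^ 2)
  have hsub : μ.real {ω | ((Finset.univ.filter fun i => ω ∈ G i).card : ℝ) < N * P / 2} ≤
      μ.real {ω | (N * P / 2) ^ 2 ≤ (X ω - N * P) ^ 2} := by
    refine measureReal_mono fun ω hω => ?_
    have hω : ((Finset.univ.filter fun i => ω ∈ G i).card : ℝ) < N * P / 2 := hω
    change (N * P / 2) ^ 2 ≤ (X ω - N * P) ^ 2
    rw [hXc] at hω
    rw [← neg_sub, neg_sq]
    have : 0 < N * P := by positivity
    exact pow_le_pow_left₀ (by positivity) (by linarith) 2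
  refine hsub.trans ?_
  have hNP : 0 < N * P := by positivity
  have h4 : (N * P / 2) ^ 2 * μ.real {ω | (N * P / 2) ^ 2 ≤ (X ω - N * P) ^ 2} ≤
      N * P + (N * P) ^ 2 * θ := hm.trans hbound
  have : 4 * (1 / (N * P) + θ) = (N * P + (N * P) ^ 2 * θ) / (N * P / 2) ^ 2 := by
    field_simp
    ring
  rw [this, le_div_iff₀ (by positivity)]
  linarith

end SecondMoment

/-! ### Occupancy probabilities for independent points. -/

section Occupancy

variable {E : Type*} [MeasurableSpace E] (ν : Measure E) [IsProbabilityMeasure ν]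
variable {S : Type*} [Fintype S] {n : ℕ}

/-- The points indexed by `t` lie in the given cells, and all the others in `d`. -/
def occupancy (c : S → Set E) (d : Set E) (t : S → Fin n) : Set (Fin n → E) :=
  {x | (∀ s, x (t s) ∈ c s) ∧ ∀ i, i ∉ Set.range t → x i ∈ d}

theorem measurableSet_occupancy {c : S → Set E} {d : Set E} (hc : ∀ s, MeasurableSet (c s))
    (hd : MeasurableSet d) (t : S → Fin n) : MeasurableSet (occupancy c d t) := by
  have : occupancy c d t = (⋂ s, (fun x : Fin n → E => x (t s)) ⁻¹' c s) ∩
      ⋂ i, ⋂ (_ : i ∉ Set.range t), (fun x : Fin n → E => x i) ⁻¹' d := by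
    ext x
    simp [occupancy]
  rw [this]
  exact (MeasurableSet.iInter fun s => measurable_pi_apply _ (hc s)).inter
    (MeasurableSet.iInter fun i => MeasurableSet.iInter fun _ => measurable_pi_apply _ hd)

theorem measureReal_occupancy (c : S → Set E) (d : Set E) {t : S → Fin n}
    (ht : Function.Injective t) :
    (Measure.pi fun _ : Fin n => ν).real (occupancy c d t) =
      (∏ s, ν.real (c s)) * ν.real d ^ (n - Fintype.card S) := by
  classical
  set f : Fin n → Set E := fun i => if h : ∃ s, t s = i then c h.choose else d with hf
  have hft : ∀ s, f (t s) = c s := by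
    intro s
    have h : ∃ s', t s' = t s := ⟨s, rfl⟩
    rw [hf]
    simp only
    rw [dif_pos h, ht h.choose_spec]
  have hfd : ∀ i, i ∉ Set.range t → f i = d := fun i hi => dif_neg hi
  have hset : occupancy c d t = Set.univ.pi f := by
    ext x
    rw [Set.mem_univ_pi]
    constructor
    · rintro ⟨h1, h2⟩ i
      by_cases h : i ∈ Set.range t
      · obtain ⟨s, rfl⟩ := h
        rw [hft]; exact h1 s
      · rw [hfd i h]; exact h2 i h
    · intro h
      exact ⟨fun s => hft s ▸ h (t s), fun i hi => hfd i hi ▸ h i⟩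
  rw [hset, measureReal_def, Measure.pi_pi, ENNReal.toReal_prod]
  simp only [← measureReal_def]
  rw [← Finset.prod_mul_prod_compl (Finset.univ.image t), Finset.prod_image fun _ _ _ _ h => ht h]
  simp only [hft]
  congr 1
  rw [Finset.prod_congr rfl fun i hi => by
    rw [hfd i (by simpa using hi)], Finset.prod_const, Finset.card_compl,
    Finset.card_image_of_injective _ ht, Fintype.card_fin, Finset.card_univ]

/-- Each cell contains exactly one of the points, and the rest of the box none. -/
def exactOccupancy (n : ℕ) (c : S → Set E) (b : Set E) : Set (Fin n → E) :=
  ⋃ t : S ↪ Fin n, occupancy c bᶜ t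

theorem measurableSet_exactOccupancy {c : S → Set E} {b : Set E} (hc : ∀ s, MeasurableSet (c s))
    (hb : MeasurableSet b) : MeasurableSet (exactOccupancy n c b) :=
  MeasurableSet.iUnion fun t => measurableSet_occupancy hc hb.compl t

/-- The events for different assignments `t` are disjoint: a point in the box must be one of the
assigned ones, and disjointness of the cells identifies its cell. Each event is a product set, so
their probabilities add up. -/
theorem measureReal_exactOccupancy {c : S → Set E} {b : Set E} (hc : ∀ s, MeasurableSet (c s))
    (hb : MeasurableSet b) (hcb : ∀ s, c s ⊆ b) (hdis : ∀ s s', s ≠ s' → Disjoint (c s) (c s'))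
    {a A : ℝ} (ha : ∀ s, ν.real (c s) = a) (hA : ν.real b = A) :
    (Measure.pi fun _ : Fin n => ν).real (exactOccupancy n c b) =
      n.descFactorial (Fintype.card S) * (a ^ Fintype.card S * (1 - A) ^ (n - Fintype.card S)) := by
  classical
  rw [exactOccupancy, measureReal_iUnion_fintype]
  · rw [Finset.sum_congr rfl fun t _ => measureReal_occupancy ν c bᶜ t.injective]
    simp only [ha, probReal_compl_eq_one_sub hb, hA, Finset.prod_const, Finset.sum_const,
      nsmul_eq_mul, Finset.card_univ, Fintype.card_embedding_eq, Fintype.card_fin]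
  · intro t t' htt'
    refine Set.disjoint_left.2 fun x hx hx' => htt' ?_
    ext s
    have h1 := hx.1 s
    by_cases h : t s ∈ Set.range t'
    · obtain ⟨s', hs'⟩ := h
      have h2 := hx'.1 s'
      rw [hs'] at h2
      have : s = s' := by
        by_contra hne
        exact Set.disjoint_left.1 (hdis s s' hne) h1 h2
      rw [this, hs', this]
    · exact absurd (hcb s h1) (hx'.2 _ h)
  · exact fun t => measurableSet_occupancy hc hb.compl t

/-- A union bound over pairs of assignments suffices. If the two assignments share an index, that
point would lie in both of the disjoint boxes, so the term vanishes; otherwise the pair is a single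
assignment for the sum type. -/
theorem measureReal_exactOccupancy_inter_le {c c' : S → Set E} {b b' : Set E}
    (hb : MeasurableSet b) (hb' : MeasurableSet b') (hcb : ∀ s, c s ⊆ b)
    (hcb' : ∀ s, c' s ⊆ b') (hbb' : Disjoint b b')
    {a A : ℝ} (ha : ∀ s, ν.real (c s) = a) (ha' : ∀ s, ν.real (c' s) = a)
    (hA : ν.real b = A) (hA' : ν.real b' = A) :
    (Measure.pi fun _ : Fin n => ν).real (exactOccupancy n c b ∩ exactOccupancy n c' b') ≤
      (n.descFactorial (Fintype.card S)) ^ 2 *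
        (a ^ (2 * Fintype.card S) * (1 - 2 * A) ^ (n - 2 * Fintype.card S)) := by
  classical
  have ha0 : 0 ≤ a ^ (2 * Fintype.card S) := by
    rw [pow_mul']
    exact sq_nonneg _
  have hd : ν.real (b ∪ b')ᶜ = 1 - 2 * A := by
    rw [probReal_compl_eq_one_sub (hb.union hb'), measureReal_union hbb' hb', hA, hA']
    ring
  have hd0 : 0 ≤ 1 - 2 * A := hd ▸ measureReal_nonneg
  have hsub : exactOccupancy n c b ∩ exactOccupancy n c' b' ⊆
      ⋃ p : (S ↪ Fin n) × (S ↪ Fin n), occupancy c bᶜ p.1 ∩ occupancy c' b'ᶜ p.2 := by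
    rintro x ⟨h1, h2⟩
    obtain ⟨t, ht⟩ := Set.mem_iUnion.1 h1
    obtain ⟨t', ht'⟩ := Set.mem_iUnion.1 h2
    exact Set.mem_iUnion.2 ⟨(t, t'), ht, ht'⟩
  refine (measureReal_mono hsub).trans ((measureReal_iUnion_fintype_le _).trans ?_)
  have hp : ∀ p : (S ↪ Fin n) × (S ↪ Fin n), (Measure.pi fun _ : Fin n => ν).real
      (occupancy c bᶜ p.1 ∩ occupancy c' b'ᶜ p.2) ≤
        a ^ (2 * Fintype.card S) * (1 - 2 * A) ^ (n - 2 * Fintype.card S) := by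
    rintro ⟨t, t'⟩
    by_cases h : Function.Injective (Sum.elim t t')
    · have hle : occupancy c bᶜ t ∩ occupancy c' b'ᶜ t' ⊆
          occupancy (Sum.elim c c') (b ∪ b')ᶜ (Sum.elim t t') := by
        rintro x ⟨h1, h2⟩
        refine ⟨fun s => ?_, fun i hi => ?_⟩
        · rcases s with s | s
          · exact h1.1 s
          · exact h2.1 s
        · rw [Set.Sum.elim_range, Set.mem_union, not_or] at hi
          rw [Set.compl_union]
          exact ⟨h1.2 i hi.1, h2.2 i hi.2⟩
      refine (measureReal_mono hle).trans (le_of_eq ?_)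
      rw [measureReal_occupancy ν _ _ h, hd, Fintype.prod_sum_type]
      simp only [Sum.elim_inl, Sum.elim_inr, ha, ha', Finset.prod_const, Finset.card_univ,
        Fintype.card_sum, two_mul, pow_add]
    · have hemp : occupancy c bᶜ t ∩ occupancy c' b'ᶜ t' = ∅ := by
        refine Set.eq_empty_of_forall_notMem ?_
        rintro x ⟨h1, h2⟩
        refine h (t.injective.sumElim t'.injective fun s s' hss' => ?_)
        have h3 := hcb _ (h1.1 s)
        rw [hss'] at h3
        exact Set.disjoint_left.1 hbb' h3 (hcb' _ (h2.1 s'))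
      rw [hemp, measureReal_empty]
      positivity
  refine (Finset.sum_le_sum fun p _ => hp p).trans (le_of_eq ?_)
  rw [Finset.sum_const, nsmul_eq_mul, Finset.card_univ, Fintype.card_prod,
    Fintype.card_embedding_eq, Fintype.card_fin]
  push_cast
  ring

end Occupancy

/-! ### Half-open grid squares. -/

section Cells

/-- The square with lower left corner `c / M` and side `1 / M`. -/
def cell (M : ℕ) (c : ℕ × ℕ) : Set Plane :=
  {p | ((c.1 : ℝ) ≤ M * p 0 ∧ M * p 0 < c.1 + 1) ∧ ((c.2 : ℝ) ≤ M * p 1 ∧ M * p 1 < c.2 + 1)}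

theorem disjoint_cell (M : ℕ) {c c' : ℕ × ℕ} (h : c ≠ c') :
    Disjoint (cell M c) (cell M c') := by
  refine Set.disjoint_left.2 fun p hp hp' => h ?_
  have key : ∀ {a b : ℕ} {y : ℝ}, (a : ℝ) ≤ y → y < a + 1 → (b : ℝ) ≤ y → y < b + 1 → a = b := by
    intro a b y h1 h2 h3 h4
    have h5 : a < b + 1 := by exact_mod_cast h1.trans_lt h4
    have h6 : b < a + 1 := by exact_mod_cast h3.trans_lt h2
    omega
  exact Prod.ext (key hp.1.1 hp.1.2 hp'.1.1 hp'.1.2) (key hp.2.1 hp.2.2 hp'.2.1 hp'.2.2)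

theorem cell_eq_preimage {M : ℕ} (hM : 0 < M) (c : ℕ × ℕ) :
    cell M c = (WithLp.ofLp : Plane → Fin 2 → ℝ) ⁻¹'
      (Set.univ.pi ![Set.Ico ((c.1 : ℝ) / M) ((c.1 + 1) / M),
        Set.Ico ((c.2 : ℝ) / M) ((c.2 + 1) / M)]) := by
  have hM' : (0 : ℝ) < M := by exact_mod_cast hM
  ext p
  simp only [cell, Set.mem_ofPred_eq, Set.mem_preimage, Set.mem_univ_pi, Fin.forall_fin_two,
    Matrix.cons_val_zero, Matrix.cons_val_one, Set.mem_Ico, div_le_iff₀ hM', lt_div_iff₀ hM',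
    mul_comm]

theorem measurableSet_cell {M : ℕ} (hM : 0 < M) (c : ℕ × ℕ) : MeasurableSet (cell M c) := by
  rw [cell_eq_preimage hM]
  refine (PiLp.volume_preserving_ofLp (Fin 2)).measurable (MeasurableSet.univ_pi fun i => ?_)
  fin_cases i <;> exact measurableSet_Ico

theorem cell_subset_unitSquare {M : ℕ} {c : ℕ × ℕ} (h1 : c.1 < M) (h2 : c.2 < M) :
    cell M c ⊆ unitSquare := by
  have key : ∀ {a : ℕ} {y : ℝ}, a < M → (a : ℝ) ≤ M * y → M * y < a + 1 → y ∈ Set.Icc (0 : ℝ) 1 := by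
    intro a y ha h1 h2
    have hM : (0 : ℝ) < M := by exact_mod_cast Nat.zero_lt_of_lt ha
    have ha' : (a : ℝ) + 1 ≤ M := by exact_mod_cast ha
    constructor
    · exact le_of_mul_le_mul_left (by rw [mul_zero]; exact (Nat.cast_nonneg a).trans h1) hM
    · exact le_of_mul_le_mul_left (by rw [mul_one]; linarith) hM
  intro p hp
  rw [unitSquare, Set.mem_ofPred_eq, Fin.forall_fin_two]
  exact ⟨key h1 hp.1.1 hp.1.2, key h2 hp.2.1 hp.2.2⟩

theorem uniformSquare_real_cell {M : ℕ} {c : ℕ × ℕ} (h1 : c.1 < M) (h2 : c.2 < M) :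
    uniformSquare.real (cell M c) = 1 / (M : ℝ) ^ 2 := by
  have hM : 0 < M := Nat.zero_lt_of_lt h1
  rw [measureReal_def, uniformSquare, Measure.restrict_apply (measurableSet_cell hM c),
    Set.inter_eq_left.2 (cell_subset_unitSquare h1 h2), cell_eq_preimage hM,
    (PiLp.volume_preserving_ofLp (Fin 2)).measure_preimage
      (MeasurableSet.univ_pi fun i => by fin_cases i <;> exact measurableSet_Ico).nullMeasurableSet,
    volume_pi_pi, Fin.prod_univ_two]
  simp only [Matrix.cons_val_zero, Matrix.cons_val_one, Real.volume_Ico]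
  rw [← sub_div, ← sub_div, add_sub_cancel_left, add_sub_cancel_left, ENNReal.toReal_mul,
    ENNReal.toReal_ofReal (by positivity)]
  field_simp

theorem subcell_subset {N K : ℕ} (hK : 0 < K) (B : ℕ × ℕ) {c : ℕ × ℕ} (h1 : c.1 < K)
    (h2 : c.2 < K) : cell (K * N) (K * B.1 + c.1, K * B.2 + c.2) ⊆ cell N B := by
  have hK' : (0 : ℝ) < K := by exact_mod_cast hK
  have key : ∀ {a b : ℕ} {y : ℝ}, a < K → ((K * b + a : ℕ) : ℝ) ≤ (K * N : ℕ) * y →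
      (K * N : ℕ) * y < ((K * b + a : ℕ) : ℝ) + 1 → (b : ℝ) ≤ N * y ∧ N * y < b + 1 := by
    intro a b y ha h1 h2
    have ha' : (a : ℝ) + 1 ≤ K := by exact_mod_cast ha
    push_cast at h1 h2
    constructor
    · exact le_of_mul_le_mul_left (by nlinarith [(Nat.cast_nonneg a : (0 : ℝ) ≤ a)]) hK'
    · exact lt_of_mul_lt_mul_left (by nlinarith) hK'.le
  exact fun p hp => ⟨key h1 hp.1.1 hp.1.2, key h2 hp.2.1 hp.2.2⟩

end Cells

/-! ### A box with a prescribed occupancy pattern contains a gadget. -/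

section Spots

/-- The two central cells of a box and the cells far from them. -/
def Spot : Type :=
  {c : ℕ × ℕ // (c.1 < 1000 ∧ c.2 < 1000) ∧ (c = (500, 500) ∨ c = (499, 500) ∨
    162000 ≤ ((c.1 : ℝ) - 500) ^ 2 + ((c.2 : ℝ) - 500) ^ 2)}

instance : Finite Spot :=
  Set.Finite.to_subtype (((Set.finite_Iio 1000).prod (Set.finite_Iio 1000)).subset
    fun _ hc => hc.1)

instance : Fintype Spot := Fintype.ofFinite _

/-- The cells of a box that are to contain a point. -/
def spotCell (N : ℕ) (B : ℕ × ℕ) (s : Spot) : Set Plane :=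
  cell (1000 * N) (1000 * B.1 + s.1.1, 1000 * B.2 + s.1.2)

theorem spotCell_subset (N : ℕ) (B : ℕ × ℕ) (s : Spot) : spotCell N B s ⊆ cell N B :=
  subcell_subset (by norm_num) B s.2.1.1 s.2.1.2

theorem disjoint_spotCell (N : ℕ) (B : ℕ × ℕ) (s s' : Spot) (h : s ≠ s') :
    Disjoint (spotCell N B s) (spotCell N B s') := by
  refine disjoint_cell _ fun h' => h (Subtype.ext ?_)
  simp only [Prod.mk.injEq, add_right_inj] at h'
  exact Prod.ext h'.1 h'.2

theorem uniformSquare_real_spotCell {N : ℕ} {B : ℕ × ℕ} (h1 : B.1 < N) (h2 : B.2 < N) (s : Spot) :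
    uniformSquare.real (spotCell N B s) = 1 / (1000 * (N : ℝ)) ^ 2 := by
  have := s.2.1.1
  have := s.2.1.2
  rw [spotCell, uniformSquare_real_cell (by simp only; omega) (by simp only; omega)]
  push_cast
  rfl

/-- Together with the next lemma this justifies the threshold `162000`, which lies between `400 ^ 2`
and `405 ^ 2` with room for rounding to cells. No cell of the outer family contains a point at
distance less than `400` from `v`, in units of a cell. -/
theorem sq_le_of_near {X Y a b : ℝ} (ha : |a - X| ≤ 1) (hb : |b - Y| ≤ 1)
    (h : X ^ 2 + Y ^ 2 ≤ 400 ^ 2) : a ^ 2 + b ^ 2 < 162000 := by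
  have h1 : |X| ≤ 400 := abs_le_of_sq_le_sq (by nlinarith [sq_nonneg Y]) (by norm_num)
  have h2 : |Y| ≤ 400 := abs_le_of_sq_le_sq (by nlinarith [sq_nonneg X]) (by norm_num)
  rw [abs_le] at *
  nlinarith

/-- Conversely, this puts every cell met by the circle of radius `405` about `v` into the outer
family. -/
theorem le_sq_of_near {X Y a b : ℝ} (ha : |a - X| ≤ 1) (hb : |b - Y| ≤ 1)
    (h : X ^ 2 + Y ^ 2 = 405 ^ 2) : 162000 ≤ a ^ 2 + b ^ 2 := by
  have h1 : |X| ≤ 405 := abs_le_of_sq_le_sq (by nlinarith [sq_nonneg Y]) (by norm_num)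
  have h2 : |Y| ≤ 405 := abs_le_of_sq_le_sq (by nlinarith [sq_nonneg X]) (by norm_num)
  rw [abs_le] at *
  nlinarith [sq_nonneg (a - X), sq_nonneg (b - Y)]

/-- In units of a cell the radius is `400` and the box has side `1000`. The two central cells supply
`v` and `u`; the empty cells around them supply the isolation, and the occupied outer cells the
covering of the circle. -/
theorem exists_isGadget {n N : ℕ} (hN : 0 < N) (B : ℕ × ℕ) {x : Fin n → Plane}
    (hx : x ∈ exactOccupancy n (spotCell N B) (cell N B)) :
    ∃ (u v : Fin n) (Z : Finset (Fin n)), x u ∈ cell N B ∧ x v ∈ cell N B ∧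
      (∀ p ∈ Z, x p ∈ cell N B) ∧ IsGadget x (2 / (5 * N)) u v Z := by
  classical
  obtain ⟨t, ht, hout⟩ := Set.mem_iUnion.1 hx
  set M : ℝ := 1000 * (N : ℝ) with hM
  have hM0 : 0 < M := by rw [hM]; positivity
  have hR : (2 : ℝ) / (5 * N) = 400 / M := by rw [hM]; field_simp; norm_num
  have hR0 : 0 < 400 / M := by positivity
  set sv : Spot := ⟨(500, 500), by norm_num⟩ with hsv
  set su : Spot := ⟨(499, 500), by norm_num⟩ with hsu
  set v := t sv with hv
  set u := t su with hu
  -- the rescaled coordinates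
  set y : Plane → Fin 2 → ℝ := fun p => ![M * p 0 - 1000 * B.1, M * p 1 - 1000 * B.2] with hy
  have hdist : ∀ p p', (M * dist p p') ^ 2 = (y p 0 - y p' 0) ^ 2 + (y p 1 - y p' 1) ^ 2 := by
    intro p p'
    rw [mul_pow, dist_plane_sq]
    simp only [hy, Matrix.cons_val_zero, Matrix.cons_val_one]
    ring
  have hdle : ∀ p p' r, |y p 0 - y p' 0| ≤ r → |y p 1 - y p' 1| ≤ r →
      dist p p' ≤ 3 / 2 * r / M := by
    intro p p' r h0 h1
    have : M * dist p p' ≤ 3 / 2 * r := by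
      have hr : 0 ≤ r := (abs_nonneg _).trans h0
      refine abs_le_of_sq_le_sq' ?_ (by positivity) |>.2
      rw [hdist]
      have := sq_le_sq' (abs_le.1 h0).1 (abs_le.1 h0).2
      have := sq_le_sq' (abs_le.1 h1).1 (abs_le.1 h1).2
      nlinarith
    rw [le_div_iff₀ hM0]
    linarith
  have hspot : ∀ s : Spot, ((s.1.1 : ℝ) ≤ y (x (t s)) 0 ∧ y (x (t s)) 0 < s.1.1 + 1) ∧
      ((s.1.2 : ℝ) ≤ y (x (t s)) 1 ∧ y (x (t s)) 1 < s.1.2 + 1) := by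
    intro s
    have h := ht s
    simp only [spotCell, cell, Set.mem_ofPred_eq] at h
    push_cast at h
    simp only [hy, Matrix.cons_val_zero, Matrix.cons_val_one, hM]
    refine ⟨⟨?_, ?_⟩, ?_, ?_⟩ <;> linarith [h.1.1, h.1.2, h.2.1, h.2.2]
  have hyv := hspot sv
  have hyu := hspot su
  rw [← hv] at hyv
  rw [← hu] at hyu
  simp only [hsv, hsu] at hyv hyu
  norm_num at hyv hyu
  have hbox : ∀ s, x (t s) ∈ cell N B := fun s => spotCell_subset N B s (ht s)
  refine ⟨u, v, Finset.univ.filter fun i => x i ∈ cell N B, hbox _, hbox _,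
    fun p hp => (Finset.mem_filter.1 hp).2, ?_⟩
  rw [hR]
  constructor
  · intro h
    have := congrArg (fun s : Spot => s.1.1) (t.injective h)
    simp [hsu, hsv] at this
  · refine (hdle _ _ 2 ?_ ?_).trans ?_
    · rw [abs_le]; constructor <;> linarith [hyv.1.1, hyv.1.2, hyu.1.1, hyu.1.2]
    · rw [abs_le]; constructor <;> linarith [hyv.2.1, hyv.2.2, hyu.2.1, hyu.2.2]
    · rw [div_div, div_le_div_iff₀ hM0 (by positivity)]
      linarith
  · intro w hwu hwv
    by_contra hlt
    push Not at hlt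
    have hlt' : M * dist (x v) (x w) < 400 := by
      rw [lt_div_iff₀ hM0] at hlt
      linarith
    have hsq : (y (x v) 0 - y (x w) 0) ^ 2 + (y (x v) 1 - y (x w) 1) ^ 2 ≤ 400 ^ 2 := by
      rw [← hdist]
      exact pow_le_pow_left₀ (by positivity) hlt'.le 2
    by_cases hw : w ∈ Set.range t
    · obtain ⟨s, rfl⟩ := hw
      have hs := hspot s
      have hfar : 162000 ≤ ((s.1.1 : ℝ) - 500) ^ 2 + ((s.1.2 : ℝ) - 500) ^ 2 := by
        rcases s.2.2 with h | h | h
        · exact absurd (congrArg t (Subtype.ext h : s = sv)) hwv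
        · exact absurd (congrArg t (Subtype.ext h : s = su)) hwu
        · exact h
      refine absurd hfar (not_le.2 ?_)
      rw [← neg_sq ((s.1.1 : ℝ) - 500), ← neg_sq ((s.1.2 : ℝ) - 500)]
      refine sq_le_of_near ?_ ?_ hsq
      · rw [abs_le]; constructor <;> linarith [hyv.1.1, hyv.1.2, hs.1.1, hs.1.2]
      · rw [abs_le]; constructor <;> linarith [hyv.2.1, hyv.2.2, hs.2.1, hs.2.2]
    · refine hout w hw ?_
      have h0 := abs_le_of_sq_le_sq' (by nlinarith [sq_nonneg (y (x v) 1 - y (x w) 1)] :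
        (y (x v) 0 - y (x w) 0) ^ 2 ≤ 400 ^ 2) (by norm_num)
      have h1 := abs_le_of_sq_le_sq' (by nlinarith [sq_nonneg (y (x v) 0 - y (x w) 0)] :
        (y (x v) 1 - y (x w) 1) ^ 2 ≤ 400 ^ 2) (by norm_num)
      have e0 : y (x w) 0 = 1000 * (N * x w 0) - 1000 * B.1 := by
        change M * x w 0 - 1000 * B.1 = _
        rw [hM]; ring
      have e1 : y (x w) 1 = 1000 * (N * x w 1) - 1000 * B.2 := by
        change M * x w 1 - 1000 * B.2 = _
        rw [hM]; ring
      refine ⟨⟨?_, ?_⟩, ?_, ?_⟩ <;>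
        linarith [hyv.1.1, hyv.1.2, hyv.2.1, hyv.2.2, h0.1, h0.2, h1.1, h1.2]
  · intro z hz
    have hz' : (y z 0 - y (x v) 0) ^ 2 + (y z 1 - y (x v) 1) ^ 2 = 400 ^ 2 := by
      rw [← hdist, hz]
      congr 1
      field_simp
    -- Pushing the circle of radius `400` out to `405` brings the point safely into an occupied
    -- cell, at the price of a shift by `5`.
    set X := 81 / 80 * (y z 0 - y (x v) 0) with hX
    set Y := 81 / 80 * (y z 1 - y (x v) 1) with hY
    have hXY : X ^ 2 + Y ^ 2 = 405 ^ 2 := by rw [hX, hY]; nlinarith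
    have hX' := abs_le_of_sq_le_sq' (by nlinarith [sq_nonneg Y] : X ^ 2 ≤ 405 ^ 2) (by norm_num)
    have hY' := abs_le_of_sq_le_sq' (by nlinarith [sq_nonneg X] : Y ^ 2 ≤ 405 ^ 2) (by norm_num)
    set a := ⌊y (x v) 0 + X⌋₊ with ha
    set b := ⌊y (x v) 1 + Y⌋₊ with hb
    have ha1 : (a : ℝ) ≤ y (x v) 0 + X := Nat.floor_le (by linarith [hyv.1.1])
    have hb1 : (b : ℝ) ≤ y (x v) 1 + Y := Nat.floor_le (by linarith [hyv.2.1])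
    have ha2 : y (x v) 0 + X < a + 1 := Nat.lt_floor_add_one _
    have hb2 : y (x v) 1 + Y < b + 1 := Nat.lt_floor_add_one _
    have ha3 : a < 1000 := by
      have : (a : ℝ) < 1000 := by linarith [hyv.1.2]
      exact_mod_cast this
    have hb3 : b < 1000 := by
      have : (b : ℝ) < 1000 := by linarith [hyv.2.2]
      exact_mod_cast this
    have hab : 162000 ≤ ((a : ℝ) - 500) ^ 2 + ((b : ℝ) - 500) ^ 2 := by
      refine le_sq_of_near ?_ ?_ hXY
      · rw [abs_le]; constructor <;> linarith [hyv.1.1, hyv.1.2]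
      · rw [abs_le]; constructor <;> linarith [hyv.2.1, hyv.2.2]
    set s : Spot := ⟨(a, b), ⟨ha3, hb3⟩, Or.inr (Or.inr hab)⟩ with hs
    have hsp := hspot s
    simp only [hs] at hsp
    rw [← hs] at hsp
    refine ⟨t s, Finset.mem_filter.2 ⟨Finset.mem_univ _, hbox s⟩, fun h => ?_, fun h => ?_, ?_⟩
    · have h' : (a, b) = (499, 500) := congrArg Subtype.val (t.injective h)
      simp only [Prod.mk.injEq] at h'
      rw [h'.1, h'.2] at hab
      norm_num at hab
    · have h' : (a, b) = (500, 500) := congrArg Subtype.val (t.injective h)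
      simp only [Prod.mk.injEq] at h'
      rw [h'.1, h'.2] at hab
      norm_num at hab
    -- The shift and the width of a cell change each coordinate by at most `7`, and `3 / 2 * 7 < 400
    -- / 32`.
    · refine (hdle _ _ 7 ?_ ?_).trans_lt ?_
      · rw [abs_le]; constructor <;> linarith [hsp.1.1, hsp.1.2]
      · rw [abs_le]; constructor <;> linarith [hsp.2.1, hsp.2.2]
      · rw [div_div, div_lt_div_iff₀ hM0 (by positivity)]
        linarith

end Spots

/-! ### Linearly many gadgets among random points. -/

section ManyGadgets

/-- At least `k` pairwise disjoint gadgets of radius `R`. -/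
def HasGadgets {n : ℕ} (x : Fin n → Plane) (R k : ℝ) : Prop :=
  ∃ (ι : Type) (J : Finset ι) (u v : ι → Fin n) (Z : ι → Finset (Fin n)),
    k ≤ J.card ∧ (∀ j ∈ J, IsGadget x R (u j) (v j) (Z j)) ∧
    ∀ i ∈ J, ∀ j ∈ J, i ≠ j → ∀ w, (w = u i ∨ w = v i) → w ≠ u j ∧ w ≠ v j ∧ w ∉ Z j

/-- The spots of the box `B` each contain one point and the rest of the box none. -/
def goodBox (n N : ℕ) (B : Fin N × Fin N) : Set (Fin n → Plane) :=
  exactOccupancy n (spotCell N (B.1, B.2)) (cell N (B.1, B.2))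

open Classical in
theorem hasGadgets_of_goodBox {n N : ℕ} [Nonempty (Fin n)] (hN : 0 < N) (x : Fin n → Plane) :
    HasGadgets x (2 / (5 * N)) (Finset.univ.filter fun B => x ∈ goodBox n N B).card := by
  choose! u v Z hu hv hZ hg using fun (B : Fin N × Fin N) (hB : x ∈ goodBox n N B) =>
    exists_isGadget hN (B.1, B.2) hB
  refine ⟨_, Finset.univ.filter fun B => x ∈ goodBox n N B, u, v, Z, le_rfl,
    fun B hB => hg B (Finset.mem_filter.1 hB).2, fun B hB B' hB' hne w hw => ?_⟩
  rw [Finset.mem_filter] at hB hB'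
  have hwB : x w ∈ cell N (B.1, B.2) := by
    rcases hw with rfl | rfl
    · exact hu B hB.2
    · exact hv B hB.2
  have hdis : Disjoint (cell N (B.1, B.2)) (cell N (B'.1, B'.2)) := by
    refine disjoint_cell _ fun h => hne ?_
    simp only [Prod.mk.injEq] at h
    exact Prod.ext (Fin.ext h.1) (Fin.ext h.2)
  refine ⟨?_, ?_, ?_⟩
  · rintro rfl
    exact Set.disjoint_left.1 hdis hwB (hu B' hB'.2)
  · rintro rfl
    exact Set.disjoint_left.1 hdis hwB (hv B' hB'.2)
  · intro h
    exact Set.disjoint_left.1 hdis hwB (hZ B' hB'.2 w h)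

theorem exp_neg_le_one_sub {A : ℝ} (hA0 : 0 ≤ A) (hA : A ≤ 1 / 2) : Real.exp (-(2 * A)) ≤ 1 - A := by
  rw [Real.exp_neg, inv_le_comm₀ (Real.exp_pos _) (by linarith)]
  refine le_trans ?_ (Real.add_one_le_exp _)
  rw [inv_le_iff_one_le_mul₀ (by linarith)]
  nlinarith

theorem exp_neg_le_one_sub_pow {A b : ℝ} (hA0 : 0 ≤ A) (hA : A ≤ 1 / 2) {k : ℕ}
    (hk : 2 * A * k ≤ b) : Real.exp (-b) ≤ (1 - A) ^ k := by
  refine le_trans ?_ (pow_le_pow_left₀ (Real.exp_pos _).le (exp_neg_le_one_sub hA0 hA) k)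
  rw [← Real.exp_nat_mul]
  exact Real.exp_le_exp.2 (by nlinarith)

/-- Each of the `m` factors of the falling factorial is at least `n / 2`, and `n / 2 ≥ N ^ 2 / 2`.
-/
theorem le_descFactorial_mul_pow {n N m : ℕ} (hn : 2 * m ≤ n) (hN : 0 < N) (hNn : N * N ≤ n) :
    (1 / 2000000 : ℝ) ^ m ≤ n.descFactorial m * (1 / (1000 * (N : ℝ)) ^ 2) ^ m := by
  have h1 : ((n : ℝ) / 2) ^ m ≤ n.descFactorial m := by
    have : (((n + 1 - m : ℕ) : ℝ)) ^ m ≤ n.descFactorial m := by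
      exact_mod_cast Nat.pow_sub_le_descFactorial n m
    refine (pow_le_pow_left₀ (by positivity) ?_ m).trans this
    rw [Nat.cast_sub (by omega)]
    have : (2 : ℝ) * m ≤ n := by exact_mod_cast hn
    push_cast
    linarith
  have hN' : (0 : ℝ) < N := by exact_mod_cast hN
  have hNn' : (N : ℝ) * N ≤ n := by exact_mod_cast hNn
  refine le_trans ?_ (mul_le_mul_of_nonneg_right h1 (by positivity))
  rw [← mul_pow]
  refine pow_le_pow_left₀ (by norm_num) ?_ m
  rw [div_mul_div_comm, div_le_div_iff₀ (by norm_num) (by positivity)]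
  nlinarith

/-- Among `N ^ 2` boxes with `N = ⌊√n⌋`, a box expects at most four points, so it shows the gadget
pattern with probability at least the constant `P₀`. Different boxes are almost uncorrelated, and
the count is at least half its mean `N ^ 2 P ≥ n P₀ / 4` with high probability. -/
theorem exists_hasGadgets : ∃ κ : ℝ, 0 < κ ∧ ∃ f : ℕ → ℝ, Tendsto f atTop (𝓝 1) ∧
    ∀ᶠ n : ℕ in atTop, ∃ R : ℝ, 2 / 5 ≤ R * √n ∧ 0 < R ∧
      ENNReal.ofReal (f n) ≤ (Measure.pi fun _ : Fin n => uniformSquare)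
        {x | HasGadgets x R (κ * n)} := by
  classical
  set m := Fintype.card Spot with hm
  set P₀ : ℝ := (1 / 2000000 : ℝ) ^ m * Real.exp (-8) with hP₀
  have hP₀0 : 0 < P₀ := by positivity
  refine ⟨P₀ / 8, by positivity,
    fun n => 1 - 4 * (4 / P₀ / n + (Real.exp (16 * m / n) - 1)), ?_, ?_⟩
  · have h1 : Tendsto (fun n : ℕ => 4 / P₀ / (n : ℝ)) atTop (𝓝 0) :=
      tendsto_const_div_atTop_nhds_zero_nat _
    have h2 : Tendsto (fun n : ℕ => Real.exp (16 * m / n)) atTop (𝓝 1) := by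
      rw [← Real.exp_zero]
      exact (Real.continuous_exp.tendsto 0).comp (tendsto_const_div_atTop_nhds_zero_nat _)
    have := ((h1.add (h2.sub_const 1)).const_mul 4).const_sub 1
    simpa using this
  · filter_upwards [eventually_ge_atTop (2 * m + 4)] with n hn
    set N := Nat.sqrt n with hN
    have hNn : N * N ≤ n := Nat.sqrt_le n
    have hnN : n < (N + 1) * (N + 1) := Nat.lt_succ_sqrt n
    have hN2 : 2 ≤ N := Nat.le_sqrt.2 (by omega)
    have hN0 : (0 : ℝ) < N := by positivity
    have hn0 : (0 : ℝ) < n := by exact_mod_cast (by omega : 0 < n)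
    have hNn' : (N : ℝ) * N ≤ n := by exact_mod_cast hNn
    have hnN' : (n : ℝ) ≤ 4 * (N * N) := by
      have : n ≤ 4 * (N * N) := by nlinarith
      exact_mod_cast this
    refine ⟨2 / (5 * N), ?_, by positivity, ?_⟩
    · have : (N : ℝ) ≤ √n := Real.le_sqrt_of_sq_le (by rw [sq]; exact hNn')
      rw [div_mul_eq_mul_div, div_le_div_iff₀ (by norm_num) (by positivity)]
      linarith
    set μ := Measure.pi fun _ : Fin n => uniformSquare with hμ
    set A : ℝ := 1 / (N : ℝ) ^ 2 with hA
    set a : ℝ := 1 / (1000 * (N : ℝ)) ^ 2 with ha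
    have hA0 : 0 < A := by positivity
    have hA2 : A ≤ 1 / 4 := by
      rw [hA]
      have : (2 : ℝ) ≤ N := by exact_mod_cast hN2
      exact one_div_le_one_div_of_le (by norm_num) (by nlinarith)
    have hAn : A * n ≤ 4 := by
      rw [hA, div_mul_eq_mul_div, div_le_iff₀ (by positivity)]
      linarith [sq (N : ℝ)]
    have hAn' : A ≤ 4 / n := by rwa [le_div_iff₀ hn0]
    have hcell : ∀ B : Fin N × Fin N, uniformSquare.real (cell N (B.1, B.2)) = A := fun B =>
      uniformSquare_real_cell B.1.2 B.2.2
    have hspot : ∀ (B : Fin N × Fin N) s, uniformSquare.real (spotCell N (B.1, B.2) s) = a :=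
      fun B s => uniformSquare_real_spotCell B.1.2 B.2.2 s
    have hmc : ∀ B : Fin N × Fin N, MeasurableSet (cell N (B.1, B.2)) := fun B =>
      measurableSet_cell (by omega) _
    have hms : ∀ (B : Fin N × Fin N) s, MeasurableSet (spotCell N (B.1, B.2) s) := fun B s =>
      measurableSet_cell (by omega) _
    set P : ℝ := n.descFactorial m * (a ^ m * (1 - A) ^ (n - m)) with hP
    have hGP : ∀ B, μ.real (goodBox n N B) = P := fun B =>
      measureReal_exactOccupancy uniformSquare (hms B) (hmc B) (spotCell_subset N _)
        (disjoint_spotCell N _) (hspot B) (hcell B)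
    have hPP₀ : P₀ ≤ P := by
      rw [hP, hP₀, ← mul_assoc]
      refine mul_le_mul (le_descFactorial_mul_pow (by omega) (by omega) hNn) ?_
        (Real.exp_pos _).le (by positivity)
      refine exp_neg_le_one_sub_pow hA0.le (by linarith) ?_
      have : ((n - m : ℕ) : ℝ) ≤ n := by exact_mod_cast Nat.sub_le _ _
      nlinarith
    have hP0 : 0 < P := hP₀0.trans_le hPP₀
    set θ : ℝ := Real.exp (16 * m / n) - 1 with hθ
    have hθ0 : 0 ≤ θ := by
      rw [hθ, sub_nonneg]
      exact Real.one_le_exp (by positivity)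
    have hpair : ∀ B B', B ≠ B' → μ.real (goodBox n N B ∩ goodBox n N B') ≤ P ^ 2 * (1 + θ) := by
      intro B B' hne
      have hdis : Disjoint (cell N (B.1, B.2)) (cell N (B'.1, B'.2)) := by
        refine disjoint_cell _ fun h => hne ?_
        simp only [Prod.mk.injEq] at h
        exact Prod.ext (Fin.ext h.1) (Fin.ext h.2)
      refine (measureReal_exactOccupancy_inter_le uniformSquare (hmc B) (hmc B')
        (spotCell_subset N _) (spotCell_subset N _) hdis (hspot B) (hspot B') (hcell B)
        (hcell B')).trans ?_
      rw [← hm, hP]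
      have h1 : (1 - 2 * A) ^ (n - 2 * m) ≤ ((1 - A) ^ 2) ^ (n - 2 * m) :=
        pow_le_pow_left₀ (by linarith) (by nlinarith) _
      -- `θ` compensates the `2 m` factors by which the exponents of the pair bound and of `P ^ 2`
      -- differ.
      have h2 : 1 ≤ (1 - A) ^ (2 * m) * (1 + θ) := by
        have h3 := exp_neg_le_one_sub_pow (b := 16 * m / n) (k := 2 * m) hA0.le (by linarith) (by
          push_cast
          rw [show (16 : ℝ) * m / n = 4 / n * (4 * m) by ring]
          nlinarith [mul_le_mul_of_nonneg_right hAn' (by positivity : (0 : ℝ) ≤ 4 * m)])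
        have h4 := mul_le_mul_of_nonneg_right h3 (Real.exp_pos (16 * m / n)).le
        rw [← Real.exp_add, neg_add_cancel, Real.exp_zero] at h4
        rw [hθ]
        simpa using h4
      have h5 : (1 - 2 * A) ^ (n - 2 * m) ≤ ((1 - A) ^ (n - m)) ^ 2 * (1 + θ) := by
        have h6 : ((1 - A) ^ (n - m)) ^ 2 = ((1 - A) ^ 2) ^ (n - 2 * m) * (1 - A) ^ (2 * m) := by
          rw [← pow_mul, ← pow_mul, ← pow_add]
          congr 1
          omega
        rw [h6, mul_assoc]
        refine h1.trans (le_mul_of_one_le_right (by positivity) h2)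
      have h7 := mul_le_mul_of_nonneg_left h5
        (by positivity : 0 ≤ (n.descFactorial m : ℝ) ^ 2 * a ^ (2 * m))
      refine (le_of_eq ?_).trans (h7.trans (le_of_eq ?_))
      · ring
      · ring
    have hne : Nonempty (Fin N × Fin N) := ⟨(⟨0, by omega⟩, ⟨0, by omega⟩)⟩
    have hG : ∀ B, MeasurableSet (goodBox n N B) := fun B =>
      measurableSet_exactOccupancy (hms B) (hmc B)
    have hmain := measureReal_card_lt_le μ hG hP0 hGP hθ0 hpair
    have hcard : (Fintype.card (Fin N × Fin N) : ℝ) = N * N := by simp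
    rw [hcard] at hmain
    set T : Set (Fin n → Plane) := {x |
      ((Finset.univ.filter fun B => x ∈ goodBox n N B).card : ℝ) < N * N * P / 2} with hT
    have : Nonempty (Fin n) := ⟨⟨0, by omega⟩⟩
    have hTc : Tᶜ ⊆ {x | HasGadgets x (2 / (5 * N)) (P₀ / 8 * n)} := by
      intro x hx
      have hx : N * N * P / 2 ≤ ((Finset.univ.filter fun B => x ∈ goodBox n N B).card : ℝ) :=
        not_lt.1 hx
      obtain ⟨ι, J, u, v, Z, hJ, h⟩ := hasGadgets_of_goodBox (N := N) (by omega) x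
      refine ⟨ι, J, u, v, Z, le_trans ?_ hJ, h⟩
      refine le_trans ?_ hx
      nlinarith [mul_le_mul hnN' hPP₀ hP₀0.le (by positivity)]
    have hTb : μ.real T ≤ 4 * (4 / P₀ / n + (Real.exp (16 * m / n) - 1)) := by
      refine hmain.trans (mul_le_mul_of_nonneg_left (add_le_add_left ?_ _) (by norm_num))
      rw [div_div]
      refine (div_le_div_iff₀ (by positivity) (by positivity)).2 ?_
      nlinarith [mul_le_mul hnN' hPP₀ hP₀0.le (by positivity)]
    refine le_trans ?_ (measure_mono hTc)
    refine ENNReal.ofReal_le_of_le_toReal ?_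
    have hu := measureReal_union_le (μ := μ) T Tᶜ
    rw [Set.union_compl_self, probReal_univ, measureReal_def μ Tᶜ] at hu
    linarith

end ManyGadgets

/-! ### Colour collisions among prescribed edges. -/

section Collisions

variable {E : Type*} [Fintype E] [DecidableEq E] {q : ℕ}

theorem prob_le_sum_div {Ω : Type*} [Fintype Ω] {P : Ω → Prop} {g : Ω → ℝ} (h0 : ∀ ω, 0 ≤ g ω)
    (h : ∀ ω, P ω → 1 ≤ g ω) : prob P ≤ (∑ ω, g ω) / Fintype.card Ω := by
  classical
  rw [prob_eq_sum]
  gcongr with ω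
  split_ifs with hP
  · exact h ω hP
  · exact h0 ω

/-- It is unlikely that few elements of `H` receive a colour from the set `C`. -/
theorem prob_card_filter_lt_le (hq : 0 < q) (H : Finset E) (C : Finset (Fin q)) {s : ℝ}
    (hs : s ≤ C.card) (r : ℕ) :
    prob (fun ω : E → Fin q => (H.filter fun e => ω e ∈ C).card < r) ≤
      2 ^ r * (1 - s / (2 * q)) ^ H.card := by
  have hq' : (0 : ℝ) < q := by exact_mod_cast hq
  -- Exponential moment method: for the count `X` the mean of `2 ^ (r - X)` factorises over the
  -- coordinates.
  set f : E → Fin q → ℝ := fun e c => if e ∈ H ∧ c ∈ C then 1 / 2 else 1 with hf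
  have hfpos : ∀ e c, 0 < f e c := fun e c => by rw [hf]; positivity
  have hprod : ∀ ω : E → Fin q, ∏ e, f e (ω e) =
      (1 / 2) ^ (H.filter fun e => ω e ∈ C).card := by
    intro ω
    rw [hf, Finset.prod_ite, Finset.prod_const_one, mul_one, Finset.prod_const]
    congr 2
    ext e
    simp
  refine (prob_le_sum_div (g := fun ω => 2 ^ r * ∏ e, f e (ω e)) (fun ω => ?_) fun ω hω => ?_).trans
    ?_
  · exact mul_nonneg (by positivity) (Finset.prod_nonneg fun e _ => (hfpos _ _).le)
  · rw [hprod, one_div, inv_pow, ← div_eq_mul_inv, one_le_div (by positivity)]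
    exact pow_le_pow_right₀ (by norm_num) hω.le
  · rw [← Finset.mul_sum, mul_div_assoc]
    refine mul_le_mul_of_nonneg_left ?_ (by positivity)
    have hsum : ∑ ω : E → Fin q, ∏ e, f e (ω e) = ∏ e, ∑ c, f e c := by
      rw [Finset.prod_univ_sum, Fintype.piFinset_univ]
    have hval : ∀ e, (∑ c, f e c) / q = if e ∈ H then 1 - (C.card : ℝ) / (2 * q) else 1 := by
      intro e
      split_ifs with he
      · have : ∀ c, f e c = 1 - if c ∈ C then 1 / 2 else 0 := by
          intro c
          by_cases hc : c ∈ C <;> simp [hf, he, hc]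
          norm_num
        simp only [this, Finset.sum_sub_distrib, Finset.sum_const, Finset.sum_ite_mem,
          Finset.univ_inter, Finset.card_univ, Fintype.card_fin, nsmul_eq_mul]
        field_simp
      · simp [hf, he, hq'.ne']
    rw [hsum, Fintype.card_fun, Fintype.card_fin]
    push_cast
    rw [← Finset.card_univ (α := E), ← Finset.prod_const, ← Finset.prod_div_distrib]
    simp only [hval]
    rw [Finset.prod_ite_mem, Finset.univ_inter, Finset.prod_const]
    refine pow_le_pow_left₀ ?_ ?_ _
    · rw [sub_nonneg, div_le_one (by positivity)]
      have : (C.card : ℝ) ≤ q := by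
        exact_mod_cast (Finset.card_le_univ C).trans (by simp)
      linarith
    · gcongr

/-- Many elements are unlikely to receive almost only distinct colours. -/
theorem prob_lt_card_image_le (hq : 0 < q) {H₁ H₂ : Finset E} {h r : ℕ} (h₁ : H₁.card = h) (h₂ : H₂.card = h) (hr : 2 * r ≤ h) (hh : h ≤ 4 * q) :
    prob (fun ω : E → Fin q => 2 * h < ((H₁ ∪ H₂).image ω).card + r) ≤
      2 ^ r * (1 - (h : ℝ) / 2 / (2 * q)) ^ h := by
  have hpos : 0 ≤ 2 ^ r * (1 - (h : ℝ) / 2 / (2 * q)) ^ h := by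
    have : 0 ≤ 1 - (h : ℝ) / 2 / (2 * q) := by
      have : (h : ℝ) ≤ 4 * q := by exact_mod_cast hh
      rw [sub_nonneg]
      exact div_le_one_of_le₀ (by linarith) (by positivity)
    positivity
  have hprob : ∀ χ : E → Fin q, ¬ False →
      prob (fun ω : E → Fin q => 2 * h < ((H₁ ∪ H₂).image (H₁.piecewise χ ω)).card + r) ≤
      2 ^ r * (1 - (h : ℝ) / 2 / (2 * q)) ^ h := by
    intro χ _
    have hle : ∀ ω : E → Fin q, ((H₁ ∪ H₂).image (H₁.piecewise χ ω)).card +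
        (H₂.filter fun e => ω e ∈ H₁.image χ).card ≤ (H₁.image χ).card + h := by
      intro ω
      have hsub : (H₁ ∪ H₂).image (H₁.piecewise χ ω) ⊆
          H₁.image χ ∪ (H₂.filter fun e => ω e ∉ H₁.image χ).image ω := by
        intro c hc
        obtain ⟨e, he, rfl⟩ := Finset.mem_image.1 hc
        by_cases h1 : e ∈ H₁
        · rw [Finset.piecewise_eq_of_mem _ _ _ h1]
          exact Finset.mem_union_left _ (Finset.mem_image_of_mem _ h1)
        · rw [Finset.piecewise_eq_of_notMem _ _ _ h1]
          by_cases h3 : ω e ∈ H₁.image χ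
          · exact Finset.mem_union_left _ h3
          · exact Finset.mem_union_right _ (Finset.mem_image_of_mem _ (Finset.mem_filter.2
              ⟨(Finset.mem_union.1 he).resolve_left h1, h3⟩))
      have h4 := (Finset.card_le_card hsub).trans (Finset.card_union_le _ _)
      have h5 := Finset.card_image_le (s := H₂.filter fun e => ω e ∉ H₁.image χ) (f := ω)
      have h6 := Finset.card_filter_add_card_filter_not (s := H₂) (fun e => ω e ∈ H₁.image χ)
      omega
    -- If `H₁` shows at least `h / 2` colours, each element of `H₂` outside `H₁` repeats one of them
    -- with probability at least `h / (2 q)`. Otherwise `H₁` alone already has enough collisions.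
    by_cases hC : h ≤ 2 * (H₁.image χ).card
    · have hC' : (h : ℝ) / 2 ≤ (H₁.image χ).card := by
        have : (h : ℝ) ≤ 2 * (H₁.image χ).card := by exact_mod_cast hC
        linarith
      have := prob_card_filter_lt_le hq H₂ (H₁.image χ) hC' r
      rw [h₂] at this
      refine (prob_mono fun ω hω => ?_).trans this
      have h7 := hle ω
      have h8 := Finset.card_image_le (s := H₁) (f := χ)
      omega
    · have hzero : prob (fun ω : E → Fin q =>
          2 * h < ((H₁ ∪ H₂).image (H₁.piecewise χ ω)).card + r) ≤ 0 := by
        refine (prob_mono (Q := fun _ => False) fun ω hω => ?_).trans (by simp [prob])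
        have h7 := hle ω
        omega
      exact hzero.trans hpos
  rw [← prob_resample H₁]
  refine (prob_prod_le (B := fun _ => False) hpos hprob).trans (by simp [prob])

/-- The restriction of a colouring of all the unordered pairs to the edges. -/
def restrict {n : ℕ} (χ : Sym2 (Fin n) → Fin q) : Colouring n q := fun e => χ e

/-- A rainbow tour contains at most one edge of `F` per colour, so it misses at least `r` gadget
edges and pays `R / 96` for each. -/
theorem minTour_add_le_minRainbowTour {n : ℕ} {x : Fin n → Plane} {R : ℝ} (hn : 3 ≤ n)
    (hR : 0 < R) {ι : Type*} (J : Finset ι) (u v : ι → Fin n) (Z : ι → Finset (Fin n))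
    (hg : ∀ j ∈ J, IsGadget x R (u j) (v j) (Z j))
    (hdis : ∀ i ∈ J, ∀ j ∈ J, i ≠ j → ∀ w, (w = u i ∨ w = v i) →
      w ≠ u j ∧ w ≠ v j ∧ w ∉ Z j) {F : Finset (Sym2 (Fin n))}
    (hF : ∀ e ∈ F, ∃ j ∈ J, s(u j, v j) = e) {χ : Sym2 (Fin n) → Fin q} {r : ℕ}
    (hr : (F.image χ).card + r ≤ F.card) (hχ : HasRainbowTour (restrict χ)) :
    minTour x + r * (R / 96) ≤ minRainbowTour x (restrict χ) := by
  classical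
  refine le_minRainbowTour x _ hχ _ fun T hT hm hrain => ?_
  refine le_trans ?_ (minTour_add_le_weight hn hR J u v Z hg hdis _ T hT hm rfl)
  have h1 : (F.filter fun e => e ∈ cycleEdges T).card ≤ (F.image χ).card := by
    refine Finset.card_le_card_of_injOn χ (fun e he => ?_) fun e he f hf hef => ?_
    · exact Finset.mem_image_of_mem _ (Finset.mem_filter.1 he).1
    · have he := Finset.mem_filter.1 he
      have hf := Finset.mem_filter.1 hf
      have hedge : ∀ e ∈ F, e ∈ (K n).edgeSet := by
        intro e he
        obtain ⟨j, hj, rfl⟩ := hF e he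
        simpa using (hg j hj).ne
      exact congrArg Subtype.val (hrain ⟨e, hedge e he.1⟩ ⟨f, hedge f hf.1⟩ he.2 hf.2 hef)
  have h2 : (F.filter fun e => e ∉ cycleEdges T).card ≤
      (J.filter fun j => s(u j, v j) ∉ cycleEdges T).card := by
    refine le_trans (Finset.card_le_card fun e he => ?_)
      (Finset.card_image_le (f := fun j => s(u j, v j)))
    rw [Finset.mem_filter] at he
    obtain ⟨j, hj, rfl⟩ := hF e he.1
    exact Finset.mem_image.2 ⟨j, Finset.mem_filter.2 ⟨hj, he.2⟩, rfl⟩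
  have h3 := Finset.card_filter_add_card_filter_not (s := F) (fun e => e ∈ cycleEdges T)
  have h4 : (r : ℝ) ≤ ((J.filter fun j => s(u j, v j) ∉ cycleEdges T).card : ℕ) := by
    exact_mod_cast (by omega)
  have : 0 ≤ R / 96 := by positivity
  gcongr

end Collisions

/-! ### Choice of the parameters for the lower bound. -/

section Gap

/-- The points are fixed here and only the colouring is random. Of `2 h` gadget edges, with `h`
about `κ n / 2`, a fixed fraction collides except with probability exponentially small in `h`. -/
theorem exists_gap {ε κ : ℝ} (hε : 0 < ε) (hκ : 0 < κ) (hκ1 : κ ≤ 1) :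
    ∃ c : ℝ, 0 < c ∧ ∃ δ : ℕ → ℝ, Tendsto δ atTop (𝓝 0) ∧
      ∀ q : ℕ → ℕ, (∀ n : ℕ, |(q n : ℝ) - (1 + ε) * (n : ℝ)| < 1) →
        ∀ᶠ n : ℕ in atTop, ∀ (x : Fin n → Plane) (R : ℝ), 0 < R → 2 / 5 ≤ R * √n →
          HasGadgets x R (κ * n) →
          ENNReal.ofReal (1 - δ n) ≤ randomColouring n (q n)
            {χ | HasRainbowTour χ → c * √n ≤ minRainbowTour x χ - minTour x} := by
  classical
  set τ : ℝ := κ / (16 * (2 + ε)) with hτ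
  have hτ0 : 0 < τ := by positivity
  have hτ1 : τ < 1 := by
    rw [hτ, div_lt_one (by positivity)]
    linarith
  -- Demanding only `r = h / g` collisions makes `2 ^ r ≤ (1 + τ) ^ h`, so the failure bound is at
  -- most `((1 + τ) (1 - τ)) ^ h = η ^ h`.
  obtain ⟨g, hg⟩ := pow_unbounded_of_one_lt (2 : ℝ) (by linarith : 1 < 1 + τ)
  have hg2 : 2 ≤ g := by
    by_contra h
    have : g ≤ 1 := by omega
    have := (pow_le_pow_right₀ (by linarith : 1 ≤ 1 + τ) this)
    linarith
  have hg0 : (0 : ℝ) < g := by positivity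
  set η : ℝ := 1 - τ ^ 2 with hη
  have hη0 : 0 < η := by rw [hη]; nlinarith
  have hη1 : η < 1 := by rw [hη]; nlinarith
  have hfloor : Tendsto (fun n : ℕ => ⌊κ / 2 * n⌋₊) atTop atTop :=
    tendsto_nat_floor_atTop.comp
      (tendsto_natCast_atTop_atTop.const_mul_atTop (by positivity : 0 < κ / 2))
  -- At least `κ n / (8 g)` edges are missed, each costing `R / 96` with `R ≥ (2 / 5) / √n`.
  refine ⟨κ / (8 * g) * (2 / 5 / 96), by positivity, fun n => η ^ ⌊κ / 2 * n⌋₊,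
    (tendsto_pow_atTop_nhds_zero_of_lt_one hη0.le hη1).comp hfloor, fun q hq => ?_⟩
  filter_upwards [eventually_ge_atTop 3, eventually_ge_atTop ⌈8 * g / κ⌉₊] with n hn hnκ x R hR hRn
    ⟨ι, J, u, v, Z, hJ, hgad, hdis⟩
  have hn3 : (3 : ℝ) ≤ n := by exact_mod_cast hn
  have hnκ' : 8 * g ≤ κ * n := by
    have := Nat.ceil_le.1 hnκ
    rw [div_le_iff₀ hκ] at this
    linarith
  have hqn := abs_lt.1 (hq n)
  have hq1 : (n : ℝ) ≤ q n + 1 := by nlinarith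
  have hq2 : (q n : ℝ) ≤ (2 + ε) * n := by nlinarith
  have hq0 : 0 < q n := by
    have : (0 : ℝ) < q n := by linarith
    exact_mod_cast this
  have hq0' : (0 : ℝ) < q n := by exact_mod_cast hq0
  set h := ⌊κ / 2 * n⌋₊ with hh
  have hh1 : (h : ℝ) ≤ κ / 2 * n := Nat.floor_le (by positivity)
  have hh2 : κ / 2 * n < h + 1 := Nat.lt_floor_add_one _
  have hgg : (2 : ℝ) ≤ g := by exact_mod_cast hg2
  have hh3 : κ / 4 * n ≤ h := by linarith
  set r := h / g with hr
  have hr1 : r * g ≤ h := Nat.div_mul_le_self h g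
  have hr2 : 2 * r ≤ h := by nlinarith
  have hr3 : κ / (8 * g) * n ≤ r := by
    have h1 : h < (r + 1) * g := by
      rw [hr]
      have := Nat.lt_mul_div_succ h (by omega : 0 < g)
      rwa [mul_comm]
    have h2 : (h : ℝ) < (r + 1) * g := by exact_mod_cast h1
    rw [div_mul_eq_mul_div, div_le_iff₀ (by positivity)]
    linarith
  -- the edges of the gadgets
  have hinj : Set.InjOn (fun i => s(u i, v i)) (J : Set ι) := by
    intro i hi i' hi' h
    by_contra hne
    have h1 := hdis i hi i' hi' hne (u i) (Or.inl rfl)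
    rcases Sym2.eq_iff.1 h with ⟨h, _⟩ | ⟨h, _⟩
    · exact h1.1 h
    · exact h1.2.1 h
  have hcard : 2 * h ≤ (J.image fun j => s(u j, v j)).card := by
    rw [Finset.card_image_of_injOn hinj]
    have : ((2 * h : ℕ) : ℝ) ≤ J.card := by push_cast; linarith
    exact_mod_cast this
  obtain ⟨F, hFJ, hFc⟩ := Finset.exists_subset_card_eq hcard
  obtain ⟨H₁, hH₁, hH₁c⟩ := Finset.exists_subset_card_eq (by omega : h ≤ F.card)
  have hH₂c : (F \ H₁).card = h := by
    rw [Finset.card_sdiff_of_subset hH₁]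
    omega
  have hhq : h ≤ 4 * q n := by
    have : (h : ℝ) ≤ ((4 * q n : ℕ) : ℝ) := by push_cast; nlinarith
    exact_mod_cast this
  have hprob := prob_lt_card_image_le hq0 hH₁c hH₂c hr2 hhq
  rw [Finset.union_sdiff_of_subset hH₁] at hprob
  have hbound : (2 : ℝ) ^ r * (1 - (h : ℝ) / 2 / (2 * q n)) ^ h ≤ η ^ h := by
    have h1 : (2 : ℝ) ^ r ≤ (1 + τ) ^ h := by
      refine (pow_le_pow_left₀ (by norm_num) hg.le r).trans ?_
      rw [← pow_mul, mul_comm]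
      exact pow_le_pow_right₀ (by linarith) hr1
    have h2 : τ ≤ (h : ℝ) / 2 / (2 * q n) := by
      rw [div_div, hτ, div_le_div_iff₀ (by positivity) (by positivity)]
      have h3 := mul_le_mul_of_nonneg_left hq2 hκ.le
      have h4 := mul_le_mul_of_nonneg_right hh3 (by positivity : 0 ≤ 16 * (2 + ε))
      linarith
    have h3 : 0 ≤ 1 - (h : ℝ) / 2 / (2 * q n) := by
      have : (h : ℝ) ≤ 4 * q n := by exact_mod_cast hhq
      rw [sub_nonneg]
      exact div_le_one_of_le₀ (by linarith) (by positivity)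
    refine (mul_le_mul h1 (pow_le_pow_left₀ h3 (by linarith : _ ≤ 1 - τ) h) (by positivity)
      (by positivity)).trans (le_of_eq ?_)
    rw [← mul_pow, hη]
    congr 1
    ring
  refine le_trans (ENNReal.ofReal_le_ofReal ?_) (le_randomColouring hq0
    (P := fun χ => (F.image χ).card + r ≤ F.card) fun χ hχ => ?_)
  · refine sub_le_sub_left (le_trans (prob_mono fun χ hχ => ?_) (hprob.trans hbound)) _
    omega
  · intro hrain
    have := minTour_add_le_minRainbowTour hn hR J u v Z hgad hdis
      (fun e he => Finset.mem_image.1 (hFJ he)) hχ hrain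
    change _ ≤ minRainbowTour x (restrict χ) - _
    have h5 : κ / (8 * g) * (2 / 5 / 96) * √n ≤ r * (R / 96) := by
      have h6 : κ / (8 * g) * (√n * √n) ≤ r := by
        rwa [Real.mul_self_sqrt (by positivity)]
      have h7 : κ / (8 * g) * √n * (2 / 5) ≤ κ / (8 * g) * √n * (R * √n) := by gcongr
      have h8 := mul_le_mul_of_nonneg_right h6 hR.le
      have h9 : κ / (8 * g) * (√n * √n) * R = κ / (8 * g) * √n * (R * √n) := by ring
      rw [h9] at h8
      linarith
    linarith

end Gap

/-! ### Combining the estimates on the product space. -/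

section Main

theorem HasGadgets.mono {n : ℕ} {x : Fin n → Plane} {R k k' : ℝ} (h : HasGadgets x R k)
    (hk : k' ≤ k) : HasGadgets x R k' := by
  obtain ⟨ι, J, u, v, Z, hJ, h⟩ := h
  exact ⟨ι, J, u, v, Z, hk.trans hJ, h⟩

theorem ofReal_le_measure_inter {Ω : Type*} [MeasurableSpace Ω] [Finite Ω]
    [MeasurableSingletonClass Ω] (μ : Measure Ω) [IsProbabilityMeasure μ] {S T : Set Ω} {a b : ℝ}
    (ha : ENNReal.ofReal a ≤ μ S) (hb : ENNReal.ofReal b ≤ μ T) :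
    ENNReal.ofReal (a + b - 1) ≤ μ (S ∩ T) := by
  have hS : a ≤ μ.real S := (ENNReal.ofReal_le_iff_le_toReal (measure_ne_top μ S)).1 ha
  have hT : b ≤ μ.real T := (ENNReal.ofReal_le_iff_le_toReal (measure_ne_top μ T)).1 hb
  refine ENNReal.ofReal_le_of_le_toReal ?_
  have h1 := measureReal_union_add_inter (μ := μ) (s := S) (t := T) T.toFinite.measurableSet
  have h2 : μ.real (S ∪ T) ≤ 1 := measureReal_le_one
  rw [measureReal_def μ (S ∩ T)] at h1
  linarith

theorem tendsto_ofReal_one_sub {δ : ℕ → ℝ} (h : Tendsto δ atTop (𝓝 0)) :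
    Tendsto (fun n => ENNReal.ofReal (1 - δ n)) atTop (𝓝 1) := by
  have := ENNReal.tendsto_ofReal (h.const_sub 1)
  simpa using this

theorem randomColouring_le_one {n q : ℕ} (hq : 0 < q) (S : Set (Colouring n q)) :
    randomColouring n q S ≤ 1 :=
  have : NeZero q := ⟨hq.ne'⟩
  MeasureTheory.prob_le_one

theorem euclideanModel_le_one {n q : ℕ} (hq : 0 < q) (S : Set ((Fin n → Plane) × Colouring n q)) :
    euclideanModel n q S ≤ 1 := by
  have : NeZero q := ⟨hq.ne'⟩
  rw [euclideanModel]
  exact MeasureTheory.prob_le_one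

theorem mul_le_euclideanModel {n q : ℕ} (S : Set ((Fin n → Plane) × Colouring n q))
    (A : Set (Fin n → Plane)) (δ : ENNReal)
    (h : ∀ x ∈ A, δ ≤ randomColouring n q {χ | (x, χ) ∈ S}) :
    δ * (Measure.pi fun _ : Fin n => uniformSquare) A ≤ euclideanModel n q S := by
  have : SFinite (randomColouring n q) := by rw [randomColouring]; infer_instance
  exact mul_le_prod_apply _ _ S A δ h

end Main

end RainbowTour

end

theorem theorem2 (ε : ℝ) (hε : 0 < ε) :
    ∃ C : ℝ, 0 < C ∧ ∃ c : ℝ, 0 < c ∧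
      -- the number of colours is `(1 + ε) n`, rounded up or down to an integer
      ∀ q : ℕ → ℕ, (∀ n : ℕ, |(q n : ℝ) - (1 + ε) * (n : ℝ)| < 1) →
        -- (a) for random points
        Tendsto
          (fun n : ℕ => RainbowTour.euclideanModel n (q n)
            {ω | RainbowTour.HasRainbowTour ω.2 ∧
              RainbowTour.minRainbowTour ω.1 ω.2 ≤ C * (Real.sqrt n * Real.log n)})
          atTop (𝓝 1) ∧
        -- (a) for arbitrary points
        (∀ x : (n : ℕ) → Fin n → RainbowTour.Plane,
          (∀ n i, x n i ∈ RainbowTour.unitSquare) →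
          Tendsto
            (fun n : ℕ => RainbowTour.randomColouring n (q n)
              {χ | RainbowTour.HasRainbowTour χ ∧
                RainbowTour.minRainbowTour (x n) χ ≤ C * (Real.sqrt n * Real.log n)})
            atTop (𝓝 1)) ∧
        -- (b)
        Tendsto
          (fun n : ℕ => RainbowTour.euclideanModel n (q n)
            {ω | RainbowTour.HasRainbowTour ω.2 ∧
              c * Real.sqrt n ≤
                RainbowTour.minRainbowTour ω.1 ω.2 - RainbowTour.minTour ω.1})
          atTop (𝓝 1) := by
  obtain ⟨C, hC, hshort⟩ := RainbowTour.exists_short_rainbowTour ε hε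
  obtain ⟨κ, hκ, f, hf, hmany⟩ := RainbowTour.exists_hasGadgets
  obtain ⟨c, hc, δ, hδ, hgap⟩ := RainbowTour.exists_gap hε (lt_min hκ one_pos) (min_le_right κ 1)
  refine ⟨C, hC, c, hc, fun q hq => ⟨?_, fun x hx => ?_, ?_⟩⟩
  · refine RainbowTour.tendsto_measure_one ?_
      (RainbowTour.tendsto_ofReal_one_sub (tendsto_const_div_atTop_nhds_zero_nat 3)) ?_
    · filter_upwards [hshort q hq] with n hn
      exact RainbowTour.euclideanModel_le_one hn.1 _
    · filter_upwards [hshort q hq] with n hn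
      refine le_trans ?_ (RainbowTour.mul_le_euclideanModel _
        {x | ∀ i, x i ∈ RainbowTour.unitSquare} _ fun x hx => hn.2 x hx)
      rw [RainbowTour.pi_unitSquare, mul_one]
  · refine RainbowTour.tendsto_measure_one ?_
      (RainbowTour.tendsto_ofReal_one_sub (tendsto_const_div_atTop_nhds_zero_nat 3)) ?_
    · filter_upwards [hshort q hq] with n hn
      exact RainbowTour.randomColouring_le_one hn.1 _
    · filter_upwards [hshort q hq] with n hn
      exact hn.2 (x n) (hx n)
  · have hδ' : Tendsto (fun n : ℕ => 3 / (n : ℝ) + δ n) atTop (𝓝 0) := by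
      simpa using (tendsto_const_div_atTop_nhds_zero_nat 3).add hδ
    have hlim := ENNReal.Tendsto.mul (RainbowTour.tendsto_ofReal_one_sub hδ') (by simp)
      (ENNReal.tendsto_ofReal hf) (by simp)
    rw [ENNReal.ofReal_one, mul_one] at hlim
    refine RainbowTour.tendsto_measure_one ?_ hlim ?_
    · filter_upwards [hshort q hq] with n hn
      exact RainbowTour.euclideanModel_le_one hn.1 _
    · filter_upwards [hshort q hq, hmany, hgap q hq] with n hn ⟨R, hRn, hR, hfn⟩ hgn
      refine (mul_le_mul_right hfn _).trans
        (RainbowTour.mul_le_euclideanModel _ _ _ fun x hx => ?_)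
      have : NeZero (q n) := ⟨hn.1.ne'⟩
      -- Existence of a rainbow tour does not depend on the points, so it may be read off from any
      -- configuration in the square; thus `x` need not be assumed to lie there.
      have h1 := hn.2 (fun _ => 0) fun _ _ => by simp
      have h2 := hgn x R hR hRn
        (hx.mono (mul_le_mul_of_nonneg_right (min_le_left κ 1) (Nat.cast_nonneg n)))
      refine le_trans (le_of_eq ?_) ((RainbowTour.ofReal_le_measure_inter _ h1 h2).trans
        (measure_mono fun χ hχ => ⟨hχ.1.1, hχ.2 hχ.1.1⟩))
      congr 1
      ring
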